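/- **Setting.** Let $\Omega\subset\mathbb{R}^2$ be a polygonal domain with a finite conforming triangulation $\mathcal{T}_H$ of closed non-degenerate triangles $T$, with $\operatorname{diam}T\le H$ and, for all $T,T'\in\mathcal{T}_H$, $H\le\gamma d_T$ and $d_{T'}\le\gamma d_T$, where $d_T$ is the diameter of the inscribed circle of $T$. Let the interface $\Gamma$ be a union of finitely many regular $C^1$ arcs, parametrized by arc length, whose interiors lie in $\Omega$ and any two of which meet in at most finitely many points (they may end on $\partial\Omega$, intersect, or be immersed in $\Omega$). Let $V$ be the space of all $v\in H^1_0(\Omega)$ whose trace on $\Gamma$ is continuous on $\Gamma$ and belongs to $H^1$ of each arc; $\nabla_\tau v$ is the tangential gradient. For a set $S$, $\|\cdot\|_S$ denotes the $L^2$ norm over $S\cap\Omega$, and $\|\cdot\|_{\Gamma\cap S}$ the $L^2$ norm with respect to arc length. Let $A$ on $\Omega$ and $A_\Gamma$ on $\Gamma$ be measurable with $0<\alpha\le A,A_\Gamma\le\beta<\infty$ almost everywhere, and put, for a set $S$, $$a_S(v,w)=\int_{S\cap\Omega}A\nabla v\cdot\nabla w+\int_{\Gamma\cap S}A_\Gamma\nabla_\tau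 v\cdot\nabla_\tau w,\qquad a=a_\Omega\ \text{ (with the whole of }\Gamma).$$ Let $U(S)$ be the union of all $T\in\mathcal{T}_H$ with $T\cap S\ne\emptyset$, and $U^k=U\circ\dots\circ U$ ($k$ times). Let $V_H$ be the space of continuous functions that are affine on each $T\in\mathcal{T}_H$ and vanish on $\partial\Omega$, and let $\mathcal{I}_H:V\to V_H$ be a linear projection onto $V_H$ such that, for all $v\in V$ and $T\in\mathcal{T}_H$, $$\|v-\mathcal{I}_Hv\|_T+\|v-\mathcal{I}_Hv\|_{\Gamma\cap T}\le C_{\mathcal I}H\left(\|\nabla v\|_{U(T)}+\|\nabla_\tau v\|_{\Gamma\cap U(T)}\right),$$ $$\|\nabla\mathcal{I}_Hv\|_T+\|\nabla_\tau\mathcal{I}_Hv\|_{\Gamma\cap T}\le C_{\mathcal I}\left(\|\nabla v\|_{U(T)}+\|\nabla_\tau v\|_{\Gamma\cap U(T)}\right).$$ Put $V_{\mathrm f}=\ker\mathcal{I}_H$ and $V_{\mathrm f}(U^k(T))=\{w\in V_{\mathrm f}:\operatorname{supp}w\subset U^k(T)\}$. For $v\in V_H$ let $Qv=\sum_{T}\phi_T$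 and $Q_kv=\sum_T\phi_T^k$, where $\phi_T\in V_{\mathrm f}$ and $\phi_T^k\in V_{\mathrm f}(U^k(T))$ are the solutions of $$a(\phi_T,w)=a_T(v,w)\ \ \forall w\in V_{\mathrm f},\qquad a_{U^k(T)}(\phi_T^k,w)=a_T(v,w)\ \ \forall w\in V_{\mathrm f}(U^k(T)).$$ **Theorem (global truncation error).** There are constants $C,c>0$, depending only on $\alpha,\beta,\gamma$ and $C_{\mathcal I}$, such that for every such configuration, every $v\in V_H$ and every integer $k\ge7$, the correctors $\phi_T$, $\phi_T^k$ exist and are unique for every $T\in\mathcal{T}_H$, and $$\|\nabla(Qv-Q_kv)\|_\Omega+\|\nabla_\tau(Qv-Q_kv)\|_\Gamma\le C\,k^{1/2}e^{-ck}\left(\|\nabla v\|_\Omega+\|\nabla_\tau v\|_\Gamma\right).$$ -/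

import Mathlib

open MeasureTheory Set
open scoped ContDiff

noncomputable section

namespace LOD

/-- The Euclidean plane. -/
abbrev Plane := EuclideanSpace ℝ (Fin 2)

/-! ### Triangulations -/

/-- The closed triangle with vertex set `t`. -/
def tri (t : Finset Plane) : Set Plane := convexHull ℝ (t : Set Plane)

/-- A conforming triangulation, consisting of finitely many closed non-degenerate triangles (given
by their vertex sets), of the polygonal domain `Ω`. Two elements meet exactly in the convex hull of
their common vertices, that is in nothing, a vertex, an edge, or everything. -/
structure Triangulation (Ω : Set Plane) where
  elems : Finset (Finset Plane)
  card_eq : ∀ t ∈ elems, t.card = 3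
  indep : ∀ t ∈ elems, AffineIndependent ℝ ((↑) : t → Plane)
  conforming : ∀ s ∈ elems, ∀ t ∈ elems,
    tri s ∩ tri t = convexHull ℝ ((s : Set Plane) ∩ (t : Set Plane))
  domain_eq : Ω = interior (⋃ t ∈ elems, tri t)

/-- The diameter of the inscribed circle of the triangle `t`, i.e. of the largest disc contained
in it. -/
def inDiam (t : Finset Plane) : ℝ :=
  sSup {d : ℝ | 0 ≤ d ∧ ∃ c : Plane, Metric.closedBall c (d / 2) ⊆ tri t}

/-- `𝒯` is quasi-uniform and shape regular, with mesh size `H` and constant `γ`. -/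
structure QuasiUniform {Ω : Set Plane} (𝒯 : Triangulation Ω) (H γ : ℝ) : Prop where
  pos : 0 < H
  diam_le : ∀ t ∈ 𝒯.elems, Metric.diam (tri t) ≤ H
  le_inDiam : ∀ t ∈ 𝒯.elems, H ≤ γ * inDiam t
  inDiam_le : ∀ t ∈ 𝒯.elems, ∀ t' ∈ 𝒯.elems, inDiam t' ≤ γ * inDiam t

/-- The element neighbour operator `U(S)`. -/
def nbhd {Ω : Set Plane} (𝒯 : Triangulation Ω) (S : Set Plane) : Set Plane :=
  ⋃ t ∈ 𝒯.elems, ⋃ _ : (tri t ∩ S).Nonempty, tri t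

/-- The patch `U^k(T)` of the element `T` with vertex set `t`. -/
def patch {Ω : Set Plane} (𝒯 : Triangulation Ω) (k : ℕ) (t : Finset Plane) : Set Plane :=
  (nbhd 𝒯)^[k] (tri t)

/-! ### Interfaces -/

/-- A network of finitely many `C¹` arcs in `Ω`, parametrized by arc length. The arcs may end on
the boundary of `Ω` or be immersed in `Ω`, and any two of them meet in finitely many points. -/
structure Interface (Ω : Set Plane) where
  n : ℕ
  len : Fin n → ℝ
  arc : Fin n → ℝ → Plane
  len_pos : ∀ i, 0 < len i
  contDiff : ∀ i, ContDiffOn ℝ 1 (arc i) (Icc 0 (len i))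
  unit_speed : ∀ i, ∀ s ∈ Icc 0 (len i), ‖derivWithin (arc i) (Icc 0 (len i)) s‖ = 1
  injOn : ∀ i, InjOn (arc i) (Icc 0 (len i))
  mapsTo : ∀ i, MapsTo (arc i) (Ioo 0 (len i)) Ω
  finite_inter : ∀ i j, i ≠ j →
    (arc i '' Icc 0 (len i) ∩ arc j '' Icc 0 (len j)).Finite

/-- The set `Γ`, the union of the arcs. -/
def Interface.carrier {Ω : Set Plane} (Γ : Interface Ω) : Set Plane :=
  ⋃ i, Γ.arc i '' Icc 0 (Γ.len i)

/-- The set of arc-length parameters of the part of the `i`-th arc that lies in `S`. -/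
def Interface.params {Ω : Set Plane} (Γ : Interface Ω) (i : Fin Γ.n) (S : Set Plane) : Set ℝ :=
  Ioo 0 (Γ.len i) ∩ Γ.arc i ⁻¹' S

/-! ### The function space -/

/-- `L²(Ω)`. -/
abbrev BulkL2 (Ω : Set Plane) := Lp ℝ 2 (volume.restrict Ω : Measure Plane)

/-- Square integrable vector fields on `Ω`. -/
abbrev BulkL2Vec (Ω : Set Plane) := Lp Plane 2 (volume.restrict Ω : Measure Plane)

/-- `L²(Γ)`, arc by arc, with respect to arc length. -/
abbrev InterfaceL2 {Ω : Set Plane} (Γ : Interface Ω) :=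
  ∀ i : Fin Γ.n, Lp ℝ 2 (volume.restrict (Ioo 0 (Γ.len i)) : Measure ℝ)

/-- The triples `(φ, ∇φ, φ|_Γ)` with `φ` smooth and compactly supported in `Ω`. -/
def smoothGraph (Ω : Set Plane) (Γ : Interface Ω) :
    Submodule ℝ (BulkL2 Ω × BulkL2Vec Ω × InterfaceL2 Γ) where
  carrier := {y | ∃ φ : Plane → ℝ, ContDiff ℝ ∞ φ ∧ HasCompactSupport φ ∧ tsupport φ ⊆ Ω ∧
    y.1 =ᵐ[volume.restrict Ω] φ ∧ y.2.1 =ᵐ[volume.restrict Ω] gradient φ ∧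
    ∀ i, y.2.2 i =ᵐ[volume.restrict (Ioo 0 (Γ.len i))] fun s => φ (Γ.arc i s)}
  zero_mem' := by
    refine ⟨fun _ => 0, contDiff_const, HasCompactSupport.zero, ?_, Lp.coeFn_zero _ _ _, ?_,
      fun i => Lp.coeFn_zero _ _ _⟩
    · have : tsupport (fun _ : Plane => (0 : ℝ)) = ∅ := by
        rw [tsupport_eq_empty_iff]; rfl
      rw [this]; exact empty_subset _
    · refine (Lp.coeFn_zero Plane 2 _).trans (Filter.Eventually.of_forall fun x => ?_)
      simp [gradient]
  add_mem' := by
    rintro a b ⟨φ, h1, h2, h3, h4, h5, h6⟩ ⟨ψ, k1, k2, k3, k4, k5, k6⟩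
    refine ⟨φ + ψ, h1.add k1, h2.add k2, ?_, ?_, ?_, fun i => ?_⟩
    · exact (tsupport_add φ ψ).trans (union_subset h3 k3)
    · filter_upwards [Lp.coeFn_add a.1 b.1, h4, k4] with x e1 e2 e3
      rw [Prod.fst_add, e1, Pi.add_apply, e2, e3, Pi.add_apply]
    · filter_upwards [Lp.coeFn_add a.2.1 b.2.1, h5, k5] with x e1 e2 e3
      rw [Prod.snd_add, Prod.fst_add, e1, Pi.add_apply, e2, e3]
      simp only [gradient]
      rw [fderiv_add (h1.differentiable (by simp) x) (k1.differentiable (by simp) x), map_add]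
    · filter_upwards [Lp.coeFn_add (a.2.2 i) (b.2.2 i), h6 i, k6 i] with x e1 e2 e3
      rw [Prod.snd_add, Prod.snd_add, Pi.add_apply, e1, Pi.add_apply, e2, e3, Pi.add_apply]
  smul_mem' := by
    rintro c a ⟨φ, h1, h2, h3, h4, h5, h6⟩
    refine ⟨c • φ, h1.const_smul c, h2.smul_left (f := fun _ => c), ?_, ?_, ?_, fun i => ?_⟩
    · exact (tsupport_smul_subset_right (fun _ => c) φ).trans h3
    · filter_upwards [Lp.coeFn_smul c a.1, h4] with x e1 e2
      rw [Prod.smul_fst, e1, Pi.smul_apply, e2, Pi.smul_apply]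
    · filter_upwards [Lp.coeFn_smul c a.2.1, h5] with x e1 e2
      rw [Prod.smul_snd, Prod.smul_fst, e1, Pi.smul_apply, e2]
      simp only [gradient]
      rw [fderiv_const_smul (h1.differentiable (by simp) x), map_smulₛₗ]
      simp
    · filter_upwards [Lp.coeFn_smul c (a.2.2 i), h6 i] with x e1 e2
      rw [Prod.smul_snd, Prod.smul_snd, Pi.smul_apply, e1, Pi.smul_apply, e2, Pi.smul_apply]

/-- The triples `(u, ∇u, u|_Γ)` with `u ∈ H¹₀(Ω)` (the `H¹`-closure of the smooth functions with
compact support in `Ω`) and `u|_Γ` its trace on `Γ`. The trace operator is the continuous extension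
of the restriction of smooth functions, so that its graph is the closure of their graph. -/
def H10WithTrace (Ω : Set Plane) (Γ : Interface Ω) :
    Submodule ℝ (BulkL2 Ω × BulkL2Vec Ω × InterfaceL2 Γ) :=
  (smoothGraph Ω Γ).topologicalClosure

/-- `h` is the weak derivative of `g` on the interval `(0, L)`. -/
def IsWeakDeriv (L : ℝ) (g h : ℝ → ℝ) : Prop :=
  ∀ ψ : ℝ → ℝ, ContDiff ℝ ∞ ψ → HasCompactSupport ψ → tsupport ψ ⊆ Ioo 0 L →
    ∫ s in Ioo 0 L, g s * deriv ψ s = -∫ s in Ioo 0 L, h s * ψ s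

theorem integrable_mul_test {L : ℝ} (g : Lp ℝ 2 (volume.restrict (Ioo 0 L) : Measure ℝ))
    {ψ : ℝ → ℝ} (hψ : Continuous ψ) (hc : HasCompactSupport ψ) :
    Integrable (fun s => g s * ψ s) (volume.restrict (Ioo 0 L)) :=
  MemLp.integrable_mul (p := 2) (q := 2) (Lp.memLp g)
    ((hψ.memLp_of_hasCompactSupport (p := 2) hc).restrict _)

/-- The space `V`. Its elements are represented by the quadruples `(u, ∇u, u|_Γ, ∇_τ u)` where
`u ∈ H¹₀(Ω)`, and where the trace `u|_Γ` is continuous on `Γ` and has on each arc a square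
integrable weak derivative `∇_τ u` with respect to arc length. The last three entries are determined
by the first one. -/
def V (Ω : Set Plane) (Γ : Interface Ω) :
    Submodule ℝ ((BulkL2 Ω × BulkL2Vec Ω × InterfaceL2 Γ) × InterfaceL2 Γ) where
  carrier := {x | x.1 ∈ H10WithTrace Ω Γ ∧
    (∀ i, IsWeakDeriv (Γ.len i) (x.1.2.2 i) (x.2 i)) ∧
    ∃ w : Plane → ℝ, ContinuousOn w Γ.carrier ∧
      ∀ i, x.1.2.2 i =ᵐ[volume.restrict (Ioo 0 (Γ.len i))] fun s => w (Γ.arc i s)}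
  zero_mem' := by
    refine ⟨Submodule.zero_mem _, fun i ψ _ _ _ => ?_, fun _ => 0, continuousOn_const,
      fun i => Lp.coeFn_zero _ _ _⟩
    have e : ((0 : Lp ℝ 2 (volume.restrict (Ioo 0 (Γ.len i)) : Measure ℝ)) : ℝ → ℝ)
        =ᵐ[volume.restrict (Ioo 0 (Γ.len i))] 0 := Lp.coeFn_zero _ _ _
    have e1 : ∀ χ : ℝ → ℝ, ∫ s in Ioo 0 (Γ.len i),
        (0 : Lp ℝ 2 (volume.restrict (Ioo 0 (Γ.len i)) : Measure ℝ)) s * χ s = 0 := by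
      intro χ
      apply integral_eq_zero_of_ae
      filter_upwards [e] with s hs
      rw [Pi.zero_apply]
      exact mul_eq_zero_of_left hs _
    change ∫ s in Ioo 0 (Γ.len i),
        (0 : Lp ℝ 2 (volume.restrict (Ioo 0 (Γ.len i)) : Measure ℝ)) s * deriv ψ s =
      -∫ s in Ioo 0 (Γ.len i),
        (0 : Lp ℝ 2 (volume.restrict (Ioo 0 (Γ.len i)) : Measure ℝ)) s * ψ s
    rw [e1, e1, neg_zero]
  add_mem' := by
    rintro a b ⟨h1, h2, w, h3, h4⟩ ⟨k1, k2, z, k3, k4⟩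
    refine ⟨Submodule.add_mem _ h1 k1, fun i ψ p1 p2 p3 => ?_, w + z, h3.add k3, fun i => ?_⟩
    · have key : ∀ (f g : Lp ℝ 2 (volume.restrict (Ioo 0 (Γ.len i)) : Measure ℝ)) (χ : ℝ → ℝ),
          Continuous χ → HasCompactSupport χ →
          ∫ s in Ioo 0 (Γ.len i), (f + g) s * χ s =
          (∫ s in Ioo 0 (Γ.len i), f s * χ s) + ∫ s in Ioo 0 (Γ.len i), g s * χ s := by
        intro f g χ c1 c2
        rw [← integral_add (integrable_mul_test f c1 c2) (integrable_mul_test g c1 c2)]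
        apply integral_congr_ae
        filter_upwards [Lp.coeFn_add f g] with s hs
        rw [hs, Pi.add_apply, add_mul]
      have := key (a.1.2.2 i) (b.1.2.2 i) (deriv ψ) (p1.continuous_deriv (by simp)) p2.deriv
      have t := key (a.2 i) (b.2 i) ψ p1.continuous p2
      have e1 := h2 i ψ p1 p2 p3
      have e2 := k2 i ψ p1 p2 p3
      change ∫ s in Ioo 0 (Γ.len i), (a.1.2.2 i + b.1.2.2 i) s * deriv ψ s =
        -∫ s in Ioo 0 (Γ.len i), (a.2 i + b.2 i) s * ψ s
      rw [this, t, e1, e2]; ring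
    · filter_upwards [Lp.coeFn_add (a.1.2.2 i) (b.1.2.2 i), h4 i, k4 i] with s e1 e2 e3
      change (a.1.2.2 i + b.1.2.2 i) s = _
      rw [e1, Pi.add_apply, e2, e3, Pi.add_apply]
  smul_mem' := by
    rintro c a ⟨h1, h2, w, h3, h4⟩
    refine ⟨Submodule.smul_mem _ c h1, fun i ψ p1 p2 p3 => ?_, fun x => c * w x,
      continuousOn_const.mul h3, fun i => ?_⟩
    · have key : ∀ (f : Lp ℝ 2 (volume.restrict (Ioo 0 (Γ.len i)) : Measure ℝ)) (χ : ℝ → ℝ),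
          ∫ s in Ioo 0 (Γ.len i), (c • f) s * χ s =
          c * ∫ s in Ioo 0 (Γ.len i), f s * χ s := by
        intro f χ
        rw [← integral_const_mul]
        apply integral_congr_ae
        filter_upwards [Lp.coeFn_smul c f] with s hs
        rw [hs, Pi.smul_apply, smul_eq_mul, mul_assoc]
      change ∫ s in Ioo 0 (Γ.len i), (c • a.1.2.2 i) s * deriv ψ s =
        -∫ s in Ioo 0 (Γ.len i), (c • a.2 i) s * ψ s
      rw [key, key, h2 i ψ p1 p2 p3]; ring
    · filter_upwards [Lp.coeFn_smul c (a.1.2.2 i), h4 i] with s e1 e2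
      change (c • a.1.2.2 i) s = _
      rw [e1, Pi.smul_apply, e2, smul_eq_mul]

section Components

variable {Ω : Set Plane} {Γ : Interface Ω}

/-- The function `v` on `Ω`. -/
def val (v : V Ω Γ) : BulkL2 Ω := v.1.1.1

/-- The gradient `∇v` on `Ω`. -/
def grad (v : V Ω Γ) : BulkL2Vec Ω := v.1.1.2.1

/-- The trace of `v` on `Γ`. -/
def trace (v : V Ω Γ) : InterfaceL2 Γ := v.1.1.2.2

/-- The tangential gradient `∇_τ v` on `Γ`, as its component along the unit tangent. -/
def tgrad (v : V Ω Γ) : InterfaceL2 Γ := v.1.2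

/-- `‖v‖_S`, the `L²` norm on `S ∩ Ω`. -/
def normOn (S : Set Plane) (v : V Ω Γ) : ℝ := √(∫ x in S ∩ Ω, (val v x) ^ 2)

/-- `‖∇v‖_S`, the `L²` norm on `S ∩ Ω`. -/
def gradNormOn (S : Set Plane) (v : V Ω Γ) : ℝ := √(∫ x in S ∩ Ω, ‖grad v x‖ ^ 2)

/-- `‖v‖_{Γ ∩ S}`, the `L²` norm with respect to arc length. -/
def traceNormOn (S : Set Plane) (v : V Ω Γ) : ℝ :=
  √(∑ i, ∫ s in Γ.params i S, (trace v i s) ^ 2)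

/-- `‖∇_τ v‖_{Γ ∩ S}`, the `L²` norm with respect to arc length. -/
def tgradNormOn (S : Set Plane) (v : V Ω Γ) : ℝ :=
  √(∑ i, ∫ s in Γ.params i S, (tgrad v i s) ^ 2)

/-- `∫_{S ∩ Ω} A ∇v · ∇w + ∫_{Γ ∩ S} A_Γ ∇_τ v · ∇_τ w`. With `S = univ` this is `a(v, w)`, with
`S = T` it is `a_T(v, w)`, and with `S = U^k(T)` it is the bilinear form on the patch. -/
def form (A AΓ : Plane → ℝ) (S : Set Plane) (v w : V Ω Γ) : ℝ :=
  (∫ x in S ∩ Ω, A x * inner ℝ (grad v x) (grad w x)) +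
    ∑ i, ∫ s in Γ.params i S, AΓ (Γ.arc i s) * (tgrad v i s * tgrad w i s)

/-- `A` and `A_Γ` are measurable and take values in `[α, β]` almost everywhere, on `Ω` with respect
to area and on `Γ` with respect to arc length. -/
structure IsPermeability (Γ : Interface Ω) (A AΓ : Plane → ℝ) (α β : ℝ) : Prop where
  bulk_meas : AEStronglyMeasurable A (volume.restrict Ω)
  bulk_bound : ∀ᵐ x ∂(volume.restrict Ω : Measure Plane), α ≤ A x ∧ A x ≤ β
  interface_meas : ∀ i, AEStronglyMeasurable (fun s => AΓ (Γ.arc i s))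
    (volume.restrict (Ioo 0 (Γ.len i)))
  interface_bound : ∀ i, ∀ᵐ s ∂(volume.restrict (Ioo 0 (Γ.len i)) : Measure ℝ),
    α ≤ AΓ (Γ.arc i s) ∧ AΓ (Γ.arc i s) ≤ β

/-- `v` belongs to the coarse space `V_H`: it is a continuous function on the closure of `Ω` which
is affine on each element and vanishes on the boundary of `Ω`. -/
def IsCoarse (𝒯 : Triangulation Ω) (v : V Ω Γ) : Prop :=
  ∃ p : Plane → ℝ, ContinuousOn p (closure Ω) ∧ (∀ x ∈ frontier Ω, p x = 0) ∧
    (∀ t ∈ 𝒯.elems, ∃ f : Plane →ᵃ[ℝ] ℝ, ∀ x ∈ tri t, p x = f x) ∧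
    val v =ᵐ[volume.restrict Ω] p

/-- `I` is a linear projection of `V` onto the coarse space, with the local error bound and the
local `H¹` stability bound with constant `C`. -/
structure IsInterpolation (𝒯 : Triangulation Ω) (H C : ℝ) (I : V Ω Γ →ₗ[ℝ] V Ω Γ) : Prop where
  coarse : ∀ v, IsCoarse 𝒯 (I v)
  proj : ∀ v, IsCoarse 𝒯 v → I v = v
  error : ∀ v, ∀ t ∈ 𝒯.elems,
    normOn (tri t) (v - I v) + traceNormOn (tri t) (v - I v) ≤
      C * H * (gradNormOn (nbhd 𝒯 (tri t)) v + tgradNormOn (nbhd 𝒯 (tri t)) v)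
  stability : ∀ v, ∀ t ∈ 𝒯.elems,
    gradNormOn (tri t) (I v) + tgradNormOn (tri t) (I v) ≤
      C * (gradNormOn (nbhd 𝒯 (tri t)) v + tgradNormOn (nbhd 𝒯 (tri t)) v)

/-- The support of `v`, as a function on `Ω` and on `Γ`, is contained in the closed set `S`. -/
def SupportedIn (S : Set Plane) (v : V Ω Γ) : Prop :=
  (∀ᵐ x ∂(volume.restrict Ω : Measure Plane), x ∉ S → val v x = 0) ∧
    ∀ i, ∀ᵐ s ∂(volume.restrict (Ioo 0 (Γ.len i)) : Measure ℝ),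
      Γ.arc i s ∉ S → trace v i s = 0

/-- `φ` is the corrector `φ_T` of `v` for the element `T` with vertex set `t`. The fine space `V_f`
is the kernel of `I`. -/
def IsCorrector (A AΓ : Plane → ℝ) (I : V Ω Γ →ₗ[ℝ] V Ω Γ) (t : Finset Plane)
    (v φ : V Ω Γ) : Prop :=
  I φ = 0 ∧ ∀ w, I w = 0 → form A AΓ univ φ w = form A AΓ (tri t) v w

/-- `φ` is the localized corrector `φ_T^k` of `v` for the element `T` with vertex set `t`. -/
def IsLocalCorrector (𝒯 : Triangulation Ω) (A AΓ : Plane → ℝ) (I : V Ω Γ →ₗ[ℝ] V Ω Γ) (k : ℕ)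
    (t : Finset Plane) (v φ : V Ω Γ) : Prop :=
  (I φ = 0 ∧ SupportedIn (patch 𝒯 k t) φ) ∧
    ∀ w, I w = 0 → SupportedIn (patch 𝒯 k t) w →
      form A AΓ (patch 𝒯 k t) φ w = form A AΓ (tri t) v w

end Components

end LOD

end

/-!
The squared energy `‖∇v‖²_S + ‖∇_τ v‖²_{Γ ∩ S}` and the squared mass `‖v‖²_S + ‖v‖²_{Γ ∩ S}` are, as
functions of the region `S`, finite measures on the plane (`sqMeasure`), and the bilinear forms are
additive in the region and comparable with the energy. This makes the bulk and the interface parts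
of the problem behave in the same way, and the localization argument for the fine space `ker I` can
be run for both at once.

*Cutting off.* A nodal piecewise affine function with values in `[0, 1]` has slope at most `4 γ / H`,
because every triangle contains a ball of radius `H / (4 γ)`. Multiplication by it preserves `V`
(`IsCutoff.exists_mul`): in the bulk, the product with a test function is Lipschitz and can be
mollified, and `H¹₀(Ω)` follows by density; on the arcs, functions with a weak derivative are
absolutely continuous. Multiplication leads out of the fine space, but subtracting the interpolant
leads back and enlarges supports by one layer of elements only. As `‖v‖ ≲ H ‖∇v‖` for fine `v`, the
factor `1 / H` from the slope of the cutoff is compensated, and fine functions can be cut off within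
the fine space at the cost of the energy in a ring of elements (`IsLocalized.exists_fine_cutoff`).

*Correctors.* They exist and are unique by the Riesz representation theorem
(`IsLocalized.existsUnique_forall_form_eq`). This needs the completeness of `V`, in which the
continuity of traces on `Γ` survives limits by a one-dimensional Sobolev inequality (`isClosed_V`),
and the closedness of the fine space.

*Decay.* Testing the equation of a corrector with its own cutoff bounds its energy outside of a patch
by a multiple of the energy in a surrounding ring. Filling the hole gives a contraction for every
eight layers of elements (`IsLocalized.energy_compl_patch_add_le`). Galerkin orthogonality turns this
into a bound for the localization error of one corrector
(`IsLocalized.energy_sub_localCorrector_le`).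

*Summation.* Let `z` be the global error. The error of the corrector of `T` does not see the part of
`z` which is cut off near `T`, so it is tested with `z` on a patch around `T` only. The Cauchy–Schwarz
inequality and a count of the overlaps of patches, by comparing areas (`QuasiUniform.card_le`), give
the global bound up to the factor `(k + 7)²` (`IsLocalized.energy_sum_sub_le`), which is absorbed by
the exponential (`exists_exp_bound`).

Everything but the multiplication by nodal cutoffs and the completeness of `V` is carried out for an
abstract space with the properties collected in `IsLocalized`; `isLocalized_V` verifies them for `V`.
-/

noncomputable section

namespace LOD

/-! ### Energy and mass on subsets -/

section EnergyMeasures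

variable {Ω : Set Plane} {Γ : Interface Ω}

/-- The sum of the squared `L²` norms of a field `f` on `S ∩ Ω` and of a family `g` of functions of
arc length on `Γ ∩ S`. -/
def sqNormOn {E : Type*} [NormedAddCommGroup E] (Γ : Interface Ω) (S : Set Plane)
    (f : Lp E 2 (volume.restrict Ω : Measure Plane)) (g : InterfaceL2 Γ) : ℝ :=
  (∫ x in S ∩ Ω, ‖f x‖ ^ 2) + ∑ i, ∫ s in Γ.params i S, (g i s) ^ 2

/-- The squared energy seminorm `‖∇v‖²_S + ‖∇_τ v‖²_{Γ ∩ S}`. -/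
def energyOn (S : Set Plane) (v : V Ω Γ) : ℝ := sqNormOn Γ S (grad v) (tgrad v)

/-- The squared mass norm `‖v‖²_S + ‖v‖²_{Γ ∩ S}`. -/
def massOn (S : Set Plane) (v : V Ω Γ) : ℝ := sqNormOn Γ S (val v) (trace v)

theorem energyOn_eq (S : Set Plane) (v : V Ω Γ) :
    energyOn S v = gradNormOn S v ^ 2 + tgradNormOn S v ^ 2 := by
  rw [energyOn, sqNormOn, gradNormOn, tgradNormOn, Real.sq_sqrt, Real.sq_sqrt]
  · exact Finset.sum_nonneg fun i _ => integral_nonneg fun s => sq_nonneg _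
  · exact integral_nonneg fun s => sq_nonneg _

theorem massOn_eq (S : Set Plane) (v : V Ω Γ) :
    massOn S v = normOn S v ^ 2 + traceNormOn S v ^ 2 := by
  rw [massOn, sqNormOn, normOn, traceNormOn, Real.sq_sqrt, Real.sq_sqrt]
  · simp only [Real.norm_eq_abs, sq_abs]
  · exact Finset.sum_nonneg fun i _ => integral_nonneg fun s => sq_nonneg _
  · exact integral_nonneg fun s => sq_nonneg _

theorem measurableSet_params (i : Fin Γ.n) {S : Set Plane} (hS : MeasurableSet S) :
    MeasurableSet (Γ.params i S) := by
  have h : ContinuousOn (Γ.arc i) (Ioo 0 (Γ.len i)) :=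
    (Γ.contDiff i).continuousOn.mono Ioo_subset_Icc_self
  have h2 : Measurable ((Ioo 0 (Γ.len i)).domRestrict (Γ.arc i)) :=
    (continuousOn_iff_continuous_domRestrict.1 h).measurable
  have h3 := (MeasurableEmbedding.subtype_coe (measurableSet_Ioo (a := (0:ℝ)) (b := Γ.len i))
    ).measurableSet_image' (h2 hS)
  convert h3 using 1
  ext s
  simp [Interface.params, Set.domRestrict, and_comm]

theorem params_subset (i : Fin Γ.n) (S : Set Plane) : Γ.params i S ⊆ Ioo 0 (Γ.len i) :=
  inter_subset_left

theorem integrable_sq_norm {X E : Type*} [MeasurableSpace X] {μ : Measure X}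
    [NormedAddCommGroup E] (f : Lp E 2 μ) : Integrable (fun x => ‖f x‖ ^ 2) μ :=
  (memLp_two_iff_integrable_sq_norm (Lp.aestronglyMeasurable f)).1 (Lp.memLp f)

theorem integrable_sq {X : Type*} [MeasurableSpace X] {μ : Measure X} (f : Lp ℝ 2 μ) :
    Integrable (fun x => (f x) ^ 2) μ := by
  simpa using integrable_sq_norm f

/-- An inequality between the integrands on `S` gives one between the squared norms over `S`. -/
theorem sqNormOn_le_of_ae {E E₁ E₂ : Type*} [NormedAddCommGroup E] [NormedAddCommGroup E₁]
    [NormedAddCommGroup E₂] {S : Set Plane} (hS : MeasurableSet S) (a b : ℝ)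
    (f : Lp E 2 (volume.restrict Ω : Measure Plane)) (g : InterfaceL2 Γ)
    (f₁ : Lp E₁ 2 (volume.restrict Ω : Measure Plane)) (g₁ : InterfaceL2 Γ)
    (f₂ : Lp E₂ 2 (volume.restrict Ω : Measure Plane)) (g₂ : InterfaceL2 Γ)
    (h : ∀ᵐ x ∂(volume.restrict Ω : Measure Plane), x ∈ S →
      ‖f x‖ ^ 2 ≤ a * ‖f₁ x‖ ^ 2 + b * ‖f₂ x‖ ^ 2)
    (h' : ∀ i, ∀ᵐ s ∂(volume.restrict (Ioo 0 (Γ.len i)) : Measure ℝ), Γ.arc i s ∈ S →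
      (g i s) ^ 2 ≤ a * (g₁ i s) ^ 2 + b * (g₂ i s) ^ 2) :
    sqNormOn Γ S f g ≤ a * sqNormOn Γ S f₁ g₁ + b * sqNormOn Γ S f₂ g₂ := by
  have e1 : ∫ x in S ∩ Ω, ‖f x‖ ^ 2 ≤
      a * (∫ x in S ∩ Ω, ‖f₁ x‖ ^ 2) + b * ∫ x in S ∩ Ω, ‖f₂ x‖ ^ 2 := by
    have r : (volume.restrict (S ∩ Ω) : Measure Plane) = (volume.restrict Ω).restrict S := by
      rw [Measure.restrict_restrict hS]
    rw [r, ← integral_const_mul, ← integral_const_mul, ← integral_add]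
    · apply integral_mono_ae
      · exact (integrable_sq_norm f).restrict
      · exact ((integrable_sq_norm f₁).restrict.const_mul _).add
          ((integrable_sq_norm f₂).restrict.const_mul _)
      · filter_upwards [ae_restrict_of_ae (s := S) h, ae_restrict_mem hS] with x h1 h2
        exact h1 h2
    · exact (integrable_sq_norm f₁).restrict.const_mul _
    · exact (integrable_sq_norm f₂).restrict.const_mul _
  have e2 : ∀ i, ∫ s in Γ.params i S, (g i s) ^ 2 ≤
      a * (∫ s in Γ.params i S, (g₁ i s) ^ 2) + b * ∫ s in Γ.params i S, (g₂ i s) ^ 2 := by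
    intro i
    have hm := measurableSet_params i hS
    have r : (volume.restrict (Γ.params i S) : Measure ℝ) =
        (volume.restrict (Ioo 0 (Γ.len i))).restrict (Γ.params i S) := by
      rw [Measure.restrict_restrict hm, inter_eq_left.2 (params_subset i S)]
    rw [r, ← integral_const_mul, ← integral_const_mul, ← integral_add]
    · apply integral_mono_ae
      · exact (integrable_sq (g i)).restrict
      · exact ((integrable_sq (g₁ i)).restrict.const_mul _).add
          ((integrable_sq (g₂ i)).restrict.const_mul _)
      · filter_upwards [ae_restrict_of_ae (s := Γ.params i S) (h' i), ae_restrict_mem hm]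
          with x h1 h2
        exact h1 h2.2
    · exact (integrable_sq (g₁ i)).restrict.const_mul _
    · exact (integrable_sq (g₂ i)).restrict.const_mul _
  have e3 := Finset.sum_le_sum fun i (_ : i ∈ Finset.univ) => e2 i
  rw [Finset.sum_add_distrib, ← Finset.mul_sum, ← Finset.mul_sum] at e3
  unfold sqNormOn
  linarith

/-- The measure on the plane whose value on `S` is `sqNormOn Γ S f g`. -/
def sqMeasure {E : Type*} [NormedAddCommGroup E] (Γ : Interface Ω)
    (f : Lp E 2 (volume.restrict Ω : Measure Plane)) (g : InterfaceL2 Γ) : Measure Plane :=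
  (volume.restrict Ω).withDensity (fun x => ENNReal.ofReal (‖f x‖ ^ 2)) +
    ∑ i, ((volume.restrict (Ioo 0 (Γ.len i))).withDensity
      (fun s => ENNReal.ofReal ((g i s) ^ 2))).map (Γ.arc i)

theorem aemeasurable_arc (i : Fin Γ.n) :
    AEMeasurable (Γ.arc i) (volume.restrict (Ioo 0 (Γ.len i))) :=
  ((Γ.contDiff i).continuousOn.mono Ioo_subset_Icc_self).aemeasurable measurableSet_Ioo

theorem sqMeasure_apply {E : Type*} [NormedAddCommGroup E]
    (f : Lp E 2 (volume.restrict Ω : Measure Plane)) (g : InterfaceL2 Γ)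
    {S : Set Plane} (hS : MeasurableSet S) :
    sqMeasure Γ f g S = ENNReal.ofReal (sqNormOn Γ S f g) := by
  rw [sqMeasure, Measure.add_apply, sqNormOn, ENNReal.ofReal_add, Measure.finsetSum_apply,
    ENNReal.ofReal_sum_of_nonneg]
  · congr 1
    · rw [withDensity_apply _ hS, ← Measure.restrict_restrict hS,
        ofReal_integral_eq_lintegral_ofReal (integrable_sq_norm f).restrict]
      exact Filter.Eventually.of_forall fun x => sq_nonneg _
    · refine Finset.sum_congr rfl fun i _ => ?_
      have hm := measurableSet_params i hS
      rw [Measure.map_apply_of_aemeasurable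
        ((aemeasurable_arc i).mono_ac (withDensity_absolutelyContinuous _ _)) hS]
      have hn : NullMeasurableSet (Γ.arc i ⁻¹' S) (volume.restrict (Ioo 0 (Γ.len i))) :=
        (aemeasurable_arc i).nullMeasurable hS
      rw [withDensity_apply₀ _ hn, Measure.restrict_restrict₀ hn, inter_comm,
        ofReal_integral_eq_lintegral_ofReal]
      · rfl
      · exact (integrable_sq (g i)).mono_measure (Measure.restrict_mono (params_subset i S) le_rfl)
      · exact Filter.Eventually.of_forall fun x => sq_nonneg _
  · exact fun i _ => integral_nonneg fun s => sq_nonneg _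
  · exact integral_nonneg fun s => sq_nonneg _
  · exact Finset.sum_nonneg fun i _ => integral_nonneg fun s => sq_nonneg _

variable {E : Type*} [NormedAddCommGroup E] {f : Lp E 2 (volume.restrict Ω : Measure Plane)}
  {g : InterfaceL2 Γ}

theorem sqNormOn_nonneg (S : Set Plane) : 0 ≤ sqNormOn Γ S f g :=
  add_nonneg (integral_nonneg fun _ => sq_nonneg _)
    (Finset.sum_nonneg fun _ _ => integral_nonneg fun _ => sq_nonneg _)

instance : IsFiniteMeasure (sqMeasure Γ f g) :=
  ⟨by rw [sqMeasure_apply _ _ MeasurableSet.univ]; exact ENNReal.ofReal_lt_top⟩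

theorem sqNormOn_eq_measureReal {S : Set Plane} (hS : MeasurableSet S) :
    sqNormOn Γ S f g = (sqMeasure Γ f g).real S := by
  rw [Measure.real, sqMeasure_apply _ _ hS, ENNReal.toReal_ofReal (sqNormOn_nonneg S)]

/-- The interior of every arc lies in `Ω`, so that only `S ∩ Ω` matters for the interface as well. -/
theorem sqNormOn_congr {S S' : Set Plane} (h : S ∩ Ω = S' ∩ Ω) :
    sqNormOn Γ S f g = sqNormOn Γ S' f g := by
  have : ∀ i, Γ.params i S = Γ.params i S' := by
    intro i
    ext s
    simp only [Interface.params, mem_inter_iff, mem_preimage]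
    refine and_congr_right fun hs => ?_
    have := Set.ext_iff.1 h (Γ.arc i s)
    simpa [Γ.mapsTo i hs] using this
  simp only [sqNormOn, h, this]

theorem sqNormOn_mono (hΩ : MeasurableSet Ω) {S S' : Set Plane} (hS : MeasurableSet S)
    (hS' : MeasurableSet S') (h : S ∩ Ω ⊆ S') : sqNormOn Γ S f g ≤ sqNormOn Γ S' f g := by
  rw [sqNormOn_congr (S' := S ∩ Ω) (by simp [inter_assoc]), sqNormOn_eq_measureReal (hS.inter hΩ),
    sqNormOn_eq_measureReal hS']
  exact measureReal_mono h

theorem sqNormOn_add_diff {S S' : Set Plane} (hS : MeasurableSet S)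
    (hS' : MeasurableSet S') (h : S ⊆ S') :
    sqNormOn Γ S f g + sqNormOn Γ (S' \ S) f g = sqNormOn Γ S' f g := by
  rw [sqNormOn_eq_measureReal (hS'.diff hS), sqNormOn_eq_measureReal hS,
    sqNormOn_eq_measureReal hS']
  have := measureReal_sdiff_add_inter (μ := sqMeasure Γ f g) (s := S') hS
  rw [inter_eq_right.2 h] at this
  linarith

theorem sqNormOn_le_sum (hΩ : MeasurableSet Ω) {ι : Type*} (F : Finset ι) (T : ι → Set Plane)
    (hT : ∀ i ∈ F, MeasurableSet (T i)) {S : Set Plane} (hS : MeasurableSet S)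
    (h : S ∩ Ω ⊆ ⋃ i ∈ F, T i) : sqNormOn Γ S f g ≤ ∑ i ∈ F, sqNormOn Γ (T i) f g := by
  have hU : MeasurableSet (⋃ i ∈ F, T i) := Finset.measurableSet_biUnion F hT
  refine (sqNormOn_mono hΩ hS hU h).trans ?_
  rw [sqNormOn_eq_measureReal hU]
  refine (measureReal_biUnion_finset_le F T).trans (le_of_eq ?_)
  exact Finset.sum_congr rfl fun i hi => (sqNormOn_eq_measureReal (hT i hi)).symm

/-- If each point of `Ω` lies in at most `N` of the sets `T i`, all of them subsets of `S`, then the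
squared norms over the `T i` add up to at most `N` times the one over `S`. -/
theorem sum_sqNormOn_le {ι : Type*} (F : Finset ι) (T : ι → Set Plane)
    (hT : ∀ i ∈ F, MeasurableSet (T i)) {S : Set Plane} (hS : MeasurableSet S)
    (hTS : ∀ i ∈ F, T i ⊆ S) {N : ℝ}
    (h : ∀ x, ∀ G ⊆ F, (∀ i ∈ G, x ∈ T i) → (G.card : ℝ) ≤ N) :
    ∑ i ∈ F, sqNormOn Γ (T i) f g ≤ N * sqNormOn Γ S f g := by
  classical
  have e : ∀ i ∈ F, sqNormOn Γ (T i) f g = ∫ x, (T i).indicator (fun _ => (1:ℝ)) x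
      ∂(sqMeasure Γ f g) := by
    intro i hi
    rw [sqNormOn_eq_measureReal (hT i hi), integral_indicator (hT i hi)]
    simp
  have e' : sqNormOn Γ S f g = ∫ x, S.indicator (fun _ => (1:ℝ)) x ∂(sqMeasure Γ f g) := by
    rw [sqNormOn_eq_measureReal hS, integral_indicator hS]
    simp
  rw [Finset.sum_congr rfl e, e', ← integral_const_mul, ← integral_finsetSum]
  · apply integral_mono
    · exact integrable_finsetSum _ fun i hi => (integrable_const _).indicator (hT i hi)
    · exact ((integrable_const _).indicator hS).const_mul _
    · intro x
      have hc := h x (F.filter (x ∈ T ·)) (Finset.filter_subset _ _) (by simp)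
      have e2 : ∑ i ∈ F, (T i).indicator (fun _ => (1:ℝ)) x = ((F.filter (x ∈ T ·)).card : ℝ) := by
        rw [Finset.card_filter]
        push_cast
        exact Finset.sum_congr rfl fun i _ => by simp [indicator_apply]
      change ∑ i ∈ F, (T i).indicator (fun _ => (1:ℝ)) x ≤ N * S.indicator (fun _ => (1:ℝ)) x
      by_cases hx : x ∈ S
      · rw [e2, indicator_of_mem hx, mul_one]
        exact hc
      · rw [indicator_of_notMem hx, mul_zero]
        refine le_of_eq (Finset.sum_eq_zero fun i hi => indicator_of_notMem ?_ _)
        exact fun h => hx (hTS i hi h)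
  · exact fun i hi => (integrable_const _).indicator (hT i hi)

theorem ae_eq_zero_of_sqNormOn_eq_zero {S : Set Plane}
    (hS : MeasurableSet S) (h : sqNormOn Γ S f g = 0) :
    (∀ᵐ x ∂(volume.restrict Ω : Measure Plane), x ∈ S → f x = 0) ∧
      ∀ i, ∀ᵐ s ∂(volume.restrict (Ioo 0 (Γ.len i)) : Measure ℝ), Γ.arc i s ∈ S → g i s = 0 := by
  have n1 : 0 ≤ ∫ x in S ∩ Ω, ‖f x‖ ^ 2 := integral_nonneg fun s => sq_nonneg _
  have n2 : ∀ i ∈ Finset.univ, 0 ≤ ∫ s in Γ.params i S, (g i s) ^ 2 :=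
    fun i _ => integral_nonneg fun s => sq_nonneg _
  have n3 := Finset.sum_nonneg n2
  unfold sqNormOn at h
  constructor
  · have : ∫ x in S ∩ Ω, ‖f x‖ ^ 2 = 0 := by linarith
    rw [← Measure.restrict_restrict hS, integral_eq_zero_iff_of_nonneg (fun x => sq_nonneg _)
      (integrable_sq_norm f).restrict] at this
    have := (ae_restrict_iff' hS).1 this
    filter_upwards [this] with x hx hxS
    simpa using hx hxS
  · intro i
    have : ∑ i, ∫ s in Γ.params i S, (g i s) ^ 2 = 0 := by linarith
    have := (Finset.sum_eq_zero_iff_of_nonneg n2).1 this i (Finset.mem_univ i)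
    have hm := measurableSet_params i hS
    have r : (volume.restrict (Γ.params i S) : Measure ℝ) =
        (volume.restrict (Ioo 0 (Γ.len i))).restrict (Γ.params i S) := by
      rw [Measure.restrict_restrict hm, inter_eq_left.2 (params_subset i S)]
    rw [r, integral_eq_zero_iff_of_nonneg (fun x => sq_nonneg _)
      (integrable_sq (g i)).restrict] at this
    have := (ae_restrict_iff' hm).1 this
    filter_upwards [this, ae_restrict_mem measurableSet_Ioo] with x hx h0 hxS
    simpa using hx ⟨h0, hxS⟩

theorem sqNormOn_eq_zero_of_ae {S : Set Plane}
    (hS : MeasurableSet S)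
    (h : ∀ᵐ x ∂(volume.restrict Ω : Measure Plane), x ∈ S → f x = 0)
    (h' : ∀ i, ∀ᵐ s ∂(volume.restrict (Ioo 0 (Γ.len i)) : Measure ℝ),
      Γ.arc i s ∈ S → g i s = 0) : sqNormOn Γ S f g = 0 := by
  refine le_antisymm ?_ (sqNormOn_nonneg S)
  have := sqNormOn_le_of_ae (Γ := Γ) hS 0 0 f g f g f g
    (h.mono fun x hx hxS => by simp [hx hxS]) (fun i => (h' i).mono fun x hx hxS => by simp [hx hxS])
  simpa using this

theorem sqNormOn_add_le {S : Set Plane} (hS : MeasurableSet S)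
    (f' : Lp E 2 (volume.restrict Ω : Measure Plane)) (g' : InterfaceL2 Γ) :
    sqNormOn Γ S (f + f') (g + g') ≤ 2 * sqNormOn Γ S f g + 2 * sqNormOn Γ S f' g' := by
  apply sqNormOn_le_of_ae hS
  · filter_upwards [Lp.coeFn_add f f'] with x hx _
    rw [hx, Pi.add_apply]
    have := norm_add_le (f x) (f' x)
    have h0 := norm_nonneg (f x + f' x)
    nlinarith [sq_nonneg (‖f x‖ - ‖f' x‖)]
  · intro i
    filter_upwards [Lp.coeFn_add (g i) (g' i)] with x hx _
    rw [Pi.add_apply, hx, Pi.add_apply]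
    nlinarith [sq_nonneg (g i x - g' i x)]

end EnergyMeasures

/-! ### The bilinear forms -/

section Form

variable {Ω : Set Plane} {Γ : Interface Ω} {A AΓ : Plane → ℝ} {α β : ℝ}

theorem restrict_params (i : Fin Γ.n) {S : Set Plane} (hS : MeasurableSet S) :
    (volume.restrict (Γ.params i S) : Measure ℝ) =
      (volume.restrict (Ioo 0 (Γ.len i))).restrict (Γ.params i S) := by
  rw [Measure.restrict_restrict (measurableSet_params i hS), inter_eq_left.2 (params_subset i S)]

theorem restrict_inter_domain {S : Set Plane} (hS : MeasurableSet S) :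
    (volume.restrict (S ∩ Ω) : Measure Plane) = (volume.restrict Ω).restrict S := by
  rw [Measure.restrict_restrict hS]

theorem grad_add_ae (v w : V Ω Γ) : ∀ᵐ x ∂(volume.restrict Ω : Measure Plane),
    grad (v + w) x = grad v x + grad w x := Lp.coeFn_add (grad v) (grad w)

theorem grad_smul_ae (c : ℝ) (v : V Ω Γ) : ∀ᵐ x ∂(volume.restrict Ω : Measure Plane),
    grad (c • v) x = c • grad v x := Lp.coeFn_smul c (grad v)

theorem tgrad_add_ae (v w : V Ω Γ) (i : Fin Γ.n) :
    ∀ᵐ s ∂(volume.restrict (Ioo 0 (Γ.len i)) : Measure ℝ),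
      tgrad (v + w) i s = tgrad v i s + tgrad w i s := Lp.coeFn_add (tgrad v i) (tgrad w i)

theorem tgrad_smul_ae (c : ℝ) (v : V Ω Γ) (i : Fin Γ.n) :
    ∀ᵐ s ∂(volume.restrict (Ioo 0 (Γ.len i)) : Measure ℝ),
      tgrad (c • v) i s = c * tgrad v i s := Lp.coeFn_smul c (tgrad v i)

theorem IsPermeability.integrable_bulk (hA : IsPermeability Γ A AΓ α β) (v w : V Ω Γ) :
    Integrable (fun x => A x * inner ℝ (grad v x) (grad w x)) (volume.restrict Ω) := by
  refine Integrable.bdd_mul (c := max |α| |β|) (L2.integrable_inner (grad v) (grad w))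
    hA.bulk_meas ?_
  filter_upwards [hA.bulk_bound] with x hx
  exact abs_le_max_abs_abs hx.1 hx.2

theorem IsPermeability.integrable_interface (hA : IsPermeability Γ A AΓ α β) (v w : V Ω Γ)
    (i : Fin Γ.n) : Integrable (fun s => AΓ (Γ.arc i s) * (tgrad v i s * tgrad w i s))
      (volume.restrict (Ioo 0 (Γ.len i))) := by
  refine Integrable.bdd_mul (c := max |α| |β|) ?_ (hA.interface_meas i) ?_
  · exact (Lp.memLp (tgrad v i)).integrable_mul (Lp.memLp (tgrad w i))
  · filter_upwards [hA.interface_bound i] with x hx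
    exact abs_le_max_abs_abs hx.1 hx.2

theorem form_comm (S : Set Plane) (v w : V Ω Γ) : form A AΓ S v w = form A AΓ S w v := by
  unfold form
  simp only [real_inner_comm, mul_comm]

theorem form_add_left (hA : IsPermeability Γ A AΓ α β) {S : Set Plane} (hS : MeasurableSet S)
    (u v w : V Ω Γ) : form A AΓ S (u + v) w = form A AΓ S u w + form A AΓ S v w := by
  have e1 : ∫ x in S ∩ Ω, A x * inner ℝ (grad (u + v) x) (grad w x) =
      (∫ x in S ∩ Ω, A x * inner ℝ (grad u x) (grad w x)) +
        ∫ x in S ∩ Ω, A x * inner ℝ (grad v x) (grad w x) := by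
    rw [restrict_inter_domain hS, ← integral_add (hA.integrable_bulk u w).restrict
      (hA.integrable_bulk v w).restrict]
    refine integral_congr_ae (ae_restrict_of_ae ?_)
    filter_upwards [grad_add_ae u v] with x hx
    rw [hx, inner_add_left, mul_add]
  have e2 : ∀ i, ∫ s in Γ.params i S, AΓ (Γ.arc i s) * (tgrad (u + v) i s * tgrad w i s) =
      (∫ s in Γ.params i S, AΓ (Γ.arc i s) * (tgrad u i s * tgrad w i s)) +
        ∫ s in Γ.params i S, AΓ (Γ.arc i s) * (tgrad v i s * tgrad w i s) := by
    intro i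
    rw [restrict_params i hS, ← integral_add (hA.integrable_interface u w i).restrict
      (hA.integrable_interface v w i).restrict]
    refine integral_congr_ae (ae_restrict_of_ae ?_)
    filter_upwards [tgrad_add_ae u v i] with x hx
    rw [hx]; ring
  unfold form
  simp only [e1, e2, Finset.sum_add_distrib]
  ring

theorem form_smul_left {S : Set Plane} (hS : MeasurableSet S) (c : ℝ)
    (v w : V Ω Γ) : form A AΓ S (c • v) w = c * form A AΓ S v w := by
  have e1 : ∫ x in S ∩ Ω, A x * inner ℝ (grad (c • v) x) (grad w x) =
      c * ∫ x in S ∩ Ω, A x * inner ℝ (grad v x) (grad w x) := by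
    rw [restrict_inter_domain hS]
    refine Eq.trans ?_ (integral_const_mul c _)
    refine integral_congr_ae (ae_restrict_of_ae ?_)
    filter_upwards [grad_smul_ae c v] with x hx
    rw [hx, real_inner_smul_left, mul_left_comm]
  have e2 : ∀ i, ∫ s in Γ.params i S, AΓ (Γ.arc i s) * (tgrad (c • v) i s * tgrad w i s) =
      c * ∫ s in Γ.params i S, AΓ (Γ.arc i s) * (tgrad v i s * tgrad w i s) := by
    intro i
    rw [restrict_params i hS]
    refine Eq.trans ?_ (integral_const_mul c _)
    refine integral_congr_ae (ae_restrict_of_ae ?_)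
    filter_upwards [tgrad_smul_ae c v i] with x hx
    rw [hx, mul_assoc, mul_left_comm]
  unfold form
  simp only [e1, e2, ← Finset.mul_sum, mul_add]

/-- The form `form A AΓ S` as a bilinear map. -/
def formBilin (hA : IsPermeability Γ A AΓ α β) {S : Set Plane} (hS : MeasurableSet S) :
    V Ω Γ →ₗ[ℝ] V Ω Γ →ₗ[ℝ] ℝ :=
  LinearMap.mk₂ ℝ (form A AΓ S) (form_add_left hA hS) (form_smul_left hS)
    (fun u v w => by rw [form_comm, form_add_left hA hS, form_comm, form_comm S w])
    (fun c v w => by rw [form_comm, form_smul_left hS, form_comm, smul_eq_mul])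

@[simp]
theorem formBilin_apply (hA : IsPermeability Γ A AΓ α β) {S : Set Plane} (hS : MeasurableSet S)
    (v w : V Ω Γ) : formBilin hA hS v w = form A AΓ S v w := rfl

theorem form_add_diff (hA : IsPermeability Γ A AΓ α β) {S S' : Set Plane} (hS : MeasurableSet S)
    (hS' : MeasurableSet S') (h : S ⊆ S') (v w : V Ω Γ) :
    form A AΓ S v w + form A AΓ (S' \ S) v w = form A AΓ S' v w := by
  have e1 : (∫ x in S ∩ Ω, A x * inner ℝ (grad v x) (grad w x)) +
      (∫ x in (S' \ S) ∩ Ω, A x * inner ℝ (grad v x) (grad w x)) =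
      ∫ x in S' ∩ Ω, A x * inner ℝ (grad v x) (grad w x) := by
    have hi := (hA.integrable_bulk v w).restrict (s := S')
    rw [← restrict_inter_domain hS'] at hi
    have := integral_inter_add_sdiff hS hi
    rwa [inter_right_comm, inter_eq_right.2 h, inter_sdiff_right_comm] at this
  have e2 : ∀ i, (∫ s in Γ.params i S, AΓ (Γ.arc i s) * (tgrad v i s * tgrad w i s)) +
      (∫ s in Γ.params i (S' \ S), AΓ (Γ.arc i s) * (tgrad v i s * tgrad w i s)) =
      ∫ s in Γ.params i S', AΓ (Γ.arc i s) * (tgrad v i s * tgrad w i s) := by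
    intro i
    have h1 : Γ.params i (S' \ S) = Γ.params i S' \ Γ.params i S := by
      ext s
      simp only [Interface.params, mem_inter_iff, mem_preimage, mem_sdiff]
      tauto
    have h2 : Γ.params i S' ∩ Γ.params i S = Γ.params i S :=
      inter_eq_right.2 (inter_subset_inter_right _ (preimage_mono h))
    have hi : IntegrableOn (fun s => AΓ (Γ.arc i s) * (tgrad v i s * tgrad w i s))
        (Γ.params i S') :=
      IntegrableOn.mono_set (t := Ioo 0 (Γ.len i)) (hA.integrable_interface v w i)
        (params_subset i S')
    have := integral_inter_add_sdiff (measurableSet_params i hS) hi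
    rwa [h2, ← h1] at this
  have e3 := Finset.sum_congr rfl fun i (_ : i ∈ Finset.univ) => e2 i
  rw [Finset.sum_add_distrib] at e3
  unfold form
  linarith

theorem le_form_self (hA : IsPermeability Γ A AΓ α β) {S : Set Plane} (hS : MeasurableSet S)
    (v : V Ω Γ) : α * energyOn S v ≤ form A AΓ S v v := by
  unfold energyOn sqNormOn form
  rw [mul_add, Finset.mul_sum]
  refine add_le_add ?_ (Finset.sum_le_sum fun i _ => ?_)
  · rw [restrict_inter_domain hS, ← integral_const_mul]
    refine integral_mono_ae ((integrable_sq_norm _).restrict.const_mul _)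
      (hA.integrable_bulk v v).restrict (ae_restrict_of_ae ?_)
    filter_upwards [hA.bulk_bound] with x hx
    rw [real_inner_self_eq_norm_sq]
    exact mul_le_mul_of_nonneg_right hx.1 (sq_nonneg _)
  · rw [restrict_params i hS, ← integral_const_mul]
    refine integral_mono_ae ((integrable_sq _).restrict.const_mul _)
      (hA.integrable_interface v v i).restrict (ae_restrict_of_ae ?_)
    filter_upwards [hA.interface_bound i] with x hx
    rw [← sq]
    exact mul_le_mul_of_nonneg_right hx.1 (sq_nonneg _)

theorem form_self_le (hA : IsPermeability Γ A AΓ α β) {S : Set Plane} (hS : MeasurableSet S)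
    (v : V Ω Γ) : form A AΓ S v v ≤ β * energyOn S v := by
  unfold energyOn sqNormOn form
  rw [mul_add, Finset.mul_sum]
  refine add_le_add ?_ (Finset.sum_le_sum fun i _ => ?_)
  · rw [restrict_inter_domain hS, ← integral_const_mul]
    refine integral_mono_ae (hA.integrable_bulk v v).restrict
      ((integrable_sq_norm _).restrict.const_mul _) (ae_restrict_of_ae ?_)
    filter_upwards [hA.bulk_bound] with x hx
    rw [real_inner_self_eq_norm_sq]
    exact mul_le_mul_of_nonneg_right hx.2 (sq_nonneg _)
  · rw [restrict_params i hS, ← integral_const_mul]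
    refine integral_mono_ae (hA.integrable_interface v v i).restrict
      ((integrable_sq _).restrict.const_mul _) (ae_restrict_of_ae ?_)
    filter_upwards [hA.interface_bound i] with x hx
    rw [← sq]
    exact mul_le_mul_of_nonneg_right hx.2 (sq_nonneg _)

theorem energyOn_nonneg (S : Set Plane) (v : V Ω Γ) : 0 ≤ energyOn S v := sqNormOn_nonneg S

theorem massOn_nonneg (S : Set Plane) (v : V Ω Γ) : 0 ≤ massOn S v := sqNormOn_nonneg S

/-- The Cauchy–Schwarz inequality for a positive semidefinite symmetric bilinear map. -/
theorem sq_apply_le_of_nonneg {E : Type*} [AddCommGroup E] [Module ℝ E] (B : E →ₗ[ℝ] E →ₗ[ℝ] ℝ)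
    (hs : ∀ x y, B x y = B y x) (hp : ∀ x, 0 ≤ B x x) (x y : E) :
    (B x y) ^ 2 ≤ B x x * B y y := by
  have h : ∀ t : ℝ, 0 ≤ B y y * (t * t) + (2 * B x y) * t + B x x := by
    intro t
    have := hp (x + t • y)
    simp only [map_add, LinearMap.add_apply, map_smul, LinearMap.smul_apply, smul_eq_mul] at this
    rw [hs y x] at this
    linarith
  have := discrim_le_zero h
  unfold discrim at this
  linarith

theorem sq_form_le (hα : 0 ≤ α) (hβ : 0 ≤ β) (hA : IsPermeability Γ A AΓ α β) {S : Set Plane}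
    (hS : MeasurableSet S) (v w : V Ω Γ) :
    (form A AΓ S v w) ^ 2 ≤ β ^ 2 * (energyOn S v * energyOn S w) := by
  have hp : ∀ u : V Ω Γ, 0 ≤ form A AΓ S u u := fun u =>
    (mul_nonneg hα (energyOn_nonneg S u)).trans (le_form_self hA hS u)
  have := sq_apply_le_of_nonneg (formBilin hA hS) (form_comm S) hp v w
  simp only [formBilin_apply] at this
  have h1 := form_self_le hA hS v
  have h2 := form_self_le hA hS w
  have := mul_le_mul h1 h2 (hp w) (mul_nonneg hβ (energyOn_nonneg S v))
  nlinarith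

theorem energyOn_add_le {S : Set Plane} (hS : MeasurableSet S) (v w : V Ω Γ) :
    energyOn S (v + w) ≤ 2 * energyOn S v + 2 * energyOn S w :=
  sqNormOn_add_le hS (grad w) (tgrad w)

theorem massOn_add_le {S : Set Plane} (hS : MeasurableSet S) (v w : V Ω Γ) :
    massOn S (v + w) ≤ 2 * massOn S v + 2 * massOn S w :=
  sqNormOn_add_le hS (val w) (trace w)

/-- Being supported in `S` is a statement about the mass only; no condition on the derivatives is
needed, since they vanish with the function on open sets. -/
theorem supportedIn_iff_massOn_eq_zero {S : Set Plane} (hS : MeasurableSet S) (v : V Ω Γ) :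
    SupportedIn S v ↔ massOn Sᶜ v = 0 :=
  ⟨fun h => sqNormOn_eq_zero_of_ae hS.compl h.1 h.2,
    fun h => ae_eq_zero_of_sqNormOn_eq_zero hS.compl h⟩

theorem eq_zero_of_energyOn_massOn {v : V Ω Γ} (h : energyOn univ v = 0) (h' : massOn univ v = 0) :
    v = 0 := by
  obtain ⟨h1, h2⟩ := ae_eq_zero_of_sqNormOn_eq_zero MeasurableSet.univ h
  obtain ⟨h3, h4⟩ := ae_eq_zero_of_sqNormOn_eq_zero MeasurableSet.univ h'
  have e1 : grad v = 0 := (Lp.eq_zero_iff_ae_eq_zero).2 (h1.mono fun x hx => hx (mem_univ _))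
  have e2 : tgrad v = 0 := funext fun i =>
    (Lp.eq_zero_iff_ae_eq_zero).2 ((h2 i).mono fun x hx => hx (mem_univ _))
  have e3 : val v = 0 := (Lp.eq_zero_iff_ae_eq_zero).2 (h3.mono fun x hx => hx (mem_univ _))
  have e4 : trace v = 0 := funext fun i =>
    (Lp.eq_zero_iff_ae_eq_zero).2 ((h4 i).mono fun x hx => hx (mem_univ _))
  exact Subtype.ext (Prod.ext (Prod.ext e3 (Prod.ext e1 e4)) e2)

end Form

/-! ### Riesz representation -/

/-- The Riesz representation theorem for a vector space which is complete with respect to the norm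
given by a symmetric positive definite bilinear map `B`. -/
theorem exists_forall_apply_eq {E : Type*} [AddCommGroup E] [Module ℝ E] (B : E →ₗ[ℝ] E →ₗ[ℝ] ℝ)
    (hs : ∀ x y, B x y = B y x) (hp : ∀ x, 0 ≤ B x x) (hd : ∀ x, B x x = 0 → x = 0)
    (hc : ∀ u : ℕ → E, (∀ ε > 0, ∃ N, ∀ m ≥ N, ∀ n ≥ N, B (u m - u n) (u m - u n) < ε) →
      ∃ x, ∀ ε > 0, ∃ N, ∀ n ≥ N, B (u n - x) (u n - x) < ε)
    (ℓ : E →ₗ[ℝ] ℝ) {C : ℝ} (hC : 0 ≤ C) (hℓ : ∀ w, (ℓ w) ^ 2 ≤ C * B w w) :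
    ∃ x, ∀ w, B x w = ℓ w := by
  let core : InnerProductSpace.Core ℝ E :=
    { inner := fun x y => B x y
      conj_inner_symm := fun x y => by simp [hs x y]
      re_inner_nonneg := fun x => by simpa using hp x
      add_left := fun x y z => by simp
      smul_left := fun x y r => by simp
      definite := hd }
  let _ : NormedAddCommGroup E := core.toNormedAddCommGroup
  let _ : InnerProductSpace ℝ E := InnerProductSpace.ofCore core.toCore
  have hn : ∀ x : E, ‖x‖ ^ 2 = B x x := fun x => (real_inner_self_eq_norm_sq x).symm
  have _ : CompleteSpace E := by
    refine Metric.complete_of_cauchySeq_tendsto fun u hu => ?_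
    obtain ⟨x, hx⟩ := hc u fun ε hε => by
      obtain ⟨N, hN⟩ := Metric.cauchySeq_iff.1 hu (√ε) (Real.sqrt_pos.2 hε)
      refine ⟨N, fun m hm n hn' => ?_⟩
      have := hN m hm n hn'
      rw [dist_eq_norm] at this
      rw [← hn]
      exact (Real.lt_sqrt (norm_nonneg _)).1 this
    refine ⟨x, Metric.tendsto_atTop.2 fun ε hε => ?_⟩
    obtain ⟨N, hN⟩ := hx (ε ^ 2) (by positivity)
    refine ⟨N, fun n hn' => ?_⟩
    rw [dist_eq_norm]
    have := hN n hn'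
    rw [← hn] at this
    exact lt_of_pow_lt_pow_left₀ 2 hε.le this
  let L : E →L[ℝ] ℝ := ℓ.mkContinuous (√C) fun w => by
    rw [Real.norm_eq_abs]
    refine abs_le_of_sq_le_sq ?_ (by positivity)
    rw [mul_pow, Real.sq_sqrt hC, hn]
    exact hℓ w
  refine ⟨(InnerProductSpace.toDual ℝ E).symm L, fun w => ?_⟩
  exact InnerProductSpace.toDual_symm_apply (x := w) (y := L)

/-! ### Element patches -/

section Mesh

variable {Ω : Set Plane}

theorem convex_tri (t : Finset Plane) : Convex ℝ (tri t) := convex_convexHull ℝ (t : Set Plane)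

theorem isCompact_tri (t : Finset Plane) : IsCompact (tri t) := t.finite_toSet.isCompact_convexHull ℝ

theorem isClosed_tri (t : Finset Plane) : IsClosed (tri t) := (isCompact_tri t).isClosed

theorem Triangulation.isOpen (𝒯 : Triangulation Ω) : IsOpen Ω := by
  rw [𝒯.domain_eq]; exact isOpen_interior

theorem Triangulation.measurableSet (𝒯 : Triangulation Ω) : MeasurableSet Ω := 𝒯.isOpen.measurableSet

/-- The union of the elements of a triangulation. -/
def Triangulation.support (𝒯 : Triangulation Ω) : Set Plane := ⋃ t ∈ 𝒯.elems, tri t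

variable {𝒯 : Triangulation Ω}

theorem Triangulation.mem_support {x : Plane} : x ∈ 𝒯.support ↔ ∃ t ∈ 𝒯.elems, x ∈ tri t := by
  simp [Triangulation.support]

theorem Triangulation.isClosed_support : IsClosed 𝒯.support :=
  isClosed_biUnion_finset fun t _ => isClosed_tri t

theorem Triangulation.domain_subset : Ω ⊆ 𝒯.support := by
  intro x hx
  rw [𝒯.domain_eq] at hx
  exact interior_subset hx

theorem mem_nbhd {S : Set Plane} {x : Plane} :
    x ∈ nbhd 𝒯 S ↔ ∃ s ∈ 𝒯.elems, (tri s ∩ S).Nonempty ∧ x ∈ tri s := by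
  simp [nbhd, and_left_comm]

theorem isClosed_nbhd (S : Set Plane) : IsClosed (nbhd 𝒯 S) :=
  isClosed_biUnion_finset fun t _ => isClosed_iUnion_of_finite fun _ => isClosed_tri t

theorem patch_succ (j : ℕ) (t : Finset Plane) : patch 𝒯 (j + 1) t = nbhd 𝒯 (patch 𝒯 j t) :=
  Function.iterate_succ_apply' _ _ _

theorem isClosed_patch (j : ℕ) (t : Finset Plane) : IsClosed (patch 𝒯 j t) := by
  cases j with
  | zero => exact isClosed_tri t
  | succ j => rw [patch_succ]; exact isClosed_nbhd _

theorem measurableSet_patch (j : ℕ) (t : Finset Plane) : MeasurableSet (patch 𝒯 j t) :=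
  (isClosed_patch j t).measurableSet

theorem tri_subset_patch_succ {j : ℕ} {s t : Finset Plane} (hs : s ∈ 𝒯.elems)
    (h : (tri s ∩ patch 𝒯 j t).Nonempty) : tri s ⊆ patch 𝒯 (j + 1) t := by
  intro x hx
  rw [patch_succ, mem_nbhd]
  exact ⟨s, hs, h, hx⟩

/-- A patch is a union of elements. -/
theorem exists_tri_subset_patch {j : ℕ} {t : Finset Plane} (ht : t ∈ 𝒯.elems) {x : Plane}
    (hx : x ∈ patch 𝒯 j t) : ∃ s ∈ 𝒯.elems, x ∈ tri s ∧ tri s ⊆ patch 𝒯 j t := by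
  cases j with
  | zero => exact ⟨t, ht, hx, subset_rfl⟩
  | succ j =>
    rw [patch_succ, mem_nbhd] at hx
    obtain ⟨s, hs, h, hxs⟩ := hx
    exact ⟨s, hs, hxs, tri_subset_patch_succ hs h⟩

theorem patch_subset_succ {t : Finset Plane} (ht : t ∈ 𝒯.elems) (j : ℕ) :
    patch 𝒯 j t ⊆ patch 𝒯 (j + 1) t := by
  intro x hx
  obtain ⟨s, hs, hxs, -⟩ := exists_tri_subset_patch ht hx
  exact tri_subset_patch_succ hs ⟨x, hxs, hx⟩ hxs

theorem patch_mono {t : Finset Plane} (ht : t ∈ 𝒯.elems) {i j : ℕ} (h : i ≤ j) :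
    patch 𝒯 i t ⊆ patch 𝒯 j t :=
  monotone_nat_of_le_succ (f := fun j => patch 𝒯 j t) (patch_subset_succ ht) h

theorem disjoint_patch_of_not_subset {j : ℕ} {s t : Finset Plane} (hs : s ∈ 𝒯.elems)
    (h : ¬ tri s ⊆ patch 𝒯 (j + 1) t) : Disjoint (tri s) (patch 𝒯 j t) := by
  rw [disjoint_iff_inter_eq_empty, ← not_nonempty_iff_eq_empty]
  exact fun h' => h (tri_subset_patch_succ hs h')

/-- An element which does not meet a patch has a neighbourhood which does not meet the patch with
one layer less. -/
theorem disjoint_nbhd_patch {j : ℕ} {s t : Finset Plane}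
    (h : Disjoint (tri s) (patch 𝒯 (j + 1) t)) : Disjoint (nbhd 𝒯 (tri s)) (patch 𝒯 j t) := by
  rw [Set.disjoint_left] at h ⊢
  intro y hy hyP
  obtain ⟨s', hs', ⟨z, hz', hz⟩, hys'⟩ := mem_nbhd.1 hy
  exact h hz (tri_subset_patch_succ hs' ⟨y, hys', hyP⟩ hz')

theorem nbhd_subset_patch_succ {j : ℕ} {s t : Finset Plane}
    (h : tri s ⊆ patch 𝒯 j t) : nbhd 𝒯 (tri s) ⊆ patch 𝒯 (j + 1) t := by
  intro y hy
  obtain ⟨s', hs', ⟨z, hz', hz⟩, hys'⟩ := mem_nbhd.1 hy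
  exact tri_subset_patch_succ hs' ⟨z, hz', h hz⟩ hys'

theorem tri_subset_nbhd {s : Finset Plane} (hs : s ∈ 𝒯.elems) : tri s ⊆ nbhd 𝒯 (tri s) :=
  patch_subset_succ hs 0

/-! ### Counting overlaps of patches -/

/-- Distinct elements of a conforming triangulation overlap in a null set: their intersection is the
convex hull of at most two vertices. -/
theorem volume_tri_inter_tri {s t : Finset Plane} (hs : s ∈ 𝒯.elems) (ht : t ∈ 𝒯.elems)
    (h : s ≠ t) : volume (tri s ∩ tri t) = 0 := by
  obtain ⟨z, hzs, hzt⟩ : ∃ z ∈ s, z ∉ t := by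
    by_contra! hc
    exact h (Finset.eq_of_subset_of_card_le hc (by rw [𝒯.card_eq s hs, 𝒯.card_eq t ht]))
  rw [𝒯.conforming s hs t ht]
  have hne : affineSpan ℝ ((s : Set Plane) ∩ t) ≠ ⊤ := by
    intro htop
    have h1 := (𝒯.indep s hs).notMem_affineSpan_sdiff ⟨z, hzs⟩ univ
    apply h1
    have : (s : Set Plane) ∩ t ⊆ (fun x : s => (x : Plane)) '' (univ \ {⟨z, hzs⟩}) := by
      rintro y ⟨hy, hyt⟩
      refine ⟨⟨y, hy⟩, ⟨mem_univ _, ?_⟩, rfl⟩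
      rintro hyz
      simp only [mem_singleton_iff, Subtype.mk.injEq] at hyz
      exact hzt (hyz ▸ hyt)
    exact affineSpan_mono ℝ this (htop ▸ AffineSubspace.mem_top ℝ Plane z)
  exact measure_mono_null (convexHull_subset_affineSpan _) (Measure.addHaar_affineSubspace _ _ hne)

/-- The constant `γ` is not assumed to be positive; as soon as there is an element, it is. -/
theorem QuasiUniform.pos_gamma {H γ : ℝ} (hq : QuasiUniform 𝒯 H γ) (hne : 𝒯.elems.Nonempty) :
    0 < γ := by
  obtain ⟨t, ht⟩ := hne
  have h1 := hq.pos.trans_le (hq.le_inDiam t ht)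
  have h2 : 0 ≤ inDiam t := Real.sSup_nonneg fun d hd => hd.1
  exact pos_of_mul_pos_left h1 h2

/-- Every element contains a ball of radius comparable to `H`. The radius is `H / (4 γ)` rather than
`H / (2 γ)`, since the supremum which defines `inDiam` is not shown to be attained. -/
theorem QuasiUniform.exists_closedBall_subset {H γ : ℝ} (hq : QuasiUniform 𝒯 H γ)
    {t : Finset Plane} (ht : t ∈ 𝒯.elems) : ∃ c, Metric.closedBall c (H / (4 * γ)) ⊆ tri t := by
  have hγ := hq.pos_gamma ⟨t, ht⟩
  have hH := hq.pos
  have h1 : H / (2 * γ) < inDiam t := by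
    have := hq.le_inDiam t ht
    rw [div_lt_iff₀ (by positivity)]
    nlinarith
  have hne : {d : ℝ | 0 ≤ d ∧ ∃ c : Plane, Metric.closedBall c (d / 2) ⊆ tri t}.Nonempty := by
    rw [nonempty_iff_ne_empty]
    intro he
    rw [inDiam, he, Real.sSup_empty] at h1
    have : 0 < H / (2 * γ) := by positivity
    linarith
  obtain ⟨d, ⟨-, c, hc⟩, hd⟩ := exists_lt_of_lt_csSup hne h1
  refine ⟨c, (Metric.closedBall_subset_closedBall ?_).trans hc⟩
  have : H / (4 * γ) = H / (2 * γ) / 2 := by field_simp; ring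
  rw [this]
  linarith

theorem QuasiUniform.dist_le {H γ : ℝ} (hq : QuasiUniform 𝒯 H γ)
    {t : Finset Plane} (ht : t ∈ 𝒯.elems) {x y : Plane} (hx : x ∈ tri t) (hy : y ∈ tri t) :
    dist x y ≤ H :=
  (Metric.dist_le_diam_of_mem (isCompact_tri t).isBounded hx hy).trans (hq.diam_le t ht)

theorem QuasiUniform.dist_le_of_mem_patch {H γ : ℝ} (hq : QuasiUniform 𝒯 H γ)
    {t : Finset Plane} (ht : t ∈ 𝒯.elems) (m : ℕ) {x : Plane} (hx : x ∈ patch 𝒯 m t) {y : Plane}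
    (hy : y ∈ tri t) : dist x y ≤ (m + 1) * H := by
  induction m generalizing x with
  | zero => simpa using hq.dist_le ht hx hy
  | succ m ih =>
    rw [patch_succ, mem_nbhd] at hx
    obtain ⟨s, hs, ⟨p, hps, hp⟩, hxs⟩ := hx
    have h1 := hq.dist_le hs hxs hps
    have h2 := ih hp
    have := dist_triangle x p y
    push_cast
    linarith

/-- By comparing areas, a point lies in the `m`-th patches of at most `(4 γ (m + 1))²` elements. -/
theorem QuasiUniform.card_le {H γ : ℝ} (hq : QuasiUniform 𝒯 H γ) (m : ℕ) (x : Plane)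
    (F : Finset (Finset Plane)) (hF : F ⊆ 𝒯.elems) (hx : ∀ t ∈ F, x ∈ patch 𝒯 m t) :
    (F.card : ℝ) ≤ (4 * γ * (m + 1)) ^ 2 := by
  rcases F.eq_empty_or_nonempty with rfl | ⟨t₀, ht₀⟩
  · simpa using sq_nonneg _
  have hγ := hq.pos_gamma ⟨t₀, hF ht₀⟩
  have hH := hq.pos
  have hr : 0 < H / (4 * γ) := by positivity
  have h1 : ∀ t ∈ F, volume (Metric.closedBall (0 : Plane) (H / (4 * γ))) ≤ volume (tri t) := by
    intro t ht
    obtain ⟨c, hc⟩ := hq.exists_closedBall_subset (hF ht)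
    rw [← Measure.addHaar_closedBall_center volume c]
    exact measure_mono hc
  have h2 : ∑ t ∈ F, volume (tri t) ≤ volume (Metric.closedBall x ((m + 1) * H)) := by
    rw [← measure_biUnion_finset₀ (fun s hs t ht h => volume_tri_inter_tri (hF hs) (hF ht) h)
      (fun t _ => (isClosed_tri t).measurableSet.nullMeasurableSet)]
    refine measure_mono (iUnion₂_subset fun t ht y hy => ?_)
    rw [Metric.mem_closedBall, dist_comm]
    exact hq.dist_le_of_mem_patch (hF ht) m (hx t ht) hy
  have h3 := (Finset.sum_le_sum h1).trans h2
  rw [Finset.sum_const, nsmul_eq_mul, Measure.addHaar_closedBall' volume _ hr.le,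
    Measure.addHaar_closedBall' volume _ (by positivity : 0 ≤ ((m : ℝ) + 1) * H), ← mul_assoc] at h3
  have hb0 : volume (Metric.closedBall (0 : Plane) 1) ≠ 0 :=
    (Metric.measure_closedBall_pos volume _ one_pos).ne'
  have hb1 : volume (Metric.closedBall (0 : Plane) 1) ≠ ⊤ :=
    measure_closedBall_lt_top.ne
  rw [ENNReal.mul_le_mul_iff_left hb0 hb1, finrank_euclideanSpace_fin,
    ← ENNReal.ofReal_natCast, ← ENNReal.ofReal_mul (by positivity),
    ENNReal.ofReal_le_ofReal_iff (by positivity)] at h3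
  have h4 : ((m + 1) * H) ^ 2 = (4 * γ * (m + 1)) ^ 2 * (H / (4 * γ)) ^ 2 := by
    field_simp
  rw [h4] at h3
  exact le_of_mul_le_mul_right h3 (by positivity)

/-! ### Piecewise affine cutoff functions -/

/-- `η` takes values in `[0, 1]` and is affine with Lipschitz constant `L` on each element. Nothing
is required outside of the mesh, apart from the range; continuity on the mesh follows. -/
structure IsCutoff (𝒯 : Triangulation Ω) (η : Plane → ℝ) (L : ℝ) : Prop where
  mem_Icc : ∀ x, η x ∈ Icc (0 : ℝ) 1
  affine : ∀ t ∈ 𝒯.elems, ∃ f : Plane →ᵃ[ℝ] ℝ, (∀ x ∈ tri t, η x = f x) ∧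
    ∀ x y, |f x - f y| ≤ L * ‖x - y‖

/-- A triangle has an affine function with prescribed values at its vertices. -/
theorem exists_affineMap_eq {t : Finset Plane} (hc : t.card = 3)
    (hi : AffineIndependent ℝ ((↑) : t → Plane)) (χ : Plane → ℝ) :
    ∃ f : Plane →ᵃ[ℝ] ℝ, ∀ z ∈ t, f z = χ z := by
  have hs : affineSpan ℝ (range ((↑) : t → Plane)) = ⊤ := by
    rw [hi.affineSpan_eq_top_iff_card_eq_finrank_add_one]
    simp [hc]
  let b : AffineBasis t ℝ Plane := ⟨(↑), hi, hs⟩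
  refine ⟨∑ z : t, χ z • b.coord z, fun z hz => ?_⟩
  have e : ∀ w : t, b.coord w z = if w = ⟨z, hz⟩ then 1 else 0 :=
    fun w => b.coord_apply w ⟨z, hz⟩
  let ev : (Plane →ᵃ[ℝ] ℝ) →+ ℝ :=
    { toFun := fun f => f z, map_zero' := rfl, map_add' := fun _ _ => rfl }
  change ev _ = _
  rw [map_sum]
  change ∑ w : t, χ w • b.coord w z = χ z
  simp [e]

theorem affineMap_mem_of_mem_tri {t : Set Plane} {f : Plane →ᵃ[ℝ] ℝ} {S : Set ℝ}
    (hS : Convex ℝ S) (h : ∀ z ∈ t, f z ∈ S) {x : Plane} (hx : x ∈ convexHull ℝ t) : f x ∈ S :=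
  convexHull_min (s := t) (t := f ⁻¹' S) h (hS.affine_preimage f) hx

/-- An affine function with values in `[0, 1]` on a ball of radius `r` has slope at most `1 / r`. -/
theorem abs_affineMap_sub_le {f : Plane →ᵃ[ℝ] ℝ} {c : Plane} {r : ℝ} (hr : 0 < r)
    (h : ∀ x ∈ Metric.closedBall c r, f x ∈ Icc (0 : ℝ) 1) (x y : Plane) :
    |f x - f y| ≤ 1 / r * ‖x - y‖ := by
  rcases eq_or_ne x y with rfl | hxy
  · simp
  have hu : 0 < ‖x - y‖ := norm_pos_iff.2 (sub_ne_zero.2 hxy)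
  have h1 := h (c + (r / ‖x - y‖) • (x - y)) (by
    rw [Metric.mem_closedBall, dist_eq_norm, add_sub_cancel_left, norm_smul, Real.norm_eq_abs,
      abs_of_pos (by positivity), div_mul_cancel₀ _ hu.ne'])
  have h2 := h c (Metric.mem_closedBall_self hr.le)
  have e1 : f (c + (r / ‖x - y‖) • (x - y)) = (r / ‖x - y‖) * (f x - f y) + f c := by
    have := f.map_vadd c ((r / ‖x - y‖) • (x - y))
    rw [vadd_eq_add, vadd_eq_add, map_smul, smul_eq_mul] at this
    rw [add_comm, this, ← vsub_eq_sub x y, f.linearMap_vsub, vsub_eq_sub, vsub_eq_sub]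
  rw [e1] at h1
  have h3 : |(r / ‖x - y‖) * (f x - f y)| ≤ 1 := by
    rw [abs_le]; constructor <;> linarith [h1.1, h1.2, h2.1, h2.2]
  rw [abs_mul, abs_of_pos (by positivity), div_mul_eq_mul_div, div_le_one hu] at h3
  rw [div_mul_eq_mul_div, one_mul, le_div_iff₀ hr]
  linarith

/-- The piecewise affine function with given vertex values in `[0, 1]` is a cutoff function. It is
constant on each element whose vertex values are equal. -/
theorem QuasiUniform.exists_isCutoff {H γ : ℝ} (hq : QuasiUniform 𝒯 H γ) (χ : Plane → ℝ)
    (hχ : ∀ z, χ z ∈ Icc (0 : ℝ) 1) :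
    ∃ η : Plane → ℝ, IsCutoff 𝒯 η (4 * γ / H) ∧
      ∀ t ∈ 𝒯.elems, ∀ c, (∀ z ∈ t, χ z = c) → ∀ x ∈ tri t, η x = c := by
  classical
  choose! f hf using fun t (ht : t ∈ 𝒯.elems) =>
    exists_affineMap_eq (𝒯.card_eq t ht) (𝒯.indep t ht) χ
  have h01 : ∀ t ∈ 𝒯.elems, ∀ x ∈ tri t, f t x ∈ Icc (0 : ℝ) 1 := fun t ht x hx =>
    affineMap_mem_of_mem_tri (convex_Icc 0 1) (fun z hz => by rw [hf t ht z hz]; exact hχ z) hx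
  -- by conformity the affine pieces agree on the intersection of two elements, as they do at its
  -- vertices
  have hag : ∀ s ∈ 𝒯.elems, ∀ t ∈ 𝒯.elems, ∀ x, x ∈ tri s → x ∈ tri t → f s x = f t x := by
    intro s hs t ht x hxs hxt
    have hx : x ∈ convexHull ℝ ((s : Set Plane) ∩ t) := by
      rw [← 𝒯.conforming s hs t ht]; exact ⟨hxs, hxt⟩
    have := affineMap_mem_of_mem_tri (f := f s - f t) (convex_singleton (0 : ℝ))
      (fun z hz => by simp [hf s hs z hz.1, hf t ht z hz.2]) hx
    simpa [sub_eq_zero] using this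
  let η : Plane → ℝ := fun x => if h : ∃ t ∈ 𝒯.elems, x ∈ tri t then f h.choose x else 0
  have hη : ∀ t ∈ 𝒯.elems, ∀ x ∈ tri t, η x = f t x := by
    intro t ht x hx
    have h : ∃ t ∈ 𝒯.elems, x ∈ tri t := ⟨t, ht, hx⟩
    simp only [η, dif_pos h]
    exact hag _ h.choose_spec.1 t ht x h.choose_spec.2 hx
  refine ⟨η, ⟨fun x => ?_, fun t ht => ⟨f t, hη t ht, fun x y => ?_⟩⟩, fun t ht c hc x hx => ?_⟩
  · by_cases h : ∃ t ∈ 𝒯.elems, x ∈ tri t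
    · obtain ⟨t, ht, hx⟩ := h
      rw [hη t ht x hx]
      exact h01 t ht x hx
    · simp [η, h]
  · obtain ⟨c, hc⟩ := hq.exists_closedBall_subset ht
    have hγ := hq.pos_gamma ⟨t, ht⟩
    have hH := hq.pos
    have := abs_affineMap_sub_le (f := f t) (by positivity) (fun x hx => h01 t ht x (hc hx)) x y
    rwa [one_div_div] at this
  · rw [hη t ht x hx]
    exact affineMap_mem_of_mem_tri (f := f t) (convex_singleton c)
      (fun z hz => by simpa [hf t ht z hz] using hc z hz) hx

end Mesh

/-! ### Weak derivatives on an interval -/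

section WeakDerivative

/-- The du Bois-Reymond lemma: a function on `(0, L)` with weak derivative zero is constant. -/
theorem exists_ae_eq_const_of_integral_mul_deriv_eq_zero {L : ℝ} (hL : 0 < L) {k : ℝ → ℝ}
    (hk : IntegrableOn k (Ioo 0 L))
    (h : ∀ ψ : ℝ → ℝ, ContDiff ℝ ∞ ψ → HasCompactSupport ψ → tsupport ψ ⊆ Ioo 0 L →
      ∫ s in Ioo 0 L, k s * deriv ψ s = 0) :
    ∃ c, ∀ᵐ s ∂(volume.restrict (Ioo 0 L)), k s = c := by
  let bump : ContDiffBump (L / 2) := ⟨L / 8, L / 4, by positivity, by linarith⟩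
  let θ : ℝ → ℝ := bump.normed volume
  have hθ : ContDiff ℝ ∞ θ := bump.contDiff_normed
  have hθc : HasCompactSupport θ := bump.hasCompactSupport_normed
  have hθs : tsupport θ = Metric.closedBall (L / 2) (L / 4) := bump.tsupport_normed_eq
  have hθi : ∫ s, θ s = 1 := bump.integral_normed
  have hθI : tsupport θ ⊆ Ioo 0 L := by
    rw [hθs, Real.closedBall_eq_Icc]
    exact Icc_subset_Ioo (by linarith) (by linarith)
  have hint : ∀ χ : ℝ → ℝ, Continuous χ → HasCompactSupport χ →
      IntegrableOn (fun s => k s * χ s) (Ioo 0 L) := by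
    intro χ h1 h2
    obtain ⟨C, hC⟩ := h1.bounded_above_of_compact_support h2
    exact Integrable.mul_bdd (c := C) hk h1.aestronglyMeasurable
      (Filter.Eventually.of_forall hC)
  set c : ℝ := ∫ s in Ioo 0 L, k s * θ s with hc
  refine ⟨c, ?_⟩
  have hkc : IntegrableOn (fun s => k s - c) (Ioo 0 L) := by
    refine hk.sub (integrableOn_const ?_)
    simp
  have key := isOpen_Ioo.ae_eq_zero_of_integral_contDiff_smul_eq_zero (μ := volume)
    hkc.locallyIntegrableOn ?_
  · rw [ae_restrict_iff' measurableSet_Ioo]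
    filter_upwards [key] with s hs h1
    linarith [hs h1]
  intro χ hχ hχc hχI
  set J : ℝ := ∫ s, χ s with hJ
  -- subtracting the multiple of `θ` with the same integral leaves a function of mean zero, whose
  -- primitive `ψ` is a test function
  let χ₀ : ℝ → ℝ := fun s => χ s - J * θ s
  have hχ₀ : ContDiff ℝ ∞ χ₀ := hχ.sub (contDiff_const.mul hθ)
  have hχ₀i : ∫ s, χ₀ s = 0 := by
    rw [integral_sub (hχ.continuous.integrable_of_hasCompactSupport hχc)
      ((hθ.continuous.integrable_of_hasCompactSupport hθc).const_mul J),
      integral_const_mul, hθi, mul_one, sub_self]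
  let ψ : ℝ → ℝ := fun s => ∫ r in (0:ℝ)..s, χ₀ r
  have hψd : ∀ s, HasDerivAt ψ (χ₀ s) s := fun s =>
    intervalIntegral.integral_hasDerivAt_right (hχ₀.continuous.intervalIntegrable _ _)
      (hχ₀.continuous.stronglyMeasurableAtFilter _ _) hχ₀.continuous.continuousAt
  have hψd' : deriv ψ = χ₀ := funext fun s => (hψd s).deriv
  have hψ : ContDiff ℝ ∞ ψ := by
    rw [contDiff_infty_iff_deriv, hψd']
    exact ⟨fun s => (hψd s).differentiableAt, hχ₀⟩
  have hK : IsCompact (tsupport χ ∪ tsupport θ) := hχc.isCompact.union hθc.isCompact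
  have hKI : tsupport χ ∪ tsupport θ ⊆ Ioo 0 L := union_subset hχI hθI
  have hKne : (tsupport χ ∪ tsupport θ).Nonempty := by
    refine ⟨L / 2, Or.inr ?_⟩
    rw [hθs]
    exact Metric.mem_closedBall_self (by positivity)
  obtain ⟨a, haK, ha⟩ := hK.exists_isLeast hKne
  obtain ⟨b, hbK, hb⟩ := hK.exists_isGreatest hKne
  have hsupp : ∀ s, χ₀ s ≠ 0 → s ∈ tsupport χ ∪ tsupport θ := by
    intro s hs
    by_contra hn
    rw [mem_union, not_or] at hn
    exact hs (by simp only [χ₀, image_eq_zero_of_notMem_tsupport hn.1,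
      image_eq_zero_of_notMem_tsupport hn.2, mul_zero, sub_zero])
  have hψ0 : ∀ s, s ∉ Icc a b → ψ s = 0 := by
    intro s hs
    rcases lt_or_ge s a with hsa | hsa
    · refine intervalIntegral.integral_zero_ae (Filter.Eventually.of_forall fun r hr => ?_)
      by_contra hne
      have h1 := ha (hsupp r hne)
      rcases hr with ⟨-, hr⟩
      exact absurd hr (not_le.2 (max_lt ((hKI haK).1.trans_le h1) (hsa.trans_le h1)))
    · have hsb : b < s := by
        by_contra hn
        exact hs ⟨hsa, not_lt.1 hn⟩
      have : ψ s = ∫ r, χ₀ r := by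
        refine intervalIntegral.integral_eq_integral_of_support_subset fun r hr => ?_
        have h1 := hsupp r hr
        exact ⟨(hKI h1).1, (hb h1).trans hsb.le⟩
      rw [this, hχ₀i]
  have hψs : tsupport ψ ⊆ Icc a b :=
    closure_minimal (fun s hs => by by_contra hn; exact hs (hψ0 s hn)) isClosed_Icc
  have hψc : HasCompactSupport ψ := isCompact_Icc.of_isClosed_subset (isClosed_tsupport _) hψs
  have h0 := h ψ hψ hψc (hψs.trans (Icc_subset_Ioo (hKI haK).1 (hKI hbK).2))
  rw [hψd'] at h0
  have e1 : ∫ s in Ioo 0 L, k s * χ₀ s = (∫ s in Ioo 0 L, k s * χ s) - J * c := by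
    rw [hc, ← integral_const_mul, ← integral_sub (hint χ hχ.continuous hχc)
      ((hint θ hθ.continuous hθc).const_mul J)]
    refine integral_congr_ae (Filter.Eventually.of_forall fun s => ?_)
    simp only [χ₀]; ring
  have e2 : ∫ s, χ s • (k s - c) = ∫ s in Ioo 0 L, χ s • (k s - c) := by
    symm
    refine setIntegral_eq_integral_of_forall_compl_eq_zero fun s hs => ?_
    rw [image_eq_zero_of_notMem_tsupport fun h => hs (hχI h), zero_smul]
  have e3 : ∫ s in Ioo 0 L, χ s = J := by
    refine setIntegral_eq_integral_of_forall_compl_eq_zero fun s hs => ?_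
    exact image_eq_zero_of_notMem_tsupport fun h => hs (hχI h)
  have e4 : ∫ s in Ioo 0 L, χ s • (k s - c) = (∫ s in Ioo 0 L, k s * χ s) - J * c := by
    rw [← e3, ← integral_mul_const, ← integral_sub (hint χ hχ.continuous hχc)
      ((hχ.continuous.integrable_of_hasCompactSupport hχc).integrableOn.mul_const c)]
    refine integral_congr_ae (Filter.Eventually.of_forall fun s => ?_)
    simp only [smul_eq_mul]; ring
  rw [e2, e4, ← e1, h0]

theorem intervalIntegral_eq_setIntegral_Ioo {L : ℝ} (hL : 0 ≤ L) (f : ℝ → ℝ) :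
    ∫ s in (0:ℝ)..L, f s = ∫ s in Ioo 0 L, f s := by
  rw [intervalIntegral.integral_of_le hL, integral_Ioc_eq_integral_Ioo]

/-- The derivative of an absolutely continuous function is its weak derivative. -/
theorem isWeakDeriv_of_absolutelyContinuous {L : ℝ} (hL : 0 ≤ L) {W g h : ℝ → ℝ}
    (hW : AbsolutelyContinuousOnInterval W 0 L)
    (hg : ∀ᵐ s ∂(volume.restrict (Ioo 0 L)), g s = W s)
    (hh : ∀ᵐ s ∂(volume.restrict (Ioo 0 L)), h s = deriv W s) : IsWeakDeriv L g h := by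
  intro ψ h1 h2 h3
  have hψ : AbsolutelyContinuousOnInterval ψ 0 L :=
    ((h1.of_le (by simp)).contDiffOn).absolutelyContinuousOnInterval
  have h0 : ψ 0 = 0 := image_eq_zero_of_notMem_tsupport fun h => lt_irrefl _ (h3 h).1
  have hl : ψ L = 0 := image_eq_zero_of_notMem_tsupport fun h => lt_irrefl _ (h3 h).2
  have := hW.integral_mul_deriv_eq_deriv_mul hψ
  rw [h0, hl, mul_zero, mul_zero, sub_zero, zero_sub, intervalIntegral_eq_setIntegral_Ioo hL,
    intervalIntegral_eq_setIntegral_Ioo hL] at this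
  rw [integral_congr_ae (f := fun s => g s * deriv ψ s) (g := fun s => W s * deriv ψ s) (hg.mono fun s hs => by
      simp only [hs]), this,
    integral_congr_ae (f := fun s => h s * ψ s) (g := fun s => deriv W s * ψ s)
      (hh.mono fun s hs => by simp only [hs])]

/-- A function with a weak derivative has an absolutely continuous representative. -/
theorem IsWeakDeriv.exists_absolutelyContinuous {L : ℝ} (hL : 0 < L) {g h : ℝ → ℝ}
    (hg : IntegrableOn g (Ioo 0 L)) (hh : IntegrableOn h (Ioo 0 L)) (hw : IsWeakDeriv L g h) :
    ∃ W : ℝ → ℝ, AbsolutelyContinuousOnInterval W 0 L ∧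
      (∀ᵐ s ∂(volume.restrict (Ioo 0 L)), g s = W s) ∧
      ∀ᵐ s ∂(volume.restrict (Ioo 0 L)), h s = deriv W s := by
  have hh' : IntervalIntegrable h volume 0 L := by
    rw [intervalIntegrable_iff_integrableOn_Ioo_of_le hL.le]; exact hh
  let G : ℝ → ℝ := fun s => ∫ r in (0:ℝ)..s, h r
  have hG : AbsolutelyContinuousOnInterval G 0 L :=
    hh'.absolutelyContinuousOnInterval_intervalIntegral (by simp)
  have hGd : ∀ᵐ s ∂(volume.restrict (Ioo 0 L)), HasDerivAt G (h s) s := by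
    rw [ae_restrict_iff' measurableSet_Ioo]
    filter_upwards [hh'.ae_hasDerivAt_integral] with s hs h1
    exact hs (by rw [uIcc_of_le hL.le]; exact Ioo_subset_Icc_self h1) 0 (by simp)
  have hGw : IsWeakDeriv L G h := isWeakDeriv_of_absolutelyContinuous hL.le hG
    (Filter.Eventually.of_forall fun _ => rfl) (hGd.mono fun s hs => hs.deriv.symm)
  have hGi : IntegrableOn G (Ioo 0 L) := by
    have := hG.continuousOn
    rw [uIcc_of_le hL.le] at this
    exact (this.integrableOn_Icc).mono_set Ioo_subset_Icc_self
  obtain ⟨c, hc⟩ := exists_ae_eq_const_of_integral_mul_deriv_eq_zero hL (hg.sub hGi) (by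
    intro ψ h1 h2 h3
    have hb : Continuous (deriv ψ) := h1.continuous_deriv (by simp)
    obtain ⟨C, hC⟩ := hb.bounded_above_of_compact_support h2.deriv
    have i1 : IntegrableOn (fun s => g s * deriv ψ s) (Ioo 0 L) :=
      Integrable.mul_bdd (c := C) hg hb.aestronglyMeasurable (Filter.Eventually.of_forall hC)
    have i2 : IntegrableOn (fun s => G s * deriv ψ s) (Ioo 0 L) :=
      Integrable.mul_bdd (c := C) hGi hb.aestronglyMeasurable (Filter.Eventually.of_forall hC)
    have : ∫ s in Ioo 0 L, (g - G) s * deriv ψ s =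
        (∫ s in Ioo 0 L, g s * deriv ψ s) - ∫ s in Ioo 0 L, G s * deriv ψ s := by
      rw [← integral_sub i1 i2]
      refine integral_congr_ae (Filter.Eventually.of_forall fun s => ?_)
      simp only [Pi.sub_apply]; ring
    rw [this, hw ψ h1 h2 h3, hGw ψ h1 h2 h3, sub_self])
  refine ⟨fun s => G s + c, ?_, ?_, ?_⟩
  · refine hG.fun_add (LipschitzOnWith.absolutelyContinuousOnInterval (K := 0) ?_)
    exact (LipschitzWith.const c).lipschitzOnWith
  · filter_upwards [hc] with s hs
    rw [Pi.sub_apply] at hs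
    linarith
  · filter_upwards [hGd] with s hs
    exact (hs.add_const c).deriv.symm

/-- The product rule for a Lipschitz factor. -/
theorem IsWeakDeriv.lipschitz_mul {L : ℝ} (hL : 0 < L) {g h ξ : ℝ → ℝ}
    (hg : IntegrableOn g (Ioo 0 L)) (hh : IntegrableOn h (Ioo 0 L)) (hw : IsWeakDeriv L g h)
    {K : NNReal} (hξ : LipschitzOnWith K ξ (Icc 0 L)) :
    IsWeakDeriv L (fun s => ξ s * g s) (fun s => ξ s * h s + deriv ξ s * g s) := by
  obtain ⟨W, hW, h1, h2⟩ := hw.exists_absolutelyContinuous hL hg hh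
  have hξ' : AbsolutelyContinuousOnInterval ξ 0 L :=
    LipschitzOnWith.absolutelyContinuousOnInterval (K := K) (by rwa [uIcc_of_le hL.le])
  refine isWeakDeriv_of_absolutelyContinuous hL.le (hξ'.fun_mul hW) ?_ ?_
  · filter_upwards [h1] with s hs
    rw [hs]
  · filter_upwards [h1, h2, ae_restrict_of_ae hξ'.ae_differentiableAt,
      ae_restrict_of_ae hW.ae_differentiableAt, ae_restrict_mem measurableSet_Ioo]
      with s e1 e2 d1 d2 hs
    have hs' : s ∈ uIcc 0 L := by rw [uIcc_of_le hL.le]; exact Ioo_subset_Icc_self hs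
    have := ((d1 hs').hasDerivAt.mul (d2 hs').hasDerivAt).deriv
    change deriv (fun s => ξ s * W s) s = _ at this
    rw [this, e1, e2]
    ring

theorem eqOn_Icc_of_ae_eq_Ioo {L : ℝ} (hL : 0 < L) {f g : ℝ → ℝ}
    (h : f =ᵐ[volume.restrict (Ioo 0 L)] g) (hf : ContinuousOn f (Icc 0 L))
    (hg : ContinuousOn g (Icc 0 L)) : EqOn f g (Icc 0 L) :=
  Measure.eqOn_Icc_of_ae_eq volume hL.ne
    (by rwa [← restrict_Ioo_eq_restrict_Icc]) hf hg

/-- A one-dimensional Sobolev inequality: a continuous representative `w` of `g` is bounded by the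
`L¹` norms of `g` and of its weak derivative `h`. -/
theorem IsWeakDeriv.mul_abs_le {L : ℝ} (hL : 0 < L) {g h w : ℝ → ℝ}
    (hg : IntegrableOn g (Ioo 0 L)) (hh : IntegrableOn h (Ioo 0 L)) (hw : IsWeakDeriv L g h)
    (hc : ContinuousOn w (Icc 0 L)) (hgw : ∀ᵐ s ∂(volume.restrict (Ioo 0 L)), g s = w s)
    {s : ℝ} (hs : s ∈ Icc 0 L) :
    L * |w s| ≤ (∫ r in Ioo 0 L, |g r|) + L * ∫ r in Ioo 0 L, |h r| := by
  obtain ⟨W, hW, h1, h2⟩ := hw.exists_absolutelyContinuous hL hg hh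
  have hWc : ContinuousOn W (Icc 0 L) := by
    have := hW.continuousOn
    rwa [uIcc_of_le hL.le] at this
  have hwW : EqOn w W (Icc 0 L) := by
    have e1 : w =ᵐ[volume.restrict (Ioo 0 L)] W := by
      filter_upwards [h1, hgw] with r a b
      rw [← a, b]
    exact eqOn_Icc_of_ae_eq_Ioo hL e1 hc hWc
  have hd : ∀ r ∈ Icc 0 L, |W s| ≤ |W r| + ∫ r in Ioo 0 L, |h r| := by
    intro r hr
    have hsub : AbsolutelyContinuousOnInterval W r s := hW.mono (by
      rw [uIcc_of_le hL.le]; exact uIcc_subset_Icc hr hs)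
    have e1 := hsub.integral_deriv_eq_sub
    have e2 : |∫ x in r..s, deriv W x| ≤ ∫ x in Ioo 0 L, |h x| := by
      have hi : IntegrableOn (fun x => |deriv W x|) (Ioo 0 L) := by
        refine (Integrable.congr hh.abs ?_)
        filter_upwards [h2] with x hx
        rw [hx]
      have hi' : IntegrableOn (fun x => |deriv W x|) (Icc 0 L) := by
        rwa [integrableOn_Icc_iff_integrableOn_Ioo]
      rw [← Real.norm_eq_abs]
      refine intervalIntegral.norm_integral_le_integral_norm_uIoc.trans ?_
      simp only [Real.norm_eq_abs]
      have e3 : ∫ x in Ioo 0 L, |h x| = ∫ x in Icc 0 L, |deriv W x| := by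
        rw [integral_Icc_eq_integral_Ioo]
        refine integral_congr_ae ?_
        filter_upwards [h2] with x hx
        rw [hx]
      rw [e3]
      refine setIntegral_mono_set hi' (Filter.Eventually.of_forall fun x => abs_nonneg _) ?_
      refine LE.le.eventuallyLE (uIoc_subset_uIcc.trans (uIcc_subset_Icc hr hs))
    rw [e1] at e2
    have := abs_sub_abs_le_abs_sub (W s) (W r)
    linarith
  have hi1 : IntegrableOn (fun r => |W r| + ∫ r in Ioo 0 L, |h r|) (Ioo 0 L) := by
    refine Integrable.add ?_ (integrable_const _)
    exact (hWc.abs.integrableOn_Icc).mono_set Ioo_subset_Icc_self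
  have := setIntegral_mono_on (μ := volume) (integrable_const (|W s|)) hi1 measurableSet_Ioo
    fun r hr => hd r (Ioo_subset_Icc_self hr)
  rw [integral_add ((hWc.abs.integrableOn_Icc).mono_set Ioo_subset_Icc_self) (integrable_const _)]
    at this
  simp only [integral_const, MeasurableSet.univ, measureReal_restrict_apply, univ_inter,
    Real.volume_real_Ioo_of_le hL.le, sub_zero, smul_eq_mul] at this
  rw [hwW hs, integral_congr_ae (g := fun r => |W r|) (h1.mono fun r hr => by simp only [hr])]
  exact this

end WeakDerivative

/-! ### Completeness of the space `V` -/

section Closedness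

variable {Ω : Set Plane} {Γ : Interface Ω}

theorem memLp_of_continuous {X E : Type*} [TopologicalSpace X] [MeasurableSpace X] [BorelSpace X]
    [NormedAddCommGroup E] [SecondCountableTopology X] {μ : Measure X}
    [IsFiniteMeasureOnCompacts μ] {f : X → E} (hf : Continuous f) (hc : HasCompactSupport f)
    (S : Set X) : MemLp f 2 (μ.restrict S) :=
  (hf.memLp_of_hasCompactSupport hc).restrict S

theorem inner_toLp_eq {X : Type*} [MeasurableSpace X] {μ : Measure X} {ψ : X → ℝ}
    (hψ : MemLp ψ 2 μ) (f : Lp ℝ 2 μ) : inner ℝ (hψ.toLp ψ) f = ∫ x, f x * ψ x ∂μ := by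
  rw [L2.inner_def]
  refine integral_congr_ae ?_
  filter_upwards [hψ.coeFn_toLp] with x hx
  rw [hx]; rfl

/-- Weak differentiability as a family of continuous linear conditions. In this form it is seen to
be closed in `L²` and stable under differences. -/
theorem isWeakDeriv_iff {L : ℝ} (g h : Lp ℝ 2 (volume.restrict (Ioo 0 L) : Measure ℝ)) :
    IsWeakDeriv L g h ↔ ∀ (ψ : ℝ → ℝ) (h1 : ContDiff ℝ ∞ ψ) (h2 : HasCompactSupport ψ),
      tsupport ψ ⊆ Ioo 0 L →
      inner ℝ ((memLp_of_continuous (h1.continuous_deriv (by simp)) h2.deriv (Ioo 0 L)).toLp _) g +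
        inner ℝ ((memLp_of_continuous h1.continuous h2 (Ioo 0 L)).toLp ψ) h = 0 := by
  unfold IsWeakDeriv
  refine forall_congr' fun ψ => forall_congr' fun h1 => forall_congr' fun h2 =>
    forall_congr' fun h3 => ?_
  rw [inner_toLp_eq, inner_toLp_eq, eq_neg_iff_add_eq_zero]

theorem IsWeakDeriv.sub {L : ℝ} {g h g' h' : Lp ℝ 2 (volume.restrict (Ioo 0 L) : Measure ℝ)}
    (H : IsWeakDeriv L g h) (H' : IsWeakDeriv L g' h') :
    IsWeakDeriv L ((g - g' : Lp ℝ 2 (volume.restrict (Ioo 0 L) : Measure ℝ)) : ℝ → ℝ)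
      ((h - h' : Lp ℝ 2 (volume.restrict (Ioo 0 L) : Measure ℝ)) : ℝ → ℝ) := by
  rw [isWeakDeriv_iff] at *
  intro ψ h1 h2 h3
  have a := H ψ h1 h2 h3
  have b := H' ψ h1 h2 h3
  rw [inner_sub_right, inner_sub_right]
  linarith

theorem integrable_of_Lp_two {X : Type*} [MeasurableSpace X] {μ : Measure X} [IsFiniteMeasure μ]
    {E : Type*} [NormedAddCommGroup E] (f : Lp E 2 μ) : Integrable f μ :=
  (Lp.memLp f).integrable (by norm_num)

/-- On a finite measure space the `L¹` norm is bounded by the `L²` norm. -/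
theorem exists_integral_abs_le {X : Type*} [MeasurableSpace X] (μ : Measure X) [IsFiniteMeasure μ] :
    ∃ C : ℝ, 0 ≤ C ∧ ∀ f : Lp ℝ 2 μ, ∫ x, |f x| ∂μ ≤ C * ‖f‖ := by
  have h1 : MemLp (fun _ : X => (1 : ℝ)) 2 μ := memLp_const 1
  refine ⟨‖h1.toLp _‖, norm_nonneg _, fun f => ?_⟩
  have h2 : MemLp (fun x => |f x|) 2 μ := (Lp.memLp f).abs
  have e : ∫ x, |f x| ∂μ = inner ℝ (h1.toLp _) (h2.toLp _) := by
    rw [inner_toLp_eq]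
    refine integral_congr_ae ?_
    filter_upwards [h2.coeFn_toLp] with x hx
    rw [hx, mul_one]
  have e2 : ‖h2.toLp _‖ = ‖f‖ := by
    rw [Lp.norm_toLp, Lp.norm_def]
    congr 1
    exact eLpNorm_congr_norm_ae (Filter.Eventually.of_forall fun x => by simp)
  rw [e, ← e2]
  exact real_inner_le_norm _ _

/-- The energy space `V` is closed; the continuity of the traces on `Γ` is preserved since by the
one-dimensional Sobolev inequality the traces converge uniformly. -/
theorem isClosed_V : IsClosed (V Ω Γ : Set ((BulkL2 Ω × BulkL2Vec Ω × InterfaceL2 Γ) ×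
    InterfaceL2 Γ)) := by
  refine IsSeqClosed.isClosed fun u x hu hux => ?_
  have hW : ∀ i, IsWeakDeriv (Γ.len i) (x.1.2.2 i) (x.2 i) := by
    intro i
    rw [isWeakDeriv_iff]
    intro ψ h1 h2 h3
    refine (isClosed_eq (f := fun x : (BulkL2 Ω × BulkL2Vec Ω × InterfaceL2 Γ) × InterfaceL2 Γ =>
      inner ℝ ((memLp_of_continuous (h1.continuous_deriv (by simp)) h2.deriv
        (Ioo 0 (Γ.len i))).toLp _) (x.1.2.2 i) +
        inner ℝ ((memLp_of_continuous h1.continuous h2 (Ioo 0 (Γ.len i))).toLp ψ) (x.2 i))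
      (g := fun _ => 0) ?_ continuous_const).mem_of_tendsto hux
      (Filter.Eventually.of_forall fun n => ?_)
    · refine Continuous.add ?_ ?_
      · exact continuous_const.inner ((continuous_apply i).comp
          (continuous_snd.comp (continuous_snd.comp continuous_fst)))
      · exact continuous_const.inner ((continuous_apply i).comp continuous_snd)
    · exact (isWeakDeriv_iff _ _).1 ((hu n).2.1 i) ψ h1 h2 h3
  refine ⟨?_, hW, ?_⟩
  · exact (Submodule.isClosed_topologicalClosure _).mem_of_tendsto
      ((continuous_fst.tendsto x).comp hux) (Filter.Eventually.of_forall fun n => (hu n).1)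
  choose W hWac hWg hWh using fun i => (hW i).exists_absolutelyContinuous (Γ.len_pos i)
    (integrable_of_Lp_two (x.1.2.2 i)) (integrable_of_Lp_two (x.2 i))
  have hWc : ∀ i, ContinuousOn (W i) (Icc 0 (Γ.len i)) := by
    intro i
    have := (hWac i).continuousOn
    rwa [uIcc_of_le (Γ.len_pos i).le] at this
  choose w hwc hw using fun n => (hu n).2.2
  choose C hC0 hC using fun i : Fin Γ.n =>
    exists_integral_abs_le (volume.restrict (Ioo 0 (Γ.len i)) : Measure ℝ)
  have harc : ∀ i, ∀ s ∈ Icc 0 (Γ.len i), Γ.arc i s ∈ Γ.carrier := fun i s hs =>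
    mem_iUnion.2 ⟨i, s, hs, rfl⟩
  have hwarc : ∀ n i, ContinuousOn (fun s => w n (Γ.arc i s)) (Icc 0 (Γ.len i)) := fun n i =>
    (hwc n).comp (Γ.contDiff i).continuousOn fun s hs => harc i s hs
  -- the distance of the traces in the supremum norm
  have hb : ∀ n i, ∀ s ∈ Icc 0 (Γ.len i), |w n (Γ.arc i s) - W i s| ≤
      (C i / Γ.len i + C i) * ‖u n - x‖ := by
    intro n i s hs
    have hL := Γ.len_pos i
    have h1 := (((hu n).2.1 i).sub (hW i)).mul_abs_le hL (integrable_of_Lp_two _)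
      (integrable_of_Lp_two _) ((hwarc n i).sub (hWc i)) (by
        filter_upwards [hw n i, hWg i, Lp.coeFn_sub ((u n).1.2.2 i) (x.1.2.2 i)] with r a b c
        rw [c, Pi.sub_apply, a, b, Pi.sub_apply]) hs
    have h2 := hC i ((u n).1.2.2 i - x.1.2.2 i)
    have h3 := hC i ((u n).2 i - x.2 i)
    have h4 : ‖(u n).1.2.2 i - x.1.2.2 i‖ ≤ ‖u n - x‖ :=
      (norm_le_pi_norm ((u n - x).1.2.2) i).trans ((norm_snd_le _).trans ((norm_snd_le _).trans
        (norm_fst_le (u n - x))))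
    have h5 : ‖(u n).2 i - x.2 i‖ ≤ ‖u n - x‖ :=
      (norm_le_pi_norm ((u n - x).2) i).trans (norm_snd_le (u n - x))
    have h6 : Γ.len i * |w n (Γ.arc i s) - W i s| ≤
        C i * ‖u n - x‖ + Γ.len i * (C i * ‖u n - x‖) := by
      refine h1.trans (add_le_add (h2.trans ?_) (mul_le_mul_of_nonneg_left (h3.trans ?_) hL.le))
      · exact mul_le_mul_of_nonneg_left h4 (hC0 i)
      · exact mul_le_mul_of_nonneg_left h5 (hC0 i)
    have h7 : (C i / Γ.len i + C i) * ‖u n - x‖ =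
        (C i * ‖u n - x‖ + Γ.len i * (C i * ‖u n - x‖)) / Γ.len i := by
      field_simp
    rw [h7, le_div_iff₀ hL]
    linarith
  set K : ℝ := ∑ i, (C i / Γ.len i + C i) with hK
  have hb' : ∀ n i, ∀ s ∈ Icc 0 (Γ.len i), |w n (Γ.arc i s) - W i s| ≤ K * ‖u n - x‖ := by
    intro n i s hs
    refine (hb n i s hs).trans (mul_le_mul_of_nonneg_right ?_ (norm_nonneg _))
    exact Finset.single_le_sum (f := fun i => C i / Γ.len i + C i)
      (fun j _ => add_nonneg (div_nonneg (hC0 j) (Γ.len_pos j).le) (hC0 j)) (Finset.mem_univ i)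
  have hlim : Filter.Tendsto (fun n => K * ‖u n - x‖) Filter.atTop (nhds 0) := by
    have := (tendsto_iff_norm_sub_tendsto_zero.1 hux).const_mul K
    rwa [mul_zero] at this
  have hex : ∀ p ∈ Γ.carrier, ∃ i, ∃ s ∈ Icc 0 (Γ.len i), Γ.arc i s = p := by
    intro p hp
    obtain ⟨i, s, hs, h⟩ := mem_iUnion.1 hp
    exact ⟨i, s, hs, h⟩
  -- the uniform limit on `Γ` is read off from an arc `I p` through `p` and a parameter `σ p` on it;
  -- the value does not depend on these choices, because all arcs carry limits of the same `w n`
  choose I' σ' hσ' hIσ' using hex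
  classical
  rcases isEmpty_or_nonempty (Fin Γ.n) with hemp | ⟨⟨i₀⟩⟩
  · exact ⟨fun _ => 0, continuousOn_const, fun i => hemp.elim i⟩
  let I : Plane → Fin Γ.n := fun p => if h : p ∈ Γ.carrier then I' p h else i₀
  let σ : Plane → ℝ := fun p => if h : p ∈ Γ.carrier then σ' p h else 0
  have hσ : ∀ p ∈ Γ.carrier, σ p ∈ Icc 0 (Γ.len (I p)) := fun p hp => by
    simp only [I, σ, dif_pos hp]; exact hσ' p hp
  have hIσ : ∀ p ∈ Γ.carrier, Γ.arc (I p) (σ p) = p := fun p hp => by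
    simp only [I, σ, dif_pos hp]; exact hIσ' p hp
  have hfin : ∀ n, ∀ p ∈ Γ.carrier, |w n p - W (I p) (σ p)| ≤ K * ‖u n - x‖ := by
    intro n p hp
    have := hb' n (I p) (σ p) (hσ p hp)
    rwa [hIσ p hp] at this
  refine ⟨fun p => W (I p) (σ p), ?_, fun i => ?_⟩
  · refine TendstoUniformlyOn.continuousOn (F := w) (p := Filter.atTop) ?_
      (Filter.Frequently.of_forall hwc)
    rw [Metric.tendstoUniformlyOn_iff]
    intro ε hε
    filter_upwards [hlim.eventually (gt_mem_nhds hε)] with n hn p hp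
    rw [dist_comm, Real.dist_eq]
    exact (hfin n p hp).trans_lt hn
  · filter_upwards [hWg i, ae_restrict_mem measurableSet_Ioo] with s hs hsI
    rw [hs]
    have hsI' := Ioo_subset_Icc_self hsI
    have hp := harc i s hsI'
    have : |W i s - W (I (Γ.arc i s)) (σ (Γ.arc i s))| ≤ 0 := by
      have h2 : Filter.Tendsto (fun n => K * ‖u n - x‖ + K * ‖u n - x‖) Filter.atTop (nhds 0) := by
        simpa using hlim.add hlim
      refine ge_of_tendsto' h2 fun n => ?_
      have a := hb' n i s hsI'
      have b := hfin n _ hp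
      have := abs_sub_le (W i s) (w n (Γ.arc i s)) (W (I (Γ.arc i s)) (σ (Γ.arc i s)))
      rw [abs_sub_comm (W i s) (w n _)] at this
      linarith
    exact sub_eq_zero.1 (abs_eq_zero.1 (le_antisymm this (abs_nonneg _)))

instance : CompleteSpace (V Ω Γ) := isClosed_V.completeSpace_coe

/-! ### Weak derivatives vanish where the function vanishes -/

/-- Integration by parts for elements of `H¹₀(Ω)`. The test function `ψ` need not vanish on the
boundary of `Ω`. -/
theorem integral_mul_fderiv_eq_neg {x : BulkL2 Ω × BulkL2Vec Ω × InterfaceL2 Γ}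
    (hx : x ∈ H10WithTrace Ω Γ) {ψ : Plane → ℝ} (hψ : ContDiff ℝ ∞ ψ) (hc : HasCompactSupport ψ)
    (b : Plane) :
    (∫ y in Ω, x.1 y * fderiv ℝ ψ y b) = - ∫ y in Ω, inner ℝ (x.2.1 y) (ψ y • b) := by
  have hψ' : Continuous (fderiv ℝ ψ) := hψ.continuous_fderiv (by simp)
  have m1 : MemLp (fun y => fderiv ℝ ψ y b) 2 (volume.restrict Ω) :=
    memLp_of_continuous (hψ'.clm_apply continuous_const)
      (hc.fderiv (𝕜 := ℝ) |>.comp_left (g := fun l : Plane →L[ℝ] ℝ => l b) rfl) Ω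
  have m2 : MemLp (fun y => ψ y • b) 2 (volume.restrict Ω) :=
    memLp_of_continuous (hψ.continuous.smul continuous_const) (hc.smul_right (f' := fun _ => b)) Ω
  have e2 : ∀ q : BulkL2Vec Ω, inner ℝ q (m2.toLp _) = ∫ y in Ω, inner ℝ (q y) (ψ y • b) := by
    intro q
    rw [L2.inner_def]
    refine integral_congr_ae ?_
    filter_upwards [m2.coeFn_toLp] with y hy
    rw [hy]
  suffices h : inner ℝ (m1.toLp _) x.1 + inner ℝ x.2.1 (m2.toLp _) = 0 by
    rw [inner_toLp_eq, e2] at h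
    linarith
  have hcl : IsClosed {x : BulkL2 Ω × BulkL2Vec Ω × InterfaceL2 Γ |
      inner ℝ (m1.toLp _) x.1 + inner ℝ x.2.1 (m2.toLp _) = 0} := by
    refine isClosed_eq (Continuous.add ?_ ?_) continuous_const
    · exact continuous_const.inner continuous_fst
    · exact (continuous_fst.comp continuous_snd).inner continuous_const
  refine closure_minimal ?_ hcl (show x ∈ closure (smoothGraph Ω Γ : Set _) from hx)
  rintro y ⟨φ, p1, p2, p3, p4, p5, p6⟩
  change inner ℝ (m1.toLp _) y.1 + inner ℝ y.2.1 (m2.toLp _) = 0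
  rw [inner_toLp_eq, e2]
  have z : ∀ z, z ∉ Ω → φ z = 0 := fun z hz =>
    image_eq_zero_of_notMem_tsupport fun h => hz (p3 h)
  have z' : ∀ z, z ∉ Ω → fderiv ℝ φ z = 0 := fun z hz => by
    by_contra hne
    exact hz (p3 (support_fderiv_subset ℝ hne))
  have hφ' : Continuous (fderiv ℝ φ) := p1.continuous_fderiv (by simp)
  have i1 : ∫ z in Ω, y.1 z * fderiv ℝ ψ z b = ∫ z, φ z * fderiv ℝ ψ z b := by
    rw [← setIntegral_eq_integral_of_forall_compl_eq_zero (s := Ω)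
      (f := fun z => φ z * fderiv ℝ ψ z b) fun y hy => by rw [z y hy, zero_mul]]
    refine integral_congr_ae ?_
    filter_upwards [p4] with z hz
    rw [hz]
  have i2 : ∫ z in Ω, inner ℝ (y.2.1 z) (ψ z • b) = ∫ z, fderiv ℝ φ z b * ψ z := by
    rw [← setIntegral_eq_integral_of_forall_compl_eq_zero (s := Ω)
      (f := fun z => fderiv ℝ φ z b * ψ z) fun y hy => by rw [z' y hy]; simp]
    refine integral_congr_ae ?_
    filter_upwards [p5] with z hz
    rw [hz, inner_smul_right, mul_comm]
    congr 1
    exact inner_gradient_left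
  rw [i1, i2, integral_mul_fderiv_eq_neg_fderiv_mul_of_integrable, neg_add_cancel]
  · exact ((hφ'.clm_apply continuous_const).mul hψ.continuous).integrable_of_hasCompactSupport
      hc.mul_left
  · exact (p1.continuous.mul (hψ'.clm_apply continuous_const)).integrable_of_hasCompactSupport
      p2.mul_right
  · exact (p1.continuous.mul hψ.continuous).integrable_of_hasCompactSupport hc.mul_left
  · exact fun y _ => p1.differentiable (by simp) y
  · exact fun y _ => hψ.differentiable (by simp) y

/-- If a function in `V` vanishes on an open set, both in the bulk and on the interface, then so do
its gradient and its tangential gradient: they are weak derivatives there. -/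
theorem energyOn_eq_zero_of_massOn_eq_zero (hΩ : IsOpen Ω) (hb : Bornology.IsBounded Ω)
    {G : Set Plane} (hG : IsOpen G)
    {v : V Ω Γ} (h : massOn G v = 0) : energyOn G v = 0 := by
  obtain ⟨h1, h2⟩ := ae_eq_zero_of_sqNormOn_eq_zero hG.measurableSet h
  refine sqNormOn_eq_zero_of_ae hG.measurableSet ?_ fun i => ?_
  · rw [ae_restrict_iff' hΩ.measurableSet] at h1 ⊢
    have _ : IsFiniteMeasure (volume.restrict Ω : Measure Plane) :=
      ⟨by rw [Measure.restrict_apply_univ]; exact hb.measure_lt_top⟩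
    have hgi : IntegrableOn (grad v) Ω := integrable_of_Lp_two (grad v)
    have hloc : LocallyIntegrableOn (grad v) (G ∩ Ω) :=
      (hgi.mono_set inter_subset_right).locallyIntegrableOn
    have := (hG.inter hΩ).ae_eq_zero_of_integral_contDiff_smul_eq_zero (μ := volume) hloc ?_
    · filter_upwards [this] with x hx a b using hx ⟨b, a⟩
    intro ψ p1 p2 p3
    obtain ⟨C, hC⟩ := p1.continuous.bounded_above_of_compact_support p2
    have z : ∀ z, z ∉ Ω → ψ z = 0 := fun z hz =>
      image_eq_zero_of_notMem_tsupport fun h => hz (p3 h).2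
    rw [← setIntegral_eq_integral_of_forall_compl_eq_zero (s := Ω)
      fun y hy => by rw [z y hy, zero_smul]]
    refine ext_inner_right ℝ fun b => ?_
    have hi : IntegrableOn (fun y => ψ y • grad v y) Ω := Integrable.bdd_smul (C := C) hgi
      p1.continuous.aestronglyMeasurable (Filter.Eventually.of_forall hC)
    have e1 := integral_inner (𝕜 := ℝ) hi b
    have e2 := integral_mul_fderiv_eq_neg v.2.1 p1 p2 b
    have e3 : ∫ y in Ω, val v y * fderiv ℝ ψ y b = 0 := by
      refine integral_eq_zero_of_ae ?_
      rw [Filter.EventuallyEq, ae_restrict_iff' hΩ.measurableSet]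
      filter_upwards [h1] with y hy hyΩ
      by_cases hyG : y ∈ G
      · rw [hy hyΩ hyG, zero_mul]; rfl
      · have : fderiv ℝ ψ y = 0 := by
          by_contra hne
          exact hyG (p3 (support_fderiv_subset ℝ hne)).1
        rw [this]; simp
    rw [inner_zero_left, real_inner_comm, ← e1]
    change ∫ y in Ω, val v y * fderiv ℝ ψ y b = - ∫ y in Ω, inner ℝ (grad v y) (ψ y • b) at e2
    rw [e3, zero_eq_neg] at e2
    rw [← e2]
    refine integral_congr_ae (Filter.Eventually.of_forall fun y => ?_)
    simp only [inner_smul_right, real_inner_comm]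
  · have h2i := h2 i
    rw [ae_restrict_iff' measurableSet_Ioo] at h2i ⊢
    have hU : IsOpen (Γ.params i G) :=
      ((Γ.contDiff i).continuousOn.mono Ioo_subset_Icc_self).isOpen_inter_preimage isOpen_Ioo hG
    have hloc : LocallyIntegrableOn (tgrad v i) (Γ.params i G) := by
      have : IntegrableOn (tgrad v i) (Ioo 0 (Γ.len i)) := integrable_of_Lp_two (tgrad v i)
      exact (this.mono_set (params_subset i G)).locallyIntegrableOn
    have := hU.ae_eq_zero_of_integral_contDiff_smul_eq_zero (μ := volume) hloc ?_
    · filter_upwards [this] with x hx a b using hx ⟨a, b⟩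
    intro ψ p1 p2 p3
    have z : ∀ z, z ∉ Ioo 0 (Γ.len i) → ψ z = 0 := fun z hz =>
      image_eq_zero_of_notMem_tsupport fun h => hz (p3 h).1
    rw [← setIntegral_eq_integral_of_forall_compl_eq_zero (s := Ioo 0 (Γ.len i))
      fun y hy => by rw [z y hy, zero_smul]]
    have e2 := v.2.2.1 i ψ p1 p2 (p3.trans (params_subset i G))
    have e3 : ∫ s in Ioo 0 (Γ.len i), trace v i s * deriv ψ s = 0 := by
      refine integral_eq_zero_of_ae ?_
      rw [Filter.EventuallyEq, ae_restrict_iff' measurableSet_Ioo]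
      filter_upwards [h2i] with y hy hyI
      by_cases hyG : Γ.arc i y ∈ G
      · rw [hy hyI hyG, zero_mul]; rfl
      · have : deriv ψ y = 0 := by
          by_contra hne
          exact hyG (p3 (support_deriv_subset hne)).2
        rw [this]; simp
    change ∫ s in Ioo 0 (Γ.len i), trace v i s * deriv ψ s =
      - ∫ s in Ioo 0 (Γ.len i), tgrad v i s * ψ s at e2
    rw [e3, zero_eq_neg] at e2
    refine Eq.trans ?_ e2
    refine integral_congr_ae (Filter.Eventually.of_forall fun y => ?_)
    simp only [smul_eq_mul, mul_comm]

theorem Triangulation.isBounded (𝒯 : Triangulation Ω) : Bornology.IsBounded Ω :=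
  ((Bornology.isBounded_biUnion_finset _).2 fun t _ => (isCompact_tri t).isBounded).subset
    𝒯.domain_subset

end Closedness

/-! ### Regularity of the cutoff functions -/

section CutoffRegularity

variable {Ω : Set Plane} {Γ : Interface Ω} {𝒯 : Triangulation Ω} {η : Plane → ℝ} {L : ℝ}

/-- Points of the mesh near `p` share an element with `p`. -/
theorem Triangulation.eventually_mem_tri (𝒯 : Triangulation Ω) (p : Plane) :
    ∀ᶠ y in nhdsWithin p 𝒯.support, ∃ t ∈ 𝒯.elems, p ∈ tri t ∧ y ∈ tri t := by
  have h : ∀ᶠ y in nhds p, ∀ t ∈ 𝒯.elems, p ∉ tri t → y ∉ tri t := by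
    rw [Filter.eventually_all_finset]
    intro t _
    by_cases hp : p ∈ tri t
    · exact Filter.Eventually.of_forall fun y h => absurd hp h
    · filter_upwards [(isClosed_tri t).isOpen_compl.mem_nhds hp] with y hy _ using hy
  filter_upwards [nhdsWithin_le_nhds h, self_mem_nhdsWithin] with y hy hyS
  obtain ⟨t, ht, hyt⟩ := Triangulation.mem_support.1 hyS
  by_contra! hn
  exact hy t ht (fun hp => hn t ht hp hyt) hyt

/-- Near a point `p`, a cutoff function is compared with its value at `p` within a single element. -/
theorem IsCutoff.eventually_abs_sub_le (hη : IsCutoff 𝒯 η L) (p : Plane) :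
    ∀ᶠ y in nhdsWithin p 𝒯.support, |η y - η p| ≤ L * ‖y - p‖ := by
  filter_upwards [𝒯.eventually_mem_tri p] with y ⟨t, ht, hp, hy⟩
  obtain ⟨f, hf, hL⟩ := hη.affine t ht
  rw [hf y hy, hf p hp]
  exact hL y p

theorem IsCutoff.eventually_eq_const (p : Plane) {c : ℝ}
    (h : ∀ t ∈ 𝒯.elems, p ∈ tri t → ∀ x ∈ tri t, η x = c) :
    ∀ᶠ y in nhdsWithin p 𝒯.support, η y = c := by
  filter_upwards [𝒯.eventually_mem_tri p] with y ⟨t, ht, hp, hy⟩ using h t ht hp y hy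

theorem IsCutoff.continuousOn (hη : IsCutoff 𝒯 η L) : ContinuousOn η 𝒯.support := by
  intro p _
  rw [ContinuousWithinAt, tendsto_iff_norm_sub_tendsto_zero]
  refine squeeze_zero' (Filter.Eventually.of_forall fun _ => norm_nonneg _)
    (hη.eventually_abs_sub_le p) ?_
  have : Filter.Tendsto (fun y => L * ‖y - p‖) (nhds p) (nhds (L * ‖p - p‖)) :=
    (Continuous.tendsto (by fun_prop) p)
  rw [sub_self, norm_zero, mul_zero] at this
  exact this.mono_left nhdsWithin_le_nhds

theorem Triangulation.support_mem_nhds (𝒯 : Triangulation Ω) {p : Plane} (hp : p ∈ Ω) :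
    𝒯.support ∈ nhds p := Filter.mem_of_superset (𝒯.isOpen.mem_nhds hp) 𝒯.domain_subset

/-- A function on an interval whose increments to the right are locally bounded by `M` is Lipschitz
with constant `M`. -/
theorem abs_sub_le_of_eventually {f : ℝ → ℝ} {a b M : ℝ} (hab : a ≤ b)
    (hc : ContinuousOn f (Icc a b))
    (h : ∀ x ∈ Ico a b, ∀ᶠ z in nhdsWithin x (Ioi x), |f z - f x| ≤ M * (z - x)) :
    |f b - f a| ≤ M * (b - a) := by
  have key : ∀ g : ℝ → ℝ, ContinuousOn g (Icc a b) →
      (∀ x ∈ Ico a b, ∀ᶠ z in nhdsWithin x (Ioi x), g z - g x ≤ M * (z - x)) →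
      g b ≤ g a + M * (b - a) := by
    intro g hg hs
    -- the mean value inequality for right slopes
    refine image_le_of_liminf_slope_right_le_deriv_boundary (f := g)
      (B := fun x => g a + M * (x - a)) (B' := fun _ => M) hg (by simp) (by fun_prop) ?_ ?_
      (right_mem_Icc.2 hab)
    · intro x _
      have : HasDerivAt (fun x => g a + M * (x - a)) (M * 1) x :=
        (((hasDerivAt_id x).sub_const a).const_mul M).const_add _
      rw [mul_one] at this
      exact this.hasDerivWithinAt
    · intro x hx r hr
      refine Filter.Eventually.frequently ?_
      filter_upwards [hs x hx, self_mem_nhdsWithin] with z hz hzx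
      have hpos : 0 < z - x := sub_pos.2 hzx
      rw [slope_def_field, div_lt_iff₀ hpos]
      exact hz.trans_lt (mul_lt_mul_of_pos_right hr hpos)
  have h1 := key f hc fun x hx => (h x hx).mono fun z hz => (le_abs_self _).trans hz
  have h2 := key (fun x => -f x) hc.neg fun x hx => (h x hx).mono fun z hz => by
    have := (neg_abs_le (f z - f x)); linarith
  rw [abs_le]; constructor <;> linarith

/-- A cutoff function is Lipschitz along Lipschitz curves in the mesh. In general it is not Lipschitz
on `Ω` with constant `L`, as `Ω` need not be convex; segments and arcs of `Γ` are all that is needed.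
-/
theorem IsCutoff.abs_sub_le_of_curve (hη : IsCutoff 𝒯 η L) (hL : 0 ≤ L) {c : ℝ → Plane}
    {a b K : ℝ} (hab : a ≤ b) (hc : ∀ x ∈ Icc a b, ∀ y ∈ Icc a b, ‖c y - c x‖ ≤ K * |y - x|)
    (hm : MapsTo c (Icc a b) 𝒯.support) : |η (c b) - η (c a)| ≤ L * K * (b - a) := by
  have hcc : ContinuousOn c (Icc a b) := by
    intro x hx
    rw [ContinuousWithinAt, tendsto_iff_norm_sub_tendsto_zero]
    refine squeeze_zero' (Filter.Eventually.of_forall fun _ => norm_nonneg _)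
      (by filter_upwards [self_mem_nhdsWithin] with y hy using hc x hx y hy) ?_
    have : Filter.Tendsto (fun y => K * |y - x|) (nhds x) (nhds (K * |x - x|)) :=
      (Continuous.tendsto (by fun_prop) x)
    rw [sub_self, abs_zero, mul_zero] at this
    exact this.mono_left nhdsWithin_le_nhds
  refine abs_sub_le_of_eventually (f := fun x => η (c x)) hab (hη.continuousOn.comp hcc hm) ?_
  intro x hx
  have hxI : x ∈ Icc a b := Ico_subset_Icc_self hx
  have h1 : Filter.Tendsto c (nhdsWithin x (Ioi x)) (nhdsWithin (c x) 𝒯.support) := by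
    have : nhdsWithin x (Ioi x) ≤ nhdsWithin x (Icc a b) := by
      refine nhdsWithin_le_of_mem ?_
      filter_upwards [Ioo_mem_nhdsGT hx.2] with z hz using ⟨hx.1.trans hz.1.le, hz.2.le⟩
    exact ((hcc x hxI).tendsto_nhdsWithin hm).mono_left this
  filter_upwards [h1.eventually (hη.eventually_abs_sub_le (c x)), Ioo_mem_nhdsGT hx.2]
    with z hz hzI
  have h2 := hc x hxI z ⟨hx.1.trans hzI.1.le, hzI.2.le⟩
  rw [abs_of_pos (sub_pos.2 hzI.1)] at h2
  calc |η (c z) - η (c x)| ≤ L * ‖c z - c x‖ := hz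
    _ ≤ L * (K * (z - x)) := mul_le_mul_of_nonneg_left h2 hL
    _ = L * K * (z - x) := by ring

theorem IsCutoff.abs_sub_le_of_segment (hη : IsCutoff 𝒯 η L) (hL : 0 ≤ L) {x y : Plane}
    (h : segment ℝ x y ⊆ Ω) : |η y - η x| ≤ L * ‖y - x‖ := by
  have := hη.abs_sub_le_of_curve hL (c := AffineMap.lineMap x y) (a := 0) (b := 1)
    (K := ‖y - x‖) zero_le_one ?_ ?_
  · simpa using this
  · intro s _ r _
    rw [← dist_eq_norm, dist_lineMap_lineMap, dist_comm x y, dist_eq_norm y x, Real.dist_eq, mul_comm]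
  · intro s hs
    refine 𝒯.domain_subset (h ?_)
    rw [segment_eq_image_lineMap]
    exact ⟨s, hs, rfl⟩

theorem IsCutoff.lipschitzOnWith_ball (hη : IsCutoff 𝒯 η L) (hL : 0 ≤ L) {p : Plane} {r : ℝ}
    (h : Metric.ball p r ⊆ Ω) : LipschitzOnWith L.toNNReal η (Metric.ball p r) := by
  refine LipschitzOnWith.of_dist_le_mul fun x hx y hy => ?_
  rw [Real.dist_eq, dist_eq_norm, Real.coe_toNNReal L hL]
  exact hη.abs_sub_le_of_segment hL
    (((convex_ball p r).segment_subset hy hx).trans h)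

theorem IsCutoff.norm_gradient_le (hη : IsCutoff 𝒯 η L) (hL : 0 ≤ L) {p : Plane} (hp : p ∈ Ω) :
    ‖gradient η p‖ ≤ L := by
  obtain ⟨r, hr, h⟩ := Metric.isOpen_iff.1 𝒯.isOpen p hp
  have := norm_fderiv_le_of_lipschitzOn ℝ (Metric.ball_mem_nhds p hr)
    (hη.lipschitzOnWith_ball hL h)
  rw [Real.coe_toNNReal L hL] at this
  rwa [gradient, LinearIsometryEquiv.norm_map]

/-- The gradient of a cutoff function vanishes at `p` if the function is constant, with the same
value, on all elements which contain `p`. -/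
theorem IsCutoff.gradient_eq_zero {p : Plane} (hp : p ∈ Ω) {c : ℝ}
    (h : ∀ t ∈ 𝒯.elems, p ∈ tri t → ∀ x ∈ tri t, η x = c) : gradient η p = 0 := by
  have h1 : η =ᶠ[nhds p] fun _ => c := by
    have := IsCutoff.eventually_eq_const (η := η) p h
    rwa [nhdsWithin_eq_nhds.2 (𝒯.support_mem_nhds hp)] at this
  rw [gradient, h1.fderiv_eq]
  simp

theorem differentiable_affineMap (f : Plane →ᵃ[ℝ] ℝ) : Differentiable ℝ f := by
  rw [f.decomp]
  exact (LinearMap.toContinuousLinearMap f.linear).differentiable.add_const _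

/-- A cutoff function is differentiable in the interiors of the elements, and the boundary of a
triangle is a null set. -/
theorem IsCutoff.ae_differentiableAt (hη : IsCutoff 𝒯 η L) :
    ∀ᵐ x ∂(volume.restrict Ω : Measure Plane), DifferentiableAt ℝ η x := by
  rw [ae_restrict_iff' 𝒯.measurableSet]
  have h : ∀ᵐ x ∂(volume : Measure Plane), ∀ t ∈ 𝒯.elems, x ∉ frontier (tri t) := by
    rw [Filter.eventually_all_finset]
    intro t _
    exact measure_eq_zero_iff_ae_notMem.1 ((convex_tri t).addHaar_frontier volume)
  filter_upwards [h] with x hx hxΩ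
  obtain ⟨t, ht, hxt⟩ := Triangulation.mem_support.1 (𝒯.domain_subset hxΩ)
  obtain ⟨f, hf, -⟩ := hη.affine t ht
  have hi : x ∈ interior (tri t) := by
    by_contra hn
    exact hx t ht ⟨subset_closure hxt, hn⟩
  refine (differentiable_affineMap f x).congr_of_eventuallyEq ?_
  filter_upwards [mem_interior_iff_mem_nhds.1 hi] with y hy using hf y hy

theorem norm_arc_sub_le (i : Fin Γ.n) {x y : ℝ} (hx : x ∈ Icc 0 (Γ.len i))
    (hy : y ∈ Icc 0 (Γ.len i)) : ‖Γ.arc i y - Γ.arc i x‖ ≤ 1 * |y - x| :=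
  (convex_Icc 0 (Γ.len i)).norm_image_sub_le_of_norm_derivWithin_le
    ((Γ.contDiff i).differentiableOn (by simp)) (fun s hs => (Γ.unit_speed i s hs).le) hx hy

theorem arc_mem_closure (i : Fin Γ.n) {x : ℝ} (hx : x ∈ Icc 0 (Γ.len i)) :
    Γ.arc i x ∈ closure Ω := by
  have h := (Γ.contDiff i).continuousOn
  rw [← closure_Ioo (Γ.len_pos i).ne] at h hx
  exact (Γ.mapsTo i).closure_of_continuousOn h hx

theorem Triangulation.closure_subset (𝒯 : Triangulation Ω) : closure Ω ⊆ 𝒯.support :=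
  closure_minimal 𝒯.domain_subset Triangulation.isClosed_support

theorem IsCutoff.lipschitzOnWith_arc (hη : IsCutoff 𝒯 η L) (hL : 0 ≤ L) (i : Fin Γ.n) :
    LipschitzOnWith L.toNNReal (fun s => η (Γ.arc i s)) (Icc 0 (Γ.len i)) := by
  have key : ∀ x ∈ Icc 0 (Γ.len i), ∀ y ∈ Icc 0 (Γ.len i), x ≤ y →
      |η (Γ.arc i y) - η (Γ.arc i x)| ≤ L * |y - x| := by
    intro x hx y hy hxy
    have hsub : Icc x y ⊆ Icc 0 (Γ.len i) := Icc_subset_Icc hx.1 hy.2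
    have := hη.abs_sub_le_of_curve hL (c := Γ.arc i) (K := 1) hxy
      (fun s hs r hr => norm_arc_sub_le i (hsub hs) (hsub hr))
      (fun s hs => 𝒯.closure_subset (arc_mem_closure i (hsub hs)))
    rwa [mul_one, ← abs_of_nonneg (sub_nonneg.2 hxy)] at this
  refine LipschitzOnWith.of_dist_le_mul fun x hx y hy => ?_
  rw [Real.dist_eq, Real.dist_eq, Real.coe_toNNReal L hL]
  rcases le_total x y with h | h
  · rw [abs_sub_comm, abs_sub_comm x]
    exact key x hx y hy h
  · exact key y hy x hx h

theorem IsCutoff.abs_deriv_arc_le (hη : IsCutoff 𝒯 η L) (hL : 0 ≤ L) (i : Fin Γ.n) {s : ℝ}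
    (hs : s ∈ Ioo 0 (Γ.len i)) : |deriv (fun s => η (Γ.arc i s)) s| ≤ L := by
  have := norm_deriv_le_of_lipschitzOn (Icc_mem_nhds hs.1 hs.2) (hη.lipschitzOnWith_arc hL i)
  rwa [Real.coe_toNNReal L hL] at this

theorem IsCutoff.deriv_arc_eq_zero (i : Fin Γ.n) {s : ℝ}
    (hs : s ∈ Ioo 0 (Γ.len i)) {c : ℝ}
    (h : ∀ t ∈ 𝒯.elems, Γ.arc i s ∈ tri t → ∀ x ∈ tri t, η x = c) :
    deriv (fun s => η (Γ.arc i s)) s = 0 := by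
  have h1 : ∀ᶠ y in nhds (Γ.arc i s), η y = c := by
    have := IsCutoff.eventually_eq_const (η := η) _ h
    rwa [nhdsWithin_eq_nhds.2 (𝒯.support_mem_nhds (Γ.mapsTo i hs))] at this
  have hc : ContinuousAt (Γ.arc i) s :=
    (Γ.contDiff i).continuousOn.continuousAt (Icc_mem_nhds hs.1 hs.2)
  have h2 : (fun s => η (Γ.arc i s)) =ᶠ[nhds s] fun _ => c := hc.eventually h1
  rw [h2.deriv_eq]
  simp

end CutoffRegularity

/-! ### Lipschitz functions belong to `H¹₀` -/

section Mollification

variable {Ω : Set Plane} {Γ : Interface Ω}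

/-- Dominated convergence in `L²` for uniformly bounded sequences on a finite measure space. -/
theorem tendsto_toLp_of_bounded {X E : Type*} [MeasurableSpace X] {μ : Measure X}
    [IsFiniteMeasure μ] [NormedAddCommGroup E] [InnerProductSpace ℝ E] {F : ℕ → X → E} {G : X → E}
    (hF : ∀ n, MemLp (F n) 2 μ) (hG : MemLp G 2 μ) {C : ℝ} (hb : ∀ n, ∀ᵐ x ∂μ, ‖F n x‖ ≤ C)
    (hbG : ∀ᵐ x ∂μ, ‖G x‖ ≤ C)
    (hlim : ∀ᵐ x ∂μ, Filter.Tendsto (fun n => F n x) Filter.atTop (nhds (G x))) :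
    Filter.Tendsto (fun n => (hF n).toLp (F n)) Filter.atTop (nhds (hG.toLp G)) := by
  rw [tendsto_iff_norm_sub_tendsto_zero]
  have e : ∀ n, ‖(hF n).toLp (F n) - hG.toLp G‖ = √(∫ x, ‖F n x - G x‖ ^ 2 ∂μ) := by
    intro n
    rw [← MemLp.toLp_sub, ← Real.sqrt_sq (norm_nonneg _), ← real_inner_self_eq_norm_sq,
      L2.inner_def]
    congr 1
    refine integral_congr_ae ?_
    filter_upwards [((hF n).sub hG).coeFn_toLp] with x hx
    rw [hx, real_inner_self_eq_norm_sq, Pi.sub_apply]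
  simp_rw [e]
  have h0 : Filter.Tendsto (fun n => ∫ x, ‖F n x - G x‖ ^ 2 ∂μ) Filter.atTop
      (nhds (∫ x, (0 : ℝ) ∂μ)) := by
    refine tendsto_integral_of_dominated_convergence (fun _ => (2 * C) ^ 2)
      (fun n => ((hF n).sub hG).aestronglyMeasurable.norm.pow 2) (integrable_const _)
      (fun n => ?_) ?_
    · filter_upwards [hb n, hbG] with x h1 h2
      rw [Real.norm_eq_abs, abs_of_nonneg (sq_nonneg _)]
      refine pow_le_pow_left₀ (norm_nonneg _) ?_ 2
      exact (norm_sub_le _ _).trans (by linarith)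
    · filter_upwards [hlim] with x hx
      have := (tendsto_iff_norm_sub_tendsto_zero.1 hx).pow 2
      simpa using this
  rw [integral_zero] at h0
  simpa using h0.sqrt

/-- The convolution of a smooth bump with a Lipschitz function is differentiated by
differentiating the Lipschitz function. -/
theorem hasFDerivAt_convolution_lipschitz {ρ f : Plane → ℝ} (hρ : Continuous ρ)
    (hρc : HasCompactSupport ρ) {K : NNReal} (hf : LipschitzWith K f) (x : Plane) :
    HasFDerivAt (convolution ρ f (ContinuousLinearMap.lsmul ℝ ℝ) volume)
      (convolution ρ (fderiv ℝ f) (ContinuousLinearMap.lsmul ℝ ℝ) volume x) x := by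
  have hint : Integrable ρ := hρ.integrable_of_hasCompactSupport hρc
  have hd : ∀ᵐ y : Plane, DifferentiableAt ℝ f (x - y) :=
    (quasiMeasurePreserving_sub_left volume x).ae hf.ae_differentiableAt
  have hcont : ∀ z : Plane, Continuous fun y => ρ y • f (z - y) := fun z =>
    hρ.smul (hf.continuous.comp (continuous_const.sub continuous_id))
  refine (hasFDerivAt_integral_of_dominated_loc_of_lip (s := univ)
    (F := fun z y => (ContinuousLinearMap.lsmul ℝ ℝ) (ρ y) (f (z - y)))
    (bound := fun y => |ρ y| * K) Filter.univ_mem ?_ ?_ ?_ ?_ ?_ ?_).2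
  · exact Filter.Eventually.of_forall fun z => (hcont z).aestronglyMeasurable
  · exact (hcont x).integrable_of_hasCompactSupport hρc.smul_right
  · exact hρ.aestronglyMeasurable.smul
      ((measurable_fderiv ℝ f).comp (measurable_const.sub measurable_id)).aestronglyMeasurable
  · refine Filter.Eventually.of_forall fun y => ?_
    refine LipschitzOnWith.of_dist_le_mul fun z _ z' _ => ?_
    have h1 := hf.dist_le_mul (z - y) (z' - y)
    rw [dist_sub_right] at h1
    rw [Real.coe_nnabs, abs_of_nonneg (by positivity)]
    simp only [ContinuousLinearMap.lsmul_apply, smul_eq_mul, Real.dist_eq] at h1 ⊢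
    rw [← mul_sub, abs_mul, mul_assoc]
    exact mul_le_mul_of_nonneg_left h1 (abs_nonneg _)
  · exact hint.abs.mul_const _
  · filter_upwards [hd] with y hy
    have h1 : HasFDerivAt (fun z => f (z - y)) (fderiv ℝ f (x - y)) x :=
      hy.hasFDerivAt.comp (f := fun z => z - y) x ((hasFDerivAt_id x).sub_const y)
    exact h1.const_smul (ρ y)

/-- A Lipschitz function with compact support in `Ω` belongs to `H¹₀(Ω)`; its weak gradient and its
trace are the classical ones. Mollification approximates it by smooth functions, the gradients
converging almost everywhere by Lebesgue differentiation. -/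
theorem exists_mem_H10WithTrace_of_lipschitz (hΩ : IsOpen Ω) (hΩb : Bornology.IsBounded Ω)
    {f : Plane → ℝ} {K : NNReal} (hf : LipschitzWith K f)
    (hc : HasCompactSupport f) (hs : tsupport f ⊆ Ω) :
    ∃ y ∈ H10WithTrace Ω Γ, y.1 =ᵐ[volume.restrict Ω] f ∧
      y.2.1 =ᵐ[volume.restrict Ω] gradient f ∧
      ∀ i, y.2.2 i =ᵐ[volume.restrict (Ioo 0 (Γ.len i))] fun s => f (Γ.arc i s) := by
  have _ : IsFiniteMeasure (volume.restrict Ω : Measure Plane) :=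
    ⟨by rw [Measure.restrict_apply_univ]; exact hΩb.measure_lt_top⟩
  obtain ⟨δ, hδ, hδΩ⟩ := hc.isCompact.exists_cthickening_subset_open hΩ hs
  obtain ⟨M, hM⟩ := hf.continuous.bounded_above_of_compact_support hc
  have hfm : Measurable (fderiv ℝ f) := measurable_fderiv ℝ f
  have hfb : ∀ x, ‖fderiv ℝ f x‖ ≤ K := fun x => norm_fderiv_le_of_lipschitz ℝ hf
  -- radii of at most `δ` keep the support in `Ω`
  let ρ : ℕ → ContDiffBump (0 : Plane) := fun n =>
    ⟨δ / (n + 1) / 2, δ / (n + 1), by positivity, half_lt_self (by positivity)⟩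
  have hr : ∀ n, (ρ n).rOut = δ / (n + 1) := fun n => rfl
  have hρ0 : Filter.Tendsto (fun n => (ρ n).rOut) Filter.atTop (nhds 0) := by
    simp only [hr]
    exact tendsto_const_nhds.div_atTop
      (Filter.tendsto_atTop_add_const_right _ _ tendsto_natCast_atTop_atTop)
  have hρK : ∀ᶠ n in Filter.atTop, (ρ n).rOut ≤ 2 * (ρ n).rIn :=
    Filter.Eventually.of_forall fun n => by
      change δ / (n + 1) ≤ 2 * (δ / (n + 1) / 2); linarith
  let F : ℕ → Plane → ℝ := fun n =>
    convolution ((ρ n).normed volume) f (ContinuousLinearMap.lsmul ℝ ℝ) volume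
  have hFs : ∀ n, ContDiff ℝ ∞ (F n) := fun n =>
    (ρ n).hasCompactSupport_normed.contDiff_convolution_left _ (ρ n).contDiff_normed
      hf.continuous.locallyIntegrable
  have hFd : ∀ n x, HasFDerivAt (F n) (convolution ((ρ n).normed volume) (fderiv ℝ f)
      (ContinuousLinearMap.lsmul ℝ ℝ) volume x) x := fun n x =>
    hasFDerivAt_convolution_lipschitz ((ρ n).contDiff_normed (n := 0)).continuous
      (ρ n).hasCompactSupport_normed hf x
  have hFt : ∀ n, tsupport (F n) ⊆ Ω := by
    intro n
    refine (closure_minimal ?_ Metric.isClosed_cthickening).trans hδΩ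
    intro x hx
    obtain ⟨a, ha, b, hb, rfl⟩ := support_convolution_subset _ hx
    rw [(ρ n).support_normed_eq, Metric.mem_ball, dist_zero_right, hr] at ha
    refine Metric.mem_cthickening_of_dist_le _ b δ _ (subset_tsupport f hb) ?_
    rw [dist_eq_norm]
    have : δ / ((n : ℝ) + 1) ≤ δ := div_le_self hδ.le (by linarith [n.cast_nonneg (α := ℝ)])
    rw [add_sub_cancel_right]
    linarith
  have hFc : ∀ n, HasCompactSupport (F n) := fun n =>
    (ρ n).hasCompactSupport_normed.convolution _ hc
  have hFapp : ∀ n x, |F n x - f x| ≤ K * (ρ n).rOut := by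
    intro n x
    have := (ρ n).dist_normed_convolution_le (μ := volume) (g := f) (x₀ := x)
      (ε := K * (ρ n).rOut) hf.continuous.aestronglyMeasurable (fun y hy => by
        refine (hf.dist_le_mul y x).trans ?_
        exact mul_le_mul_of_nonneg_left (Metric.mem_ball.1 hy).le K.coe_nonneg)
    rwa [Real.dist_eq] at this
  have hlim0 : ∀ x, Filter.Tendsto (fun n => F n x) Filter.atTop (nhds (f x)) := by
    intro x
    rw [tendsto_iff_norm_sub_tendsto_zero]
    refine squeeze_zero (fun _ => norm_nonneg _) (fun n => hFapp n x) ?_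
    simpa using hρ0.const_mul (K : ℝ)
  have hFb : ∀ n x, ‖F n x‖ ≤ M + K * δ := by
    intro n x
    have h1 := hFapp n x
    have h2 := hM x
    have h3 : (ρ n).rOut ≤ δ := by
      rw [hr]; exact div_le_self hδ.le (by linarith [n.cast_nonneg (α := ℝ)])
    have h4 := mul_le_mul_of_nonneg_left h3 K.coe_nonneg
    rw [Real.norm_eq_abs] at h2 ⊢
    have := abs_sub_abs_le_abs_sub (F n x) (f x)
    linarith
  have hfb' : ∀ x, ‖f x‖ ≤ M + K * δ := fun x => (hM x).trans (by
    have := mul_nonneg K.coe_nonneg hδ.le; linarith)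
  have hgb : ∀ n x, ‖gradient (F n) x‖ ≤ K := by
    intro n x
    rw [gradient, LinearIsometryEquiv.norm_map, (hFd n x).fderiv]
    have h1 : Integrable (fun t => (ρ n).normed volume t * K) :=
      (ρ n).integrable_normed.mul_const _
    refine (norm_integral_le_of_norm_le h1 (Filter.Eventually.of_forall fun t => ?_)).trans
      (le_of_eq ?_)
    · rw [ContinuousLinearMap.lsmul_apply, norm_smul, Real.norm_eq_abs,
        abs_of_nonneg ((ρ n).nonneg_normed t)]
      exact mul_le_mul_of_nonneg_left (hfb _) ((ρ n).nonneg_normed t)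
    · rw [integral_mul_const, (ρ n).integral_normed, one_mul]
  have hgb' : ∀ x, ‖gradient f x‖ ≤ K := by
    intro x
    rw [gradient, LinearIsometryEquiv.norm_map]
    exact hfb x
  have hgm : Measurable (gradient f) :=
    (InnerProductSpace.toDual ℝ Plane).symm.continuous.measurable.comp hfm
  have hlim1 : ∀ᵐ x : Plane, Filter.Tendsto (fun n => gradient (F n) x) Filter.atTop
      (nhds (gradient f x)) := by
    have hli : LocallyIntegrable (fderiv ℝ f) volume := by
      intro x
      refine ⟨Metric.ball x 1, Metric.ball_mem_nhds x one_pos, ?_⟩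
      exact Measure.integrableOn_of_bounded measure_ball_lt_top.ne hfm.aestronglyMeasurable
        (M := K) (Filter.Eventually.of_forall hfb)
    filter_upwards [ContDiffBump.ae_convolution_tendsto_right_of_locallyIntegrable hρ0 hρK hli]
      with x hx
    have := ((InnerProductSpace.toDual ℝ Plane).symm.continuous.tendsto _).comp hx
    refine this.congr fun n => ?_
    rw [gradient, (hFd n x).fderiv]
    rfl
  have m1 : ∀ n, MemLp (F n) 2 (volume.restrict Ω) := fun n =>
    memLp_of_continuous (hFs n).continuous (hFc n) Ω
  have m1' : MemLp f 2 (volume.restrict Ω) := memLp_of_continuous hf.continuous hc Ω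
  have m2 : ∀ n, MemLp (gradient (F n)) 2 (volume.restrict Ω) := fun n =>
    MemLp.of_bound ((InnerProductSpace.toDual ℝ Plane).symm.continuous.comp
      ((hFs n).continuous_fderiv (by simp))).aestronglyMeasurable K
      (Filter.Eventually.of_forall (hgb n))
  have m2' : MemLp (gradient f) 2 (volume.restrict Ω) :=
    MemLp.of_bound hgm.aestronglyMeasurable K (Filter.Eventually.of_forall hgb')
  have m3 : ∀ g : Plane → ℝ, Continuous g → (∀ x, ‖g x‖ ≤ M + K * δ) → ∀ i,
      MemLp (fun s => g (Γ.arc i s)) 2 (volume.restrict (Ioo 0 (Γ.len i))) := fun g hg hb i =>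
    MemLp.of_bound ((hg.comp_continuousOn ((Γ.contDiff i).continuousOn.mono
      Ioo_subset_Icc_self)).aestronglyMeasurable measurableSet_Ioo) _
      (Filter.Eventually.of_forall fun s => hb _)
  have m3F := fun n => m3 (F n) (hFs n).continuous (hFb n)
  have m3f := m3 f hf.continuous hfb'
  refine ⟨(m1'.toLp f, m2'.toLp _, fun i => (m3f i).toLp _), ?_, m1'.coeFn_toLp, m2'.coeFn_toLp,
    fun i => (m3f i).coeFn_toLp⟩
  refine mem_closure_of_tendsto (f := fun n => ((m1 n).toLp (F n), (m2 n).toLp (gradient (F n)),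
    fun i => (m3F n i).toLp _)) (b := Filter.atTop) ?_ (Filter.Eventually.of_forall fun n => ?_)
  · refine Filter.Tendsto.prodMk_nhds ?_ (Filter.Tendsto.prodMk_nhds ?_ ?_)
    · exact tendsto_toLp_of_bounded m1 m1' (fun n => Filter.Eventually.of_forall (hFb n))
        (Filter.Eventually.of_forall hfb') (Filter.Eventually.of_forall hlim0)
    · exact tendsto_toLp_of_bounded m2 m2' (fun n => Filter.Eventually.of_forall (hgb n))
        (Filter.Eventually.of_forall hgb') (ae_restrict_of_ae hlim1)
    · rw [tendsto_pi_nhds]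
      intro i
      exact tendsto_toLp_of_bounded (fun n => m3F n i) (m3f i)
        (fun n => Filter.Eventually.of_forall fun s => hFb n _)
        (Filter.Eventually.of_forall fun s => hfb' _)
        (Filter.Eventually.of_forall fun s => hlim0 _)
  · exact ⟨F n, hFs n, hFc n, hFt n, (m1 n).coeFn_toLp, (m2 n).coeFn_toLp,
      fun i => (m3F n i).coeFn_toLp⟩

end Mollification

/-! ### Multiplication by cutoff functions -/

section Multiplication

variable {Ω : Set Plane} {Γ : Interface Ω} {𝒯 : Triangulation Ω} {η : Plane → ℝ} {L : ℝ}

/-- A bounded measurable family of linear maps acts continuously on `L²`. -/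
theorem exists_pointwise_clm {X E F : Type*} [MeasurableSpace X] {μ : Measure X}
    [NormedAddCommGroup E] [NormedSpace ℝ E] [NormedAddCommGroup F] [NormedSpace ℝ F]
    {T : X → E →L[ℝ] F} (hT : AEStronglyMeasurable T μ) {C : ℝ} (hC : ∀ᵐ x ∂μ, ‖T x‖ ≤ C) :
    ∃ Φ : Lp E 2 μ →L[ℝ] Lp F 2 μ, ∀ f : Lp E 2 μ, Φ f =ᵐ[μ] fun x => T x (f x) := by
  have hb : ∀ f : Lp E 2 μ, ∀ᵐ x ∂μ, ‖T x (f x)‖ ≤ C * ‖f x‖ := fun f => by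
    filter_upwards [hC] with x hx
    exact ((T x).le_opNorm _).trans (mul_le_mul_of_nonneg_right hx (norm_nonneg _))
  have hm : ∀ f : Lp E 2 μ, MemLp (fun x => T x (f x)) 2 μ := fun f =>
    (Lp.memLp f).of_le_mul ((ContinuousLinearMap.id ℝ (E →L[ℝ] F)).aestronglyMeasurable_comp₂ hT
      (Lp.aestronglyMeasurable f)) (hb f)
  let Ψ : Lp E 2 μ →ₗ[ℝ] Lp F 2 μ :=
    { toFun := fun f => (hm f).toLp _
      map_add' := fun f g => by
        rw [← MemLp.toLp_add]
        refine MemLp.toLp_congr _ _ ?_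
        filter_upwards [Lp.coeFn_add f g] with x hx
        rw [hx, Pi.add_apply, map_add]; rfl
      map_smul' := fun c f => by
        rw [RingHom.id_apply, ← MemLp.toLp_const_smul]
        refine MemLp.toLp_congr _ _ ?_
        filter_upwards [Lp.coeFn_smul c f] with x hx
        rw [hx, Pi.smul_apply, map_smul]; rfl }
  refine ⟨Ψ.mkContinuous C fun f => ?_, fun f => (hm f).coeFn_toLp⟩
  refine Lp.norm_le_mul_norm_of_ae_le_mul ?_
  filter_upwards [hb f, (hm f).coeFn_toLp] with x h1 h2
  change ‖((hm f).toLp _ : X → F) x‖ ≤ _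
  rw [h2]
  exact h1

theorem IsCutoff.abs_le_one (hη : IsCutoff 𝒯 η L) (x : Plane) : |η x| ≤ 1 := by
  rw [abs_of_nonneg (hη.mem_Icc x).1]; exact (hη.mem_Icc x).2

/-- The product of a cutoff function and a test function is globally Lipschitz, although the cutoff
function is so only locally: near the support of `φ` there are balls in `Ω`, and points farther apart
than their radius `δ` are dealt with by boundedness. -/
theorem IsCutoff.exists_lipschitzWith_mul (hη : IsCutoff 𝒯 η L) (hL : 0 ≤ L) {φ : Plane → ℝ}
    (h1 : ContDiff ℝ ∞ φ) (h2 : HasCompactSupport φ) (h3 : tsupport φ ⊆ Ω) :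
    ∃ K, LipschitzWith K fun x => η x * φ x := by
  obtain ⟨Kφ, hKφ⟩ := h1.lipschitzWith_of_hasCompactSupport h2 (by simp)
  obtain ⟨M, hM⟩ := h1.continuous.bounded_above_of_compact_support h2
  obtain ⟨δ, hδ, hδΩ⟩ := h2.isCompact.exists_thickening_subset_open 𝒯.isOpen h3
  have hM0 : 0 ≤ M := (norm_nonneg _).trans (hM 0)
  have near : ∀ x y, x ∈ tsupport φ → dist x y < δ →
      |η x * φ x - η y * φ y| ≤ (Kφ + M * L) * dist x y := by
    intro x y hx hxy
    have hball : Metric.ball x δ ⊆ Ω := fun z hz =>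
      hδΩ (Metric.mem_thickening_iff.2 ⟨x, hx, Metric.mem_ball.1 hz⟩)
    have e1 := hη.abs_sub_le_of_segment hL (((convex_ball x δ).segment_subset
      (Metric.mem_ball.2 (by rwa [dist_comm])) (Metric.mem_ball_self hδ)).trans hball)
      (x := y) (y := x)
    have e2 := hKφ.dist_le_mul x y
    rw [← dist_eq_norm] at e1
    rw [Real.dist_eq] at e2
    have e3 : η x * φ x - η y * φ y = η x * (φ x - φ y) + φ y * (η x - η y) := by ring
    rw [e3]
    refine (abs_add_le _ _).trans ?_
    rw [abs_mul, abs_mul, add_mul, mul_assoc]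
    refine add_le_add ?_ ?_
    · calc |η x| * |φ x - φ y| ≤ 1 * |φ x - φ y| :=
            mul_le_mul_of_nonneg_right (hη.abs_le_one x) (abs_nonneg _)
        _ ≤ Kφ * dist x y := by rw [one_mul]; exact e2
    · exact mul_le_mul (hM y) e1 (abs_nonneg _) hM0
  have hK : 0 ≤ Kφ + M * L + 2 * M / δ := by positivity
  refine ⟨Real.toNNReal (Kφ + M * L + 2 * M / δ), LipschitzWith.of_dist_le_mul fun x y => ?_⟩
  rw [Real.dist_eq, Real.coe_toNNReal _ hK]
  have hle : (Kφ + M * L) * dist x y ≤ (Kφ + M * L + 2 * M / δ) * dist x y :=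
    mul_le_mul_of_nonneg_right (le_add_of_nonneg_right (by positivity)) dist_nonneg
  rcases lt_or_ge (dist x y) δ with hd | hd
  · by_cases hx : x ∈ tsupport φ
    · exact (near x y hx hd).trans hle
    · by_cases hy : y ∈ tsupport φ
      · have := near y x hy (by rwa [dist_comm])
        rw [abs_sub_comm, dist_comm] at this
        exact this.trans hle
      · rw [image_eq_zero_of_notMem_tsupport hx, image_eq_zero_of_notMem_tsupport hy]
        simp only [mul_zero, sub_self, abs_zero]
        positivity
  · have b : ∀ z, |η z * φ z| ≤ M := fun z => by
      rw [abs_mul]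
      calc |η z| * |φ z| ≤ 1 * M := mul_le_mul (hη.abs_le_one z) (hM z) (abs_nonneg _) zero_le_one
        _ = M := one_mul M
    have e1 : |η x * φ x - η y * φ y| ≤ 2 * M := by
      have := abs_sub (η x * φ x) (η y * φ y)
      linarith [b x, b y]
    have e2 : 2 * M ≤ 2 * M / δ * dist x y := by
      rw [div_mul_eq_mul_div, le_div_iff₀ hδ]
      exact mul_le_mul_of_nonneg_left hd (by positivity)
    have e3 : 0 ≤ (Kφ + M * L) * dist x y := by positivity
    linarith

/-- `H¹₀(Ω)` is stable under multiplication by a cutoff function. -/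
theorem IsCutoff.exists_mul_mem_H10WithTrace (hη : IsCutoff 𝒯 η L) (hL : 0 ≤ L)
    {x : BulkL2 Ω × BulkL2Vec Ω × InterfaceL2 Γ} (hx : x ∈ H10WithTrace Ω Γ) :
    ∃ y ∈ H10WithTrace Ω Γ, (∀ᵐ z ∂(volume.restrict Ω), y.1 z = η z * x.1 z) ∧
      (∀ᵐ z ∂(volume.restrict Ω), y.2.1 z = η z • x.2.1 z + x.1 z • gradient η z) ∧
      ∀ i, ∀ᵐ s ∂(volume.restrict (Ioo 0 (Γ.len i))),
        y.2.2 i s = η (Γ.arc i s) * x.2.2 i s := by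
  have hηc : ContinuousOn η Ω := hη.continuousOn.mono 𝒯.domain_subset
  have hηm : AEStronglyMeasurable η (volume.restrict Ω) :=
    hηc.aestronglyMeasurable 𝒯.measurableSet
  have hgm : Measurable (gradient η) :=
    (InnerProductSpace.toDual ℝ Plane).symm.continuous.measurable.comp (measurable_fderiv ℝ η)
  have hξm : ∀ i, AEStronglyMeasurable (fun s => η (Γ.arc i s))
      (volume.restrict (Ioo 0 (Γ.len i))) := fun i =>
    (((hη.lipschitzOnWith_arc hL i).continuousOn).mono
      Ioo_subset_Icc_self).aestronglyMeasurable measurableSet_Ioo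
  obtain ⟨Φ₁, hΦ₁⟩ := exists_pointwise_clm (μ := volume.restrict Ω) (C := 1)
    (T := fun z => η z • ContinuousLinearMap.id ℝ ℝ) (hηm.smul_const _)
    (Filter.Eventually.of_forall fun z => by
      rw [norm_smul, ContinuousLinearMap.norm_id, mul_one]; exact hη.abs_le_one z)
  obtain ⟨Φ₂, hΦ₂⟩ := exists_pointwise_clm (μ := volume.restrict Ω) (C := 1)
    (T := fun z => η z • ContinuousLinearMap.id ℝ Plane) (hηm.smul_const _)
    (Filter.Eventually.of_forall fun z => by
      rw [norm_smul, ContinuousLinearMap.norm_id, mul_one]; exact hη.abs_le_one z)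
  obtain ⟨Φ₃, hΦ₃⟩ := exists_pointwise_clm (μ := volume.restrict Ω) (C := L)
    (T := fun z => ContinuousLinearMap.toSpanSingleton ℝ (gradient η z))
    ((ContinuousLinearMap.toSpanSingletonCLE (𝕜 := ℝ) (E := Plane)).continuous.comp_aestronglyMeasurable
      hgm.aestronglyMeasurable)
    (by
      filter_upwards [ae_restrict_mem 𝒯.measurableSet] with z hz
      rw [ContinuousLinearMap.norm_toSpanSingleton]
      exact hη.norm_gradient_le hL hz)
  choose Φ₄ hΦ₄ using fun i => exists_pointwise_clm (μ := volume.restrict (Ioo 0 (Γ.len i))) (C := 1)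
    (T := fun s => η (Γ.arc i s) • ContinuousLinearMap.id ℝ ℝ) ((hξm i).smul_const _)
    (Filter.Eventually.of_forall fun z => by
      rw [norm_smul, ContinuousLinearMap.norm_id, mul_one]; exact hη.abs_le_one _)
  -- multiplication by `η` is continuous on the ambient space, so that it suffices to treat smooth
  -- functions
  let P : BulkL2 Ω × BulkL2Vec Ω × InterfaceL2 Γ → BulkL2 Ω × BulkL2Vec Ω × InterfaceL2 Γ :=
    fun x => (Φ₁ x.1, Φ₂ x.2.1 + Φ₃ x.1, fun i => Φ₄ i (x.2.2 i))
  have hP : Continuous P := by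
    refine (Φ₁.continuous.comp continuous_fst).prodMk (Continuous.prodMk ?_ ?_)
    · exact (Φ₂.continuous.comp (continuous_fst.comp continuous_snd)).add
        (Φ₃.continuous.comp continuous_fst)
    · exact continuous_pi fun i => (Φ₄ i).continuous.comp
        ((continuous_apply i).comp (continuous_snd.comp continuous_snd))
  have hPmem : P x ∈ H10WithTrace Ω Γ := by
    have hcl : IsClosed (P ⁻¹' (H10WithTrace Ω Γ : Set _)) :=
      (Submodule.isClosed_topologicalClosure _).preimage hP
    refine closure_minimal ?_ hcl (show x ∈ closure (smoothGraph Ω Γ : Set _) from hx)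
    rintro u ⟨φ, h1, h2, h3, h4, h5, h6⟩
    obtain ⟨K, hK⟩ := hη.exists_lipschitzWith_mul hL h1 h2 h3
    have hs : tsupport (fun x => η x * φ x) ⊆ tsupport φ := tsupport_mul_subset_right
    obtain ⟨y, hy, hy1, hy2, hy3⟩ := exists_mem_H10WithTrace_of_lipschitz (Γ := Γ) 𝒯.isOpen
      𝒯.isBounded hK h2.mul_left (hs.trans h3)
    have e : P u = y := by
      refine Prod.ext ?_ (Prod.ext ?_ (funext fun i => ?_))
      · refine Lp.ext ?_
        filter_upwards [hΦ₁ u.1, h4, hy1] with z a b c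
        rw [c, ← b]
        exact a
      · refine Lp.ext ?_
        filter_upwards [Lp.coeFn_add (Φ₂ u.2.1) (Φ₃ u.1), hΦ₂ u.2.1, hΦ₃ u.1, h4, h5, hy2,
          hη.ae_differentiableAt] with z a b c d e f g
        change (Φ₂ u.2.1 + Φ₃ u.1 : BulkL2Vec Ω) z = _
        rw [a, Pi.add_apply, b, c, d, e, f, gradient, gradient, gradient,
          fderiv_fun_mul g (h1.differentiable (by simp) z), map_add, map_smulₛₗ, map_smulₛₗ]
        simp
      · refine Lp.ext ?_
        filter_upwards [hΦ₄ i (u.2.2 i), h6 i, hy3 i] with s a b c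
        rw [c, ← b]
        exact a
    rw [mem_preimage, e]
    exact hy
  refine ⟨P x, hPmem, ?_, ?_, fun i => ?_⟩
  · filter_upwards [hΦ₁ x.1] with z a
    exact a
  · filter_upwards [Lp.coeFn_add (Φ₂ x.2.1) (Φ₃ x.1), hΦ₂ x.2.1, hΦ₃ x.1] with z a b c
    change (Φ₂ x.2.1 + Φ₃ x.1 : BulkL2Vec Ω) z = _
    rw [a, Pi.add_apply, b, c]
    simp
  · filter_upwards [hΦ₄ i (x.2.2 i)] with s a
    exact a

/-- The space `V` is stable under multiplication by a cutoff function, and the product rule holds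
for both gradients. -/
theorem IsCutoff.exists_mul (hη : IsCutoff 𝒯 η L) (hL : 0 ≤ L) (v : V Ω Γ) :
    ∃ w : V Ω Γ, (∀ᵐ z ∂(volume.restrict Ω), val w z = η z * val v z) ∧
      (∀ᵐ z ∂(volume.restrict Ω), grad w z = η z • grad v z + val v z • gradient η z) ∧
      (∀ i, ∀ᵐ s ∂(volume.restrict (Ioo 0 (Γ.len i))),
        trace w i s = η (Γ.arc i s) * trace v i s) ∧
      ∀ i, ∀ᵐ s ∂(volume.restrict (Ioo 0 (Γ.len i))), tgrad w i s =
        η (Γ.arc i s) * tgrad v i s + deriv (fun s => η (Γ.arc i s)) s * trace v i s := by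
  obtain ⟨y, hy, hy1, hy2, hy3⟩ := hη.exists_mul_mem_H10WithTrace hL v.2.1
  have hξm : ∀ i, AEStronglyMeasurable (fun s => η (Γ.arc i s))
      (volume.restrict (Ioo 0 (Γ.len i))) := fun i =>
    (((hη.lipschitzOnWith_arc hL i).continuousOn).mono
      Ioo_subset_Icc_self).aestronglyMeasurable measurableSet_Ioo
  have hm : ∀ i, MemLp (fun s => η (Γ.arc i s) * tgrad v i s +
      deriv (fun s => η (Γ.arc i s)) s * trace v i s) 2 (volume.restrict (Ioo 0 (Γ.len i))) := by
    intro i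
    refine MemLp.add ?_ ?_
    · refine (Lp.memLp (tgrad v i)).of_le_mul (c := 1)
        ((hξm i).mul (Lp.aestronglyMeasurable _)) (Filter.Eventually.of_forall fun s => ?_)
      rw [norm_mul]
      exact mul_le_mul_of_nonneg_right (hη.abs_le_one _) (norm_nonneg _)
    · refine (Lp.memLp (trace v i)).of_le_mul (c := L)
        ((measurable_deriv _).aestronglyMeasurable.mul (Lp.aestronglyMeasurable _)) ?_
      filter_upwards [ae_restrict_mem measurableSet_Ioo] with s hs
      rw [norm_mul]
      exact mul_le_mul_of_nonneg_right (hη.abs_deriv_arc_le hL i hs) (norm_nonneg _)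
  refine ⟨⟨(y, fun i => (hm i).toLp _), hy, fun i => ?_, ?_⟩, hy1, hy2, hy3,
    fun i => (hm i).coeFn_toLp⟩
  · have := (v.2.2.1 i).lipschitz_mul (Γ.len_pos i) (integrable_of_Lp_two (trace v i))
      (integrable_of_Lp_two (tgrad v i)) (hη.lipschitzOnWith_arc hL i)
    intro ψ p1 p2 p3
    have h := this ψ p1 p2 p3
    refine Eq.trans ?_ (h.trans ?_)
    · refine integral_congr_ae ?_
      filter_upwards [hy3 i] with s hs
      change (y.2.2 i) s * _ = _
      rw [hs]; rfl
    · congr 1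
      refine integral_congr_ae ?_
      filter_upwards [(hm i).coeFn_toLp] with s hs
      change _ = ((hm i).toLp _ : ℝ → ℝ) s * _
      rw [hs]
  · obtain ⟨w, hw, hw'⟩ := v.2.2.2
    have hcar : Γ.carrier ⊆ 𝒯.support := by
      intro p hp
      obtain ⟨i, s, hs, rfl⟩ := mem_iUnion.1 hp
      exact 𝒯.closure_subset (arc_mem_closure i hs)
    refine ⟨fun p => η p * w p, (hη.continuousOn.mono hcar).mul hw, fun i => ?_⟩
    filter_upwards [hy3 i, hw' i] with s a b
    change (y.2.2 i) s = _
    rw [a, b]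

end Multiplication

/-! ### Cutting off on element patches -/

section Cutoff

variable {Ω : Set Plane} {Γ : Interface Ω} {𝒯 : Triangulation Ω} {H γ : ℝ}

/-- Where the nodal cutoff is locally constant with value `c`, multiplication by it is
multiplication by `c`, for the function and for its derivatives. -/
theorem IsCutoff.energyOn_sub_smul_eq_zero {η : Plane → ℝ} {v w : V Ω Γ} {c : ℝ}
    (h2 : ∀ᵐ z ∂(volume.restrict Ω), grad w z = η z • grad v z + val v z • gradient η z)
    (h4 : ∀ i, ∀ᵐ s ∂(volume.restrict (Ioo 0 (Γ.len i))), tgrad w i s =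
        η (Γ.arc i s) * tgrad v i s + deriv (fun s => η (Γ.arc i s)) s * trace v i s)
    {S : Set Plane} (hS : MeasurableSet S)
    (h : ∀ p ∈ Ω, p ∈ S → ∀ t ∈ 𝒯.elems, p ∈ tri t → ∀ x ∈ tri t, η x = c) :
    energyOn S (w - c • v) = 0 := by
  have hc : ∀ p ∈ Ω, p ∈ S → η p = c := fun p hp hpS => by
    obtain ⟨t, ht, hpt⟩ := Triangulation.mem_support.1 (𝒯.domain_subset hp)
    exact h p hp hpS t ht hpt p hpt
  refine sqNormOn_eq_zero_of_ae hS ?_ fun i => ?_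
  · filter_upwards [h2, ae_restrict_mem 𝒯.measurableSet, Lp.coeFn_sub (grad w) (grad (c • v)),
      grad_smul_ae c v] with p h2 hp h5 h6 hpS
    refine h5.trans ?_
    rw [Pi.sub_apply, h6, h2, hc p hp hpS, IsCutoff.gradient_eq_zero hp (h p hp hpS)]
    simp
  · filter_upwards [h4 i, ae_restrict_mem measurableSet_Ioo,
      Lp.coeFn_sub (tgrad w i) (tgrad (c • v) i), tgrad_smul_ae c v i] with s h4 hs h5 h6 hsS
    refine h5.trans ?_
    have hp := Γ.mapsTo i hs
    rw [Pi.sub_apply, h6, h4, hc _ hp hsS, IsCutoff.deriv_arc_eq_zero i hs (h _ hp hsS)]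
    simp

theorem IsCutoff.massOn_sub_smul_eq_zero {η : Plane → ℝ} {v w : V Ω Γ} {c : ℝ}
    (h1 : ∀ᵐ z ∂(volume.restrict Ω), val w z = η z * val v z)
    (h3 : ∀ i, ∀ᵐ s ∂(volume.restrict (Ioo 0 (Γ.len i))),
        trace w i s = η (Γ.arc i s) * trace v i s)
    {S : Set Plane} (hS : MeasurableSet S) (hΩ : MeasurableSet Ω)
    (h : ∀ p ∈ Ω, p ∈ S → η p = c) :
    massOn S (w - c • v) = 0 := by
  refine sqNormOn_eq_zero_of_ae hS ?_ fun i => ?_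
  · filter_upwards [h1, ae_restrict_mem hΩ, Lp.coeFn_sub (val w) (val (c • v)),
      Lp.coeFn_smul c (val v)] with p h2 hp h5 h6 hpS
    refine h5.trans ?_
    have h6' : val (c • v) p = c * val v p := h6
    rw [Pi.sub_apply, h6', h2, h p hp hpS, sub_self]
  · filter_upwards [h3 i, ae_restrict_mem measurableSet_Ioo,
      Lp.coeFn_sub (trace w i) (trace (c • v) i), Lp.coeFn_smul c (trace v i)]
      with s h4 hs h5 h6 hsS
    refine h5.trans ?_
    have h6' : trace (c • v) i s = c * trace v i s := h6
    rw [Pi.sub_apply, h6', h4, h _ (Γ.mapsTo i hs) hsS, sub_self]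

/-- The energy of the product of `v` with a cutoff function of slope `L`, by the product rule. -/
theorem IsCutoff.energyOn_mul_le {η : Plane → ℝ} {L : ℝ} (hη : IsCutoff 𝒯 η L) (hL : 0 ≤ L)
    {v w : V Ω Γ}
    (h2 : ∀ᵐ z ∂(volume.restrict Ω), grad w z = η z • grad v z + val v z • gradient η z)
    (h4 : ∀ i, ∀ᵐ s ∂(volume.restrict (Ioo 0 (Γ.len i))), tgrad w i s =
        η (Γ.arc i s) * tgrad v i s + deriv (fun s => η (Γ.arc i s)) s * trace v i s)
    {S : Set Plane} (hS : MeasurableSet S) :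
    energyOn S w ≤ 2 * energyOn S v + 2 * L ^ 2 * massOn S v := by
  have key : ∀ a b c d n : ℝ, 0 ≤ n → n ≤ a * b + d * c → 0 ≤ a → a ≤ 1 → 0 ≤ d → d ≤ L →
      0 ≤ b → 0 ≤ c → n ^ 2 ≤ 2 * b ^ 2 + 2 * L ^ 2 * c ^ 2 := by
    intro a b c d n hn h ha ha' hd hd' hb hc
    have h1 : n ≤ b + L * c :=
      h.trans (add_le_add (mul_le_of_le_one_left hb ha') (mul_le_mul_of_nonneg_right hd' hc))
    calc n ^ 2 ≤ (b + L * c) ^ 2 := pow_le_pow_left₀ hn h1 2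
      _ ≤ 2 * b ^ 2 + 2 * L ^ 2 * c ^ 2 := by nlinarith [sq_nonneg (b - L * c)]
  refine sqNormOn_le_of_ae hS _ _ _ _ _ _ _ _ ?_ fun i => ?_
  · filter_upwards [h2, ae_restrict_mem 𝒯.measurableSet] with p h2 hp _
    refine key |η p| _ _ ‖gradient η p‖ _ (norm_nonneg _) ?_ (abs_nonneg _) (hη.abs_le_one p)
      (norm_nonneg _) (hη.norm_gradient_le hL hp) (norm_nonneg _) (norm_nonneg _)
    rw [h2]
    refine (norm_add_le _ _).trans (le_of_eq ?_)
    rw [norm_smul, norm_smul, Real.norm_eq_abs (η p), mul_comm ‖gradient η p‖]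
  · filter_upwards [h4 i, ae_restrict_mem measurableSet_Ioo] with s h4 hs _
    have := key |η (Γ.arc i s)| |tgrad v i s| |trace v i s|
      |deriv (fun s => η (Γ.arc i s)) s| |tgrad w i s| (abs_nonneg _) ?_ (abs_nonneg _)
      (hη.abs_le_one _) (abs_nonneg _) (hη.abs_deriv_arc_le hL i hs) (abs_nonneg _) (abs_nonneg _)
    · simpa only [sq_abs] using this
    · rw [h4, ← abs_mul, ← abs_mul]
      exact abs_add_le _ _

/-- Where the cutoff function is locally constant, multiplication by it does not increase the energy. -/
theorem IsCutoff.energyOn_mul_le_self {η : Plane → ℝ} {L : ℝ} (hη : IsCutoff 𝒯 η L)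
    {v w : V Ω Γ}
    (h2 : ∀ᵐ z ∂(volume.restrict Ω), grad w z = η z • grad v z + val v z • gradient η z)
    (h4 : ∀ i, ∀ᵐ s ∂(volume.restrict (Ioo 0 (Γ.len i))), tgrad w i s =
        η (Γ.arc i s) * tgrad v i s + deriv (fun s => η (Γ.arc i s)) s * trace v i s)
    {S : Set Plane} (hS : MeasurableSet S)
    (h : ∀ p ∈ Ω, p ∈ S → ∃ c, ∀ t ∈ 𝒯.elems, p ∈ tri t → ∀ x ∈ tri t, η x = c) :
    energyOn S w ≤ energyOn S v := by
  suffices this : sqNormOn Γ S (grad w) (tgrad w) ≤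
      1 * sqNormOn Γ S (grad v) (tgrad v) + 0 * sqNormOn Γ S (grad v) (tgrad v) by
    rw [one_mul, zero_mul, add_zero] at this
    exact this
  refine sqNormOn_le_of_ae hS 1 0 _ _ _ _ _ _ ?_ fun i => ?_
  · filter_upwards [h2, ae_restrict_mem 𝒯.measurableSet] with p h2 hp hpS
    obtain ⟨c, hc⟩ := h p hp hpS
    rw [h2, IsCutoff.gradient_eq_zero hp hc, smul_zero, add_zero, norm_smul, zero_mul, add_zero,
      one_mul, Real.norm_eq_abs]
    exact pow_le_pow_left₀ (by positivity)
      (mul_le_of_le_one_left (norm_nonneg _) (hη.abs_le_one p)) 2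
  · filter_upwards [h4 i, ae_restrict_mem measurableSet_Ioo] with s h4 hs hsS
    obtain ⟨c, hc⟩ := h _ (Γ.mapsTo i hs) hsS
    rw [h4, IsCutoff.deriv_arc_eq_zero i hs hc, zero_mul, add_zero, zero_mul, add_zero, one_mul,
      mul_pow]
    refine mul_le_of_le_one_left (sq_nonneg _) ?_
    rw [← sq_abs]
    exact pow_le_one₀ (abs_nonneg _) (hη.abs_le_one _)

/-- The nodal cutoff which vanishes on all elements touching the `j`-th patch and is one on all
elements not contained in the `(j + 2)`-nd one. It takes the value `0` at the vertices in the
`(j + 1)`-st patch and the value `1` at the other ones. -/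
theorem QuasiUniform.exists_isCutoff_patch (hq : QuasiUniform 𝒯 H γ) (t : Finset Plane) (j : ℕ) :
    ∃ η : Plane → ℝ, IsCutoff 𝒯 η (4 * γ / H) ∧
      (∀ p ∈ Ω, p ∈ patch 𝒯 j t → ∀ s ∈ 𝒯.elems, p ∈ tri s → ∀ x ∈ tri s, η x = 0) ∧
      ∀ p ∈ Ω, p ∈ (patch 𝒯 (j + 2) t)ᶜ → ∀ s ∈ 𝒯.elems, p ∈ tri s → ∀ x ∈ tri s, η x = 1 := by
  classical
  obtain ⟨η, hη, hηc⟩ := hq.exists_isCutoff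
    (fun z => if z ∈ patch 𝒯 (j + 1) t then 0 else 1) (fun z => by
      split_ifs <;> norm_num)
  have hvert : ∀ {s : Finset Plane} {z : Plane}, z ∈ s → z ∈ tri s :=
    fun hz => subset_convexHull ℝ _ hz
  refine ⟨η, hη, fun p _ hp s hs hps => ?_, fun p _ hp s hs hps => ?_⟩
  · refine hηc s hs 0 fun z hz => if_pos ?_
    exact tri_subset_patch_succ hs ⟨p, hps, hp⟩ (hvert hz)
  · refine hηc s hs 1 fun z hz => if_neg fun hz' => ?_
    exact hp (tri_subset_patch_succ hs ⟨z, hvert hz, hz'⟩ hps)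

set_option maxHeartbeats 1000000 in
/-- The product of `v` with a nodal cutoff which vanishes on the `j`-th patch and is one outside of
the `(j + 2)`-nd one. -/
theorem QuasiUniform.exists_cutoff (hq : QuasiUniform 𝒯 H γ) {t : Finset Plane}
    (ht : t ∈ 𝒯.elems) (j : ℕ) (v : V Ω Γ) : ∃ w : V Ω Γ,
      (∀ S, MeasurableSet S → energyOn S w ≤ 2 * energyOn S v +
        2 * (4 * γ / H) ^ 2 * massOn (S ∩ (patch 𝒯 (j + 2) t \ patch 𝒯 j t)) v) ∧
      energyOn (patch 𝒯 j t) w = 0 ∧ massOn (patch 𝒯 j t) w = 0 ∧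
      energyOn (patch 𝒯 (j + 2) t)ᶜ (w - v) = 0 ∧ massOn (patch 𝒯 (j + 2) t)ᶜ (w - v) = 0 := by
  have hγ := hq.pos_gamma ⟨t, ht⟩
  have hH := hq.pos
  have hL : 0 ≤ 4 * γ / H := by positivity
  obtain ⟨η, hη, c0, c1⟩ := hq.exists_isCutoff_patch t j
  refine (hη.exists_mul hL v).imp fun w hw => ?_
  have h1 := hw.1
  have h2 := hw.2.1
  have h3 := hw.2.2.1
  have h4 := hw.2.2.2
  have hv : ∀ (S : Set Plane) (c : ℝ),
      (∀ p ∈ Ω, p ∈ S → ∀ s ∈ 𝒯.elems, p ∈ tri s → ∀ x ∈ tri s, η x = c) →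
      ∀ p ∈ Ω, p ∈ S → η p = c := fun S c h p hp hpS => by
    obtain ⟨s, hs, hps⟩ := Triangulation.mem_support.1 (𝒯.domain_subset hp)
    exact h p hp hpS s hs hps p hps
  have mj := measurableSet_patch (𝒯 := 𝒯) j t
  have mj2 := measurableSet_patch (𝒯 := 𝒯) (j + 2) t
  have e0 : energyOn (patch 𝒯 j t) (w - (0 : ℝ) • v) = 0 :=
    IsCutoff.energyOn_sub_smul_eq_zero h2 h4 mj c0
  have m0 : massOn (patch 𝒯 j t) (w - (0 : ℝ) • v) = 0 :=
    IsCutoff.massOn_sub_smul_eq_zero h1 h3 mj 𝒯.measurableSet (hv _ _ c0)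
  have e1 : energyOn (patch 𝒯 (j + 2) t)ᶜ (w - (1 : ℝ) • v) = 0 :=
    IsCutoff.energyOn_sub_smul_eq_zero h2 h4 mj2.compl c1
  have m1 : massOn (patch 𝒯 (j + 2) t)ᶜ (w - (1 : ℝ) • v) = 0 :=
    IsCutoff.massOn_sub_smul_eq_zero h1 h3 mj2.compl 𝒯.measurableSet (hv _ _ c1)
  rw [zero_smul, sub_zero] at e0 m0
  rw [one_smul] at e1 m1
  refine ⟨fun S hS => ?_, e0, m0, e1, m1⟩
  have mR := mj2.diff mj
  have hsplit : ∀ u : V Ω Γ, energyOn (S ∩ (patch 𝒯 (j + 2) t \ patch 𝒯 j t)) u +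
      energyOn (S \ (S ∩ (patch 𝒯 (j + 2) t \ patch 𝒯 j t))) u = energyOn S u := fun u =>
    sqNormOn_add_diff (hS.inter mR) hS inter_subset_left
  have b1 := hη.energyOn_mul_le hL h2 h4 (hS.inter mR)
  have b2 : energyOn (S \ (S ∩ (patch 𝒯 (j + 2) t \ patch 𝒯 j t))) w ≤
      energyOn (S \ (S ∩ (patch 𝒯 (j + 2) t \ patch 𝒯 j t))) v := by
    have mD := hS.diff (hS.inter mR)
    have hcase : ∀ p ∈ Ω, p ∈ S \ (S ∩ (patch 𝒯 (j + 2) t \ patch 𝒯 j t)) →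
        ∃ c, ∀ s ∈ 𝒯.elems, p ∈ tri s → ∀ x ∈ tri s, η x = c := by
      intro p hp hpS
      by_cases hpj : p ∈ patch 𝒯 j t
      · exact ⟨0, c0 p hp hpj⟩
      · exact ⟨1, c1 p hp fun h => hpS.2 ⟨hpS.1, h, hpj⟩⟩
    exact hη.energyOn_mul_le_self h2 h4 mD hcase
  have := hsplit w
  have := hsplit v
  have := energyOn_nonneg (S \ (S ∩ (patch 𝒯 (j + 2) t \ patch 𝒯 j t))) v
  linarith

end Cutoff

/-! ### Cutting off within the fine space -/

theorem measurableSet_nbhd {Ω : Set Plane} {𝒯 : Triangulation Ω} (S : Set Plane) :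
    MeasurableSet (nbhd 𝒯 S) :=
  (isClosed_nbhd S).measurableSet

theorem measurableSet_tri (t : Finset Plane) : MeasurableSet (tri t) :=
  (isClosed_tri t).measurableSet

/-- A family of squared local seminorms on `E` which behaves, as a function of the region, like a
measure on the domain `Ω`. Both `energyOn` and `massOn` are of this kind. -/
structure IsLocalEnergy (Ω : Set Plane) {E : Type*} [AddCommGroup E] [Module ℝ E]
    (e : Set Plane → E → ℝ) : Prop where
  nonneg : ∀ S v, 0 ≤ e S v
  mono : ∀ {S S' : Set Plane}, MeasurableSet S → MeasurableSet S' → S ∩ Ω ⊆ S' →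
    ∀ v, e S v ≤ e S' v
  add_diff : ∀ {S S' : Set Plane}, MeasurableSet S → MeasurableSet S' → S ⊆ S' →
    ∀ v, e S v + e (S' \ S) v = e S' v
  le_sum : ∀ (F : Finset (Finset Plane)) (T : Finset Plane → Set Plane),
    (∀ i ∈ F, MeasurableSet (T i)) → ∀ {S : Set Plane}, MeasurableSet S →
      S ∩ Ω ⊆ ⋃ i ∈ F, T i → ∀ v, e S v ≤ ∑ i ∈ F, e (T i) v
  sum_le : ∀ (F : Finset (Finset Plane)) (T : Finset Plane → Set Plane),
    (∀ i ∈ F, MeasurableSet (T i)) → ∀ {S : Set Plane}, MeasurableSet S →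
      (∀ i ∈ F, T i ⊆ S) → ∀ {N : ℝ},
      (∀ x, ∀ G ⊆ F, (∀ i ∈ G, x ∈ T i) → (G.card : ℝ) ≤ N) →
      ∀ v, ∑ i ∈ F, e (T i) v ≤ N * e S v
  add_le : ∀ {S : Set Plane}, MeasurableSet S → ∀ v w, e S (v + w) ≤ 2 * e S v + 2 * e S w
  smul_le : ∀ {S : Set Plane}, MeasurableSet S → ∀ (c : ℝ) v, e S (c • v) ≤ c ^ 2 * e S v

/-- The properties of the space `V`, with its energy `e`, mass `m`, interpolation `I` and bilinear
forms `a`, on which the analysis of the correctors rests. The space is an abstract one, which keeps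
the `L²` realization of `V` out of that analysis. The constants are those of the mesh (`H`, `γ`), of
the interpolation (`C`) and of the coefficients (`α`, `β`); completeness is with respect to the sum of
energy and mass. -/
structure IsLocalized {Ω : Set Plane} (𝒯 : Triangulation Ω) (H γ C α β : ℝ) {E : Type*}
    [AddCommGroup E] [Module ℝ E] (e m : Set Plane → E → ℝ) (I : E →ₗ[ℝ] E)
    (a : Set Plane → E → E → ℝ) : Prop where
  quasiUniform : QuasiUniform 𝒯 H γ
  energy : IsLocalEnergy Ω e
  mass : IsLocalEnergy Ω m
  definite : ∀ v, e univ v = 0 → m univ v = 0 → v = 0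
  complete : ∀ u : ℕ → E, (∀ ε > 0, ∃ N, ∀ i ≥ N, ∀ j ≥ N,
      e univ (u i - u j) + m univ (u i - u j) < ε) →
    ∃ x, ∀ ε > 0, ∃ N, ∀ i ≥ N, e univ (u i - x) + m univ (u i - x) < ε
  energy_eq_zero : ∀ {G : Set Plane}, IsOpen G → ∀ {v}, m G v = 0 → e G v = 0
  map_map : ∀ v, I (I v) = I v
  mass_sub_le : ∀ v, ∀ t ∈ 𝒯.elems,
    m (tri t) (v - I v) ≤ 2 * (C * H) ^ 2 * e (nbhd 𝒯 (tri t)) v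
  energy_map_le : ∀ v, ∀ t ∈ 𝒯.elems, e (tri t) (I v) ≤ 2 * C ^ 2 * e (nbhd 𝒯 (tri t)) v
  exists_cutoff : ∀ t ∈ 𝒯.elems, ∀ j v, ∃ w,
    (∀ S, MeasurableSet S → e S w ≤ 2 * e S v +
      2 * (4 * γ / H) ^ 2 * m (S ∩ (patch 𝒯 (j + 2) t \ patch 𝒯 j t)) v) ∧
    e (patch 𝒯 j t) w = 0 ∧ m (patch 𝒯 j t) w = 0 ∧
    e (patch 𝒯 (j + 2) t)ᶜ (w - v) = 0 ∧ m (patch 𝒯 (j + 2) t)ᶜ (w - v) = 0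
  form_comm : ∀ S v w, a S v w = a S w v
  form_add_left : ∀ {S : Set Plane}, MeasurableSet S → ∀ u v w,
    a S (u + v) w = a S u w + a S v w
  form_smul_left : ∀ {S : Set Plane}, MeasurableSet S → ∀ (c : ℝ) v w,
    a S (c • v) w = c * a S v w
  form_add_diff : ∀ {S S' : Set Plane}, MeasurableSet S → MeasurableSet S' → S ⊆ S' → ∀ v w,
    a S v w + a (S' \ S) v w = a S' v w
  le_form : ∀ {S : Set Plane}, MeasurableSet S → ∀ v, α * e S v ≤ a S v v
  sq_form_le : ∀ {S : Set Plane}, MeasurableSet S → ∀ v w,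
    (a S v w) ^ 2 ≤ β ^ 2 * (e S v * e S w)

/-- The bound `(8γ)²` for the number of element neighbourhoods to which a point can belong. -/
def overlap (γ : ℝ) : ℝ := (8 * γ) ^ 2

theorem overlap_nonneg (γ : ℝ) : 0 ≤ overlap γ := sq_nonneg _

/-- The constant in the energy bound for the cutoff within the fine space. -/
def cutConst (γ C : ℝ) : ℝ :=
  4 * (1 + 32 * γ ^ 2 * C ^ 2 * overlap γ) * (1 + 2 * C ^ 2 * overlap γ)

theorem one_le_cutConst (γ C : ℝ) : 1 ≤ cutConst γ C := by
  have h1 : 0 ≤ 32 * γ ^ 2 * C ^ 2 * overlap γ :=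
    mul_nonneg (by positivity) (overlap_nonneg γ)
  have h2 : 0 ≤ 2 * C ^ 2 * overlap γ := mul_nonneg (by positivity) (overlap_nonneg γ)
  rw [cutConst]
  nlinarith [mul_nonneg h1 h2]

section FineCutoff

variable {Ω : Set Plane} {𝒯 : Triangulation Ω} {H γ C α β : ℝ} {E : Type*} [AddCommGroup E]
  [Module ℝ E] {e m : Set Plane → E → ℝ} {I : E →ₗ[ℝ] E} {a : Set Plane → E → E → ℝ}

theorem IsLocalEnergy.mono_set (he : IsLocalEnergy Ω e) {S S' : Set Plane} (hS : MeasurableSet S)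
    (hS' : MeasurableSet S') (h : S ⊆ S') (v : E) : e S v ≤ e S' v :=
  he.mono hS hS' (inter_subset_left.trans h) v

theorem IsLocalEnergy.neg (he : IsLocalEnergy Ω e) {S : Set Plane} (hS : MeasurableSet S)
    (v : E) : e S (-v) = e S v := by
  have h : ∀ u : E, e S (-u) ≤ e S u := fun u => by
    have := he.smul_le hS (-1) u
    rwa [neg_one_smul, neg_one_sq, one_mul] at this
  refine le_antisymm (h v) ?_
  have := h (-v)
  rwa [neg_neg] at this

theorem IsLocalEnergy.empty (he : IsLocalEnergy Ω e) (v : E) : e ∅ v = 0 := by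
  have := he.add_diff MeasurableSet.empty MeasurableSet.empty subset_rfl v
  rwa [sdiff_self, add_eq_left] at this

theorem IsLocalEnergy.sub_le (he : IsLocalEnergy Ω e) {S : Set Plane} (hS : MeasurableSet S)
    (v w : E) : e S (v - w) ≤ 2 * e S v + 2 * e S w := by
  rw [sub_eq_add_neg, ← he.neg hS w]
  exact he.add_le hS v (-w)

theorem IsLocalEnergy.eq_zero_of_le (he : IsLocalEnergy Ω e) {S : Set Plane} {v : E}
    (h : e S v ≤ 0) : e S v = 0 := le_antisymm h (he.nonneg S v)

theorem IsLocalEnergy.eq_zero_of_subset (he : IsLocalEnergy Ω e) {S S' : Set Plane}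
    (hS : MeasurableSet S) (hS' : MeasurableSet S') (h : S ⊆ S') {v : E}
    (h0 : e S' v = 0) : e S v = 0 :=
  he.eq_zero_of_le ((he.mono_set hS hS' h v).trans h0.le)

theorem IsLocalEnergy.add_compl (he : IsLocalEnergy Ω e) {S : Set Plane} (hS : MeasurableSet S)
    (v : E) : e S v + e Sᶜ v = e univ v := by
  rw [compl_eq_univ_sdiff]
  exact he.add_diff hS MeasurableSet.univ (subset_univ S) v

/-- If every point of `Ω ∩ S` lies in an element on which the energy vanishes, then it vanishes
on `S`. -/
theorem IsLocalEnergy.eq_zero_of_tri (he : IsLocalEnergy Ω e) (𝒯 : Triangulation Ω)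
    {S : Set Plane} (hS : MeasurableSet S) {v : E}
    (h : ∀ x ∈ Ω, x ∈ S → ∃ t ∈ 𝒯.elems, x ∈ tri t ∧ e (tri t) v = 0) : e S v = 0 := by
  classical
  refine he.eq_zero_of_le ((he.le_sum (𝒯.elems.filter fun t => e (tri t) v = 0) tri
    (fun t _ => measurableSet_tri t) hS (fun x hx => ?_) v).trans (le_of_eq ?_))
  · obtain ⟨t, ht, hxt, h0⟩ := h x hx.2 hx.1
    exact mem_iUnion₂.2 ⟨t, Finset.mem_filter.2 ⟨ht, h0⟩, hxt⟩
  · exact Finset.sum_eq_zero fun t ht => (Finset.mem_filter.1 ht).2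

/-- Summing the energy over element neighbourhoods costs a factor `overlap γ`. -/
theorem IsLocalEnergy.sum_nbhd_inter_le (he : IsLocalEnergy Ω e) (hq : QuasiUniform 𝒯 H γ)
    (v : E) {F : Finset (Finset Plane)} (hF : F ⊆ 𝒯.elems) {B S : Set Plane}
    (hB : MeasurableSet B) (hS : MeasurableSet S) (h : ∀ s ∈ F, nbhd 𝒯 (tri s) ∩ B ⊆ S) :
    ∑ s ∈ F, e (nbhd 𝒯 (tri s) ∩ B) v ≤ overlap γ * e S v := by
  refine he.sum_le F _ (fun s _ => (measurableSet_nbhd _).inter hB) hS h (fun x G hG hx => ?_) v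
  refine (hq.card_le 1 x G (hG.trans hF) fun t ht => (hx t ht).1).trans (le_of_eq ?_)
  rw [overlap]; push_cast; ring

theorem IsLocalEnergy.sum_nbhd_le (he : IsLocalEnergy Ω e) (hq : QuasiUniform 𝒯 H γ)
    (v : E) {F : Finset (Finset Plane)} (hF : F ⊆ 𝒯.elems) {S : Set Plane}
    (hS : MeasurableSet S) (h : ∀ s ∈ F, nbhd 𝒯 (tri s) ⊆ S) :
    ∑ s ∈ F, e (nbhd 𝒯 (tri s)) v ≤ overlap γ * e S v := by
  have := he.sum_nbhd_inter_le hq v hF MeasurableSet.univ hS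
    (fun s hs => inter_subset_left.trans (h s hs))
  simpa only [inter_univ] using this

theorem IsLocalized.mass_le (hV : IsLocalized 𝒯 H γ C α β e m I a) {v : E} (hv : I v = 0)
    {t : Finset Plane} (ht : t ∈ 𝒯.elems) :
    m (tri t) v ≤ 2 * (C * H) ^ 2 * e (nbhd 𝒯 (tri t)) v := by
  simpa only [hv, sub_zero] using hV.mass_sub_le v t ht

theorem IsLocalized.energy_map_eq_zero (hV : IsLocalized 𝒯 H γ C α β e m I a) {v : E}
    {t : Finset Plane} (ht : t ∈ 𝒯.elems) (h : e (nbhd 𝒯 (tri t)) v = 0) :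
    e (tri t) (I v) = 0 :=
  hV.energy.eq_zero_of_le ((hV.energy_map_le v t ht).trans (by rw [h, mul_zero]))

theorem IsLocalized.mass_sub_eq_zero (hV : IsLocalized 𝒯 H γ C α β e m I a) {v : E}
    {t : Finset Plane} (ht : t ∈ 𝒯.elems) (h : e (nbhd 𝒯 (tri t)) v = 0) :
    m (tri t) (v - I v) = 0 :=
  hV.mass.eq_zero_of_le ((hV.mass_sub_le v t ht).trans (by rw [h, mul_zero]))

/-- A fine function `v` can be cut off near an element within the fine space: there is a fine `w`
which vanishes (up to constants) on the `(l + 2)`-nd patch, agrees with `v` outside of the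
`(l + 7)`-th one, and in between is bounded by the energy of `v` in a ring. Multiplication by a
nodal cutoff leads out of the fine space, and subtracting the interpolant leads back; the latter is
local up to one layer of elements. The gradient of the cutoff, of size `1 / H`, is compensated by
the bound `‖v‖ ≲ H ‖∇v‖` for fine functions. -/
theorem IsLocalized.exists_fine_cutoff (hV : IsLocalized 𝒯 H γ C α β e m I a)
    {t : Finset Plane} (ht : t ∈ 𝒯.elems) (l : ℕ) {v : E}
    (hv : I v = 0) : ∃ w : E, I w = 0 ∧ e (patch 𝒯 (l + 2) t) w = 0 ∧
      m (patch 𝒯 (l + 7) t)ᶜ (v - w) = 0 ∧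
      e (patch 𝒯 (l + 8) t) w ≤
        cutConst γ C * e (patch 𝒯 (l + 8) t \ patch 𝒯 l t) v := by
  classical
  have he := hV.energy
  have hm := hV.mass
  have hq := hV.quasiUniform
  have hH := hq.pos
  have mP := fun j => measurableSet_patch (𝒯 := 𝒯) j t
  obtain ⟨u, hu, hu0, -, hu1, -⟩ := hV.exists_cutoff t ht (l + 3) v
  have hIu : I u = I (u - v) := by rw [map_sub, hv, sub_zero]
  -- near the element, `u` and thus its interpolant have no energy
  have n1 : ∀ s ∈ 𝒯.elems, tri s ⊆ patch 𝒯 (l + 2) t → e (tri s) (I u) = 0 :=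
    fun s hs hsub => hV.energy_map_eq_zero hs <|
      he.eq_zero_of_subset (measurableSet_nbhd _) (mP _) (nbhd_subset_patch_succ hsub) hu0
  -- far from the element, `u = v` up to constants, and the interpolant of `u - v` has no energy
  have n2' : ∀ s ∈ 𝒯.elems, Disjoint (tri s) (patch 𝒯 (l + 6) t) →
      e (nbhd 𝒯 (tri s)) (u - v) = 0 := fun s hs hd =>
    he.eq_zero_of_subset (measurableSet_nbhd _) (mP (l + 5)).compl
      (subset_compl_iff_disjoint_right.2 (disjoint_nbhd_patch hd)) hu1
  have n2 : ∀ s ∈ 𝒯.elems, Disjoint (tri s) (patch 𝒯 (l + 6) t) → e (tri s) (I u) = 0 :=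
    fun s hs hd => by rw [hIu]; exact hV.energy_map_eq_zero hs (n2' s hs hd)
  have z1 : e (patch 𝒯 (l + 2) t) (I u) = 0 :=
    he.eq_zero_of_tri 𝒯 (mP _) fun x _ hx => by
      obtain ⟨s, hs, hxs, hsub⟩ := exists_tri_subset_patch ht hx
      exact ⟨s, hs, hxs, n1 s hs hsub⟩
  have z2 : e (patch 𝒯 (l + 2) t) u = 0 :=
    he.eq_zero_of_subset (mP _) (mP _) (patch_subset_succ ht _) hu0
  have z : e (patch 𝒯 (l + 2) t) (u - I u) = 0 :=
    he.eq_zero_of_le ((he.sub_le (mP _) u (I u)).trans (by rw [z1, z2]; norm_num))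
  refine ⟨u - I u, by rw [map_sub, hV.map_map, sub_self], z, ?_, ?_⟩
  · have heq : v - (u - I u) = -((u - v) - I (u - v)) := by rw [hIu]; abel
    rw [heq, hm.neg (mP _).compl]
    refine hm.eq_zero_of_tri 𝒯 (mP _).compl fun x hxΩ hx => ?_
    obtain ⟨s, hs, hxs⟩ := Triangulation.mem_support.1 (𝒯.domain_subset hxΩ)
    exact ⟨s, hs, hxs, hV.mass_sub_eq_zero hs <| n2' s hs <|
      disjoint_patch_of_not_subset hs fun hsub => hx (hsub hxs)⟩
  · set N := overlap γ with hN
    have hN0 : 0 ≤ N := overlap_nonneg γ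
    set W := e (patch 𝒯 (l + 8) t \ patch 𝒯 l t) v with hW
    have mE := (mP (l + 8)).diff (mP l)
    set D := patch 𝒯 (l + 8) t \ patch 𝒯 (l + 2) t with hD
    have mD : MeasurableSet D := (mP (l + 8)).diff (mP (l + 2))
    set R := patch 𝒯 (l + 5) t \ patch 𝒯 (l + 3) t with hR
    have mR : MeasurableSet R := (mP (l + 5)).diff (mP (l + 3))
    let G := 𝒯.elems.filter fun s => ¬ tri s ⊆ patch 𝒯 (l + 2) t
    let F := G.filter fun s => ¬ Disjoint (tri s) (patch 𝒯 (l + 6) t)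
    have hGe : ∀ s ∈ G, s ∈ 𝒯.elems := fun s hs => (Finset.mem_filter.1 hs).1
    have hFG : F ⊆ G := Finset.filter_subset _ _
    have hFe : F ⊆ 𝒯.elems := fun s hs => hGe s (hFG hs)
    have hFsub : ∀ s ∈ F, nbhd 𝒯 (tri s) ⊆ patch 𝒯 (l + 8) t \ patch 𝒯 l t := by
      intro s hs
      have h1 : ¬ tri s ⊆ patch 𝒯 (l + 2) t := (Finset.mem_filter.1 (hFG hs)).2
      have h2 := not_disjoint_iff_nonempty_inter.1 (Finset.mem_filter.1 hs).2
      have h3 : Disjoint (nbhd 𝒯 (tri s)) (patch 𝒯 l t) :=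
        disjoint_nbhd_patch (disjoint_patch_of_not_subset (hFe hs) h1)
      exact subset_sdiff.2 ⟨nbhd_subset_patch_succ (tri_subset_patch_succ (hFe hs) h2), h3⟩
    have hsum : ∑ s ∈ F, e (nbhd 𝒯 (tri s)) v ≤ N * W :=
      he.sum_nbhd_le hq v hFe mE hFsub
    have hmR : m R v ≤ 2 * (C * H) ^ 2 * (N * W) := by
      calc m R v ≤ ∑ s ∈ F, m (tri s) v := by
            refine hm.le_sum F tri (fun s _ => measurableSet_tri s) mR (fun x hx => ?_) v
            obtain ⟨s, hs, hxs, hsub⟩ := exists_tri_subset_patch ht hx.1.1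
            refine mem_iUnion₂.2 ⟨s, Finset.mem_filter.2 ⟨Finset.mem_filter.2 ⟨hs, fun h => ?_⟩,
              ?_⟩, hxs⟩
            · exact hx.1.2 (patch_subset_succ ht _ (h hxs))
            · exact not_disjoint_iff.2 ⟨x, hxs, patch_subset_succ ht _ hx.1.1⟩
        _ ≤ ∑ s ∈ F, 2 * (C * H) ^ 2 * e (nbhd 𝒯 (tri s)) v :=
            Finset.sum_le_sum fun s hs => hV.mass_le hv (hFe hs)
        _ ≤ 2 * (C * H) ^ 2 * (N * W) := by
            rw [← Finset.mul_sum]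
            exact mul_le_mul_of_nonneg_left hsum (by positivity)
    -- the factor `1 / H` from the gradient of the cutoff cancels here
    have hLm : (4 * γ / H) ^ 2 * m R v ≤ 32 * γ ^ 2 * C ^ 2 * N * W := by
      calc (4 * γ / H) ^ 2 * m R v
          ≤ (4 * γ / H) ^ 2 * (2 * (C * H) ^ 2 * (N * W)) :=
            mul_le_mul_of_nonneg_left hmR (by positivity)
        _ = 32 * γ ^ 2 * C ^ 2 * N * W := by field_simp; ring
    have hDE : e D v ≤ W :=
      he.mono_set mD mE (sdiff_subset_sdiff_right (patch_mono ht (by omega))) v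
    have hDu : e D u ≤ 2 * W + 2 * (32 * γ ^ 2 * C ^ 2 * N * W) := by
      have h1 := hu D mD
      have h2 : m (D ∩ R) v ≤ m R v :=
        hm.mono_set (mD.inter mR) mR inter_subset_right v
      have h3 := mul_le_mul_of_nonneg_left h2 (sq_nonneg (4 * γ / H))
      change e D u ≤ 2 * e D v + 2 * (4 * γ / H) ^ 2 * m (D ∩ R) v at h1
      linarith
    have hsu : ∑ s ∈ F, e (nbhd 𝒯 (tri s)) u ≤
        2 * (N * W) + 2 * N * (32 * γ ^ 2 * C ^ 2 * N * W) := by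
      have h1 : ∑ s ∈ F, m (nbhd 𝒯 (tri s) ∩ R) v ≤ N * m R v :=
        hm.sum_nbhd_inter_le hq v hFe mR mR fun s _ => inter_subset_right
      have h2 := mul_le_mul_of_nonneg_left h1 (sq_nonneg (4 * γ / H))
      have h3 := mul_le_mul_of_nonneg_left hLm hN0
      calc ∑ s ∈ F, e (nbhd 𝒯 (tri s)) u
          ≤ ∑ s ∈ F, (2 * e (nbhd 𝒯 (tri s)) v +
              2 * (4 * γ / H) ^ 2 * m (nbhd 𝒯 (tri s) ∩ R) v) :=
            Finset.sum_le_sum fun s _ => hu _ (measurableSet_nbhd _)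
        _ = 2 * ∑ s ∈ F, e (nbhd 𝒯 (tri s)) v +
            2 * ((4 * γ / H) ^ 2 * ∑ s ∈ F, m (nbhd 𝒯 (tri s) ∩ R) v) := by
            rw [Finset.sum_add_distrib, ← Finset.mul_sum, ← Finset.mul_sum]; ring
        _ ≤ _ := by linarith
    have hDI : e D (I u) ≤
        2 * C ^ 2 * (2 * (N * W) + 2 * N * (32 * γ ^ 2 * C ^ 2 * N * W)) := by
      calc e D (I u) ≤ ∑ s ∈ G, e (tri s) (I u) := by
            refine he.le_sum G tri (fun s _ => measurableSet_tri s) mD (fun x hx => ?_) _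
            obtain ⟨s, hs, hxs⟩ := Triangulation.mem_support.1 (𝒯.domain_subset hx.2)
            exact mem_iUnion₂.2 ⟨s, Finset.mem_filter.2 ⟨hs, fun h => hx.1.2 (h hxs)⟩, hxs⟩
        _ ≤ ∑ s ∈ G, if ¬ Disjoint (tri s) (patch 𝒯 (l + 6) t) then
              2 * C ^ 2 * e (nbhd 𝒯 (tri s)) u else 0 := by
            refine Finset.sum_le_sum fun s hs => ?_
            split_ifs with h
            · exact (n2 s (hGe s hs) h).le
            · exact hV.energy_map_le u s (hGe s hs)
        _ = 2 * C ^ 2 * ∑ s ∈ F, e (nbhd 𝒯 (tri s)) u := by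
            rw [← Finset.sum_filter, Finset.mul_sum]
        _ ≤ _ := mul_le_mul_of_nonneg_left hsu (by positivity)
    have hsplit : e (patch 𝒯 (l + 2) t) (u - I u) + e D (u - I u) =
        e (patch 𝒯 (l + 8) t) (u - I u) :=
      he.add_diff (mP _) (mP _) (patch_mono ht (by omega)) _
    have hfin := he.sub_le mD u (I u)
    rw [← hsplit, z, zero_add, cutConst, ← hN]
    nlinarith
end FineCutoff

/-! ### Existence and uniqueness of the correctors -/

section Existence

variable {Ω : Set Plane} {𝒯 : Triangulation Ω} {H γ C α β : ℝ} {E : Type*} [AddCommGroup E]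
  [Module ℝ E] {e m : Set Plane → E → ℝ} {I : E →ₗ[ℝ] E} {a : Set Plane → E → E → ℝ}

theorem nonpos_of_forall_le_mul {x K : ℝ} (h : ∀ ε > 0, x ≤ K * ε) : x ≤ 0 := by
  by_contra! hx
  have hK : 0 < K := by
    have := h 1 one_pos
    linarith
  have := h (x / (2 * K)) (by positivity)
  have e1 : K * (x / (2 * K)) = x / 2 := by field_simp
  linarith

/-- The Poincaré inequality on the fine space. It makes the form definite on fine functions. -/
theorem IsLocalized.mass_univ_le (hV : IsLocalized 𝒯 H γ C α β e m I a) {v : E} (hv : I v = 0) :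
    m univ v ≤ 2 * (C * H) ^ 2 * overlap γ * e univ v := by
  calc m univ v ≤ ∑ t ∈ 𝒯.elems, m (tri t) v := by
        refine hV.mass.le_sum _ tri (fun t _ => measurableSet_tri t) MeasurableSet.univ
          (fun x hx => ?_) v
        obtain ⟨t, ht, hxt⟩ := Triangulation.mem_support.1 (𝒯.domain_subset hx.2)
        exact mem_iUnion₂.2 ⟨t, ht, hxt⟩
    _ ≤ ∑ t ∈ 𝒯.elems, 2 * (C * H) ^ 2 * e (nbhd 𝒯 (tri t)) v :=
        Finset.sum_le_sum fun t ht => hV.mass_le hv ht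
    _ ≤ 2 * (C * H) ^ 2 * (overlap γ * e univ v) := by
        rw [← Finset.mul_sum]
        exact mul_le_mul_of_nonneg_left (hV.energy.sum_nbhd_le hV.quasiUniform v subset_rfl
          MeasurableSet.univ fun _ _ => subset_univ _) (by positivity)
    _ = _ := by ring

theorem IsLocalized.form_self_le (hV : IsLocalized 𝒯 H γ C α β e m I a) (hβ : 0 ≤ β)
    {S : Set Plane} (hS : MeasurableSet S) (v : E) : a S v v ≤ β * e S v := by
  refine le_of_sq_le_sq ?_ (mul_nonneg hβ (hV.energy.nonneg S v))
  have := hV.sq_form_le hS v v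
  linarith

theorem IsLocalized.form_eq_zero (hV : IsLocalized 𝒯 H γ C α β e m I a)
    {S : Set Plane} (hS : MeasurableSet S) (v : E) {w : E} (hw : e S w = 0) : a S v w = 0 := by
  have := hV.sq_form_le hS v w
  rw [hw, mul_zero, mul_zero] at this
  exact pow_eq_zero_iff two_ne_zero |>.1 (le_antisymm this (sq_nonneg _))

/-- The fine space is closed: on each element, the stability and the error estimate of `I` bound
`I x = -I (u n - x)` by the energy and the mass of `u n - x`. -/
theorem IsLocalized.map_eq_zero_of_tendsto (hV : IsLocalized 𝒯 H γ C α β e m I a) {u : ℕ → E}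
    {x : E} (hu : ∀ n, I (u n) = 0)
    (hx : ∀ ε > 0, ∃ N, ∀ i ≥ N, e univ (u i - x) + m univ (u i - x) < ε) : I x = 0 := by
  have he := hV.energy
  have hm := hV.mass
  have hd : ∀ n, I (u n - x) = -I x := fun n => by rw [map_sub, hu, zero_sub]
  have mt := measurableSet_tri
  have key : ∀ ε > 0, ∃ d, e univ d < ε ∧ m univ d < ε ∧ I d = -I x := by
    intro ε hε
    obtain ⟨N, hN⟩ := hx ε hε
    have h1 := hN N le_rfl
    have h2 := he.nonneg univ (u N - x)
    have h3 := hm.nonneg univ (u N - x)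
    exact ⟨u N - x, by linarith, by linarith, hd N⟩
  have hE : ∀ t ∈ 𝒯.elems, e (tri t) (I x) = 0 := by
    intro t ht
    refine he.eq_zero_of_le (nonpos_of_forall_le_mul (K := 2 * C ^ 2) fun ε hε => ?_)
    obtain ⟨d, h1, -, h2⟩ := key ε hε
    have := hV.energy_map_le d t ht
    rw [h2, he.neg (mt t)] at this
    refine this.trans (mul_le_mul_of_nonneg_left ?_ (by positivity))
    exact (he.mono_set (measurableSet_nbhd _) MeasurableSet.univ (subset_univ _) d).trans h1.le
  have hM : ∀ t ∈ 𝒯.elems, m (tri t) (I x) = 0 := by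
    intro t ht
    refine hm.eq_zero_of_le (nonpos_of_forall_le_mul (K := 2 * (2 * (C * H) ^ 2) + 2)
      fun ε hε => ?_)
    obtain ⟨d, h1, h1', h2⟩ := key ε hε
    have h3 := hV.mass_sub_le d t ht
    have h4 : I x = (d - I d) - d := by rw [h2]; abel
    have h5 := hm.sub_le (mt t) (d - I d) d
    rw [← h4] at h5
    have h6 := hm.mono_set (mt t) MeasurableSet.univ (subset_univ _) d
    have h7 := mul_le_mul_of_nonneg_left
      ((he.mono_set (measurableSet_nbhd (𝒯 := 𝒯) (tri t)) MeasurableSet.univ (subset_univ _)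
        d).trans h1.le) (show 0 ≤ 2 * (C * H) ^ 2 by positivity)
    linarith
  have cover : ∀ y ∈ Ω, y ∈ univ → ∃ t ∈ 𝒯.elems, y ∈ tri t := fun y hy _ =>
    Triangulation.mem_support.1 (𝒯.domain_subset hy)
  refine hV.definite _ ?_ ?_
  · exact he.eq_zero_of_tri 𝒯 MeasurableSet.univ fun y hy hy' => by
      obtain ⟨t, ht, hyt⟩ := cover y hy hy'
      exact ⟨t, ht, hyt, hE t ht⟩
  · exact hm.eq_zero_of_tri 𝒯 MeasurableSet.univ fun y hy hy' => by
      obtain ⟨t, ht, hyt⟩ := cover y hy hy'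
      exact ⟨t, ht, hyt, hM t ht⟩

/-- The fine functions supported in `S`. -/
def IsLocalized.fineSpace (hV : IsLocalized 𝒯 H γ C α β e m I a) {S : Set Plane}
    (hS : MeasurableSet S) : Submodule ℝ E where
  carrier := {w | I w = 0 ∧ m Sᶜ w = 0}
  zero_mem' := ⟨map_zero I, hV.mass.eq_zero_of_le (by
    have := hV.mass.smul_le hS.compl 0 0
    rwa [smul_zero, zero_pow two_ne_zero, zero_mul] at this)⟩
  add_mem' := by
    rintro v w ⟨h1, h2⟩ ⟨h3, h4⟩
    refine ⟨by rw [map_add, h1, h3, add_zero], hV.mass.eq_zero_of_le ?_⟩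
    have := hV.mass.add_le hS.compl v w
    rwa [h2, h4, mul_zero, add_zero] at this
  smul_mem' := by
    rintro c v ⟨h1, h2⟩
    refine ⟨by rw [map_smul, h1, smul_zero], hV.mass.eq_zero_of_le ?_⟩
    have := hV.mass.smul_le hS.compl c v
    rwa [h2, mul_zero] at this

/-- The form on `S` as a bilinear map. -/
def IsLocalized.bilin (hV : IsLocalized 𝒯 H γ C α β e m I a) {S : Set Plane}
    (hS : MeasurableSet S) : E →ₗ[ℝ] E →ₗ[ℝ] ℝ :=
  LinearMap.mk₂ ℝ (a S) (hV.form_add_left hS) (hV.form_smul_left hS)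
    (fun u v w => by
      rw [hV.form_comm, hV.form_add_left hS, hV.form_comm S v u, hV.form_comm S w u])
    (fun c v w => by rw [hV.form_comm, hV.form_smul_left hS, hV.form_comm, smul_eq_mul])

theorem IsLocalized.form_sub_left (hV : IsLocalized 𝒯 H γ C α β e m I a) {S : Set Plane}
    (hS : MeasurableSet S) (u v w : E) : a S (u - v) w = a S u w - a S v w :=
  LinearMap.map_sub₂ (hV.bilin hS) u v w

theorem IsLocalized.form_sub_right (hV : IsLocalized 𝒯 H γ C α β e m I a) {S : Set Plane}
    (hS : MeasurableSet S) (u v w : E) : a S u (v - w) = a S u v - a S u w :=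
  map_sub (hV.bilin hS u) v w

/-- The Galerkin problem on the fine functions supported in `S` is uniquely solvable. -/
theorem IsLocalized.existsUnique_forall_form_eq (hV : IsLocalized 𝒯 H γ C α β e m I a)
    (hα : 0 < α) (hβ : 0 ≤ β) {S : Set Plane} (hS : MeasurableSet S) (t : Finset Plane) (v : E) :
    ∃! φ, (I φ = 0 ∧ m Sᶜ φ = 0) ∧
      ∀ w, I w = 0 → m Sᶜ w = 0 → a univ φ w = a (tri t) v w := by
  have he := hV.energy
  have hm := hV.mass
  have mU : MeasurableSet (univ : Set Plane) := MeasurableSet.univ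
  set P := 2 * (C * H) ^ 2 * overlap γ with hP
  have hP0 : 0 ≤ P := mul_nonneg (by positivity) (overlap_nonneg γ)
  let K := hV.fineSpace hS
  have hfine : ∀ w : K, e univ w + m univ w ≤ (1 + P) / α * a univ w w := by
    intro w
    have h1 := hV.mass_univ_le w.2.1
    have h2 := hV.le_form mU (w : E)
    have h3 : e univ w ≤ a univ w w / α := by rw [le_div_iff₀ hα]; linarith
    have h4 := mul_le_mul_of_nonneg_left h3 (show 0 ≤ 1 + P by positivity)
    calc e univ (w : E) + m univ w ≤ (1 + P) * e univ w := by linarith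
      _ ≤ (1 + P) * (a univ w w / α) := h4
      _ = _ := by ring
  have hpos : ∀ w : E, 0 ≤ a univ w w := fun w =>
    (mul_nonneg hα.le (he.nonneg univ w)).trans (hV.le_form mU w)
  have hdef : ∀ w : K, a univ w w = 0 → w = 0 := by
    intro w hw
    have h1 := hfine w
    rw [hw, mul_zero] at h1
    have h2 := he.nonneg univ (w : E)
    have h3 := hm.nonneg univ (w : E)
    exact Subtype.ext (hV.definite _ (by linarith) (by linarith))
  let B : K →ₗ[ℝ] K →ₗ[ℝ] ℝ := (hV.bilin mU).domRestrict₁₂ K K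
  have hB : ∀ x y : K, B x y = a univ x y := fun _ _ => rfl
  have hcomp : ∀ u : ℕ → K, (∀ ε > 0, ∃ N, ∀ i ≥ N, ∀ j ≥ N, B (u i - u j) (u i - u j) < ε) →
      ∃ x, ∀ ε > 0, ∃ N, ∀ n ≥ N, B (u n - x) (u n - x) < ε := by
    intro u hu
    obtain ⟨x, hx⟩ := hV.complete (fun n => (u n : E)) fun ε hε => by
      obtain ⟨N, hN⟩ := hu (α / (1 + P) * ε) (by positivity)
      refine ⟨N, fun i hi j hj => ?_⟩
      have h1 := hfine (u i - u j)
      have h2 := mul_lt_mul_of_pos_left (hN i hi j hj) (show 0 < (1 + P) / α by positivity)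
      have h3 : (1 + P) / α * (α / (1 + P) * ε) = ε := by field_simp
      rw [h3] at h2
      exact h1.trans_lt h2
    have hxK : x ∈ K := by
      refine ⟨hV.map_eq_zero_of_tendsto (fun n => (u n).2.1) hx, hm.eq_zero_of_le
        (nonpos_of_forall_le_mul (K := 2) fun ε hε => ?_)⟩
      obtain ⟨N, hN⟩ := hx ε hε
      have h1 := hN N le_rfl
      have h2 := he.nonneg univ ((u N : E) - x)
      have h3 := hm.mono_set hS.compl mU (subset_univ _) ((u N : E) - x)
      have h4 := hm.sub_le hS.compl (u N : E) ((u N : E) - x)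
      rw [sub_sub_cancel, (u N).2.2] at h4
      linarith
    refine ⟨⟨x, hxK⟩, fun ε hε => ?_⟩
    obtain ⟨N, hN⟩ := hx (ε / (β + 1)) (by positivity)
    refine ⟨N, fun n hn => ?_⟩
    have h1 := hN n hn
    have h2 := hV.form_self_le hβ mU ((u n : E) - x)
    have h3 := hm.nonneg univ ((u n : E) - x)
    have h4 := he.nonneg univ ((u n : E) - x)
    rw [lt_div_iff₀ (by positivity)] at h1
    change a univ ((u n : E) - x) ((u n : E) - x) < ε
    nlinarith
  obtain ⟨φ, hφ⟩ := exists_forall_apply_eq B (fun x y => hV.form_comm univ _ _)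
    (fun x => hpos x) hdef hcomp ((hV.bilin (measurableSet_tri t) v).domRestrict K)
    (C := β ^ 2 * e (tri t) v / α)
    (div_nonneg (mul_nonneg (sq_nonneg β) (he.nonneg _ v)) hα.le) fun w => by
      change a (tri t) v w ^ 2 ≤ _ * a univ w w
      refine (hV.sq_form_le (measurableSet_tri t) v w).trans ?_
      have h1 := he.mono_set (measurableSet_tri t) mU (subset_univ _) (w : E)
      have h2 := hV.le_form mU (w : E)
      have h3 : e (tri t) w ≤ a univ w w / α := by rw [le_div_iff₀ hα]; nlinarith
      calc β ^ 2 * (e (tri t) v * e (tri t) w)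
          ≤ β ^ 2 * (e (tri t) v * (a univ w w / α)) := by
            gcongr
            exact he.nonneg _ v
        _ = _ := by ring
  have hφ' : ∀ w, I w = 0 → m Sᶜ w = 0 → a univ φ w = a (tri t) v w := fun w h1 h2 =>
    hφ ⟨w, h1, h2⟩
  refine ⟨φ, ⟨φ.2, hφ'⟩, ?_⟩
  rintro ψ ⟨hψ, hψ'⟩
  have hd : (⟨ψ, hψ⟩ : K) - φ = 0 := hdef _ <| by
    have h1 := hψ' (ψ - φ) ((⟨ψ, hψ⟩ : K) - φ).2.1 ((⟨ψ, hψ⟩ : K) - φ).2.2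
    have h2 := hφ' (ψ - φ) ((⟨ψ, hψ⟩ : K) - φ).2.1 ((⟨ψ, hψ⟩ : K) - φ).2.2
    change a univ (ψ - φ) (ψ - φ) = 0
    rw [hV.form_sub_left mU, h1, h2, sub_self]
  exact congrArg Subtype.val (sub_eq_zero.1 hd)

theorem IsLocalized.form_add_compl (hV : IsLocalized 𝒯 H γ C α β e m I a) {S : Set Plane}
    (hS : MeasurableSet S) (v w : E) : a S v w + a Sᶜ v w = a univ v w := by
  rw [compl_eq_univ_sdiff]
  exact hV.form_add_diff hS MeasurableSet.univ (subset_univ S) v w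

/-- Functions supported in a closed set `S` have no energy on the open complement, so that the form
on `S` agrees with the one on the whole domain. Both correctors are thus Galerkin solutions for the
same form. -/
theorem IsLocalized.form_eq_form_univ (hV : IsLocalized 𝒯 H γ C α β e m I a) {S : Set Plane}
    (hS : IsClosed S) (v : E) {w : E} (hw : m Sᶜ w = 0) : a S v w = a univ v w := by
  have h := hV.form_add_compl hS.measurableSet v w
  rwa [hV.form_eq_zero hS.measurableSet.compl v (hV.energy_eq_zero hS.isOpen_compl hw),
    add_zero] at h

theorem IsLocalized.existsUnique_corrector (hV : IsLocalized 𝒯 H γ C α β e m I a)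
    (hα : 0 < α) (hβ : 0 ≤ β) (t : Finset Plane) (v : E) :
    ∃! φ, I φ = 0 ∧ ∀ w, I w = 0 → a univ φ w = a (tri t) v w := by
  have h0 : ∀ w : E, m univᶜ w = 0 := fun w => by rw [compl_univ]; exact hV.mass.empty w
  obtain ⟨φ, ⟨h1, h2⟩, h3⟩ := hV.existsUnique_forall_form_eq hα hβ MeasurableSet.univ t v
  exact ⟨φ, ⟨h1.1, fun w hw => h2 w hw (h0 w)⟩,
    fun ψ hψ => h3 ψ ⟨⟨hψ.1, h0 ψ⟩, fun w hw _ => hψ.2 w hw⟩⟩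

theorem IsLocalized.existsUnique_localCorrector (hV : IsLocalized 𝒯 H γ C α β e m I a)
    (hα : 0 < α) (hβ : 0 ≤ β) {S : Set Plane} (hS : IsClosed S) (t : Finset Plane) (v : E) :
    ∃! φ, (I φ = 0 ∧ m Sᶜ φ = 0) ∧
      ∀ w, I w = 0 → m Sᶜ w = 0 → a S φ w = a (tri t) v w := by
  obtain ⟨φ, ⟨h1, h2⟩, h3⟩ := hV.existsUnique_forall_form_eq hα hβ hS.measurableSet t v
  exact ⟨φ, ⟨h1, fun w hw hw' => (hV.form_eq_form_univ hS φ hw').trans (h2 w hw hw')⟩,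
    fun ψ hψ => h3 ψ ⟨hψ.1, fun w hw hw' =>
      (hV.form_eq_form_univ hS ψ hw').symm.trans (hψ.2 w hw hw')⟩⟩

theorem IsLocalized.form_univ_eq_of_localCorrector (hV : IsLocalized 𝒯 H γ C α β e m I a)
    {k : ℕ} {t : Finset Plane} {v ψ : E}
    (h : (I ψ = 0 ∧ m (patch 𝒯 k t)ᶜ ψ = 0) ∧ ∀ w, I w = 0 → m (patch 𝒯 k t)ᶜ w = 0 →
      a (patch 𝒯 k t) ψ w = a (tri t) v w) :
    (I ψ = 0 ∧ m (patch 𝒯 k t)ᶜ ψ = 0) ∧ ∀ w, I w = 0 → m (patch 𝒯 k t)ᶜ w = 0 →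
      a univ ψ w = a (tri t) v w :=
  ⟨h.1, fun w hw hw' =>
    (hV.form_eq_form_univ (isClosed_patch k t) ψ hw').symm.trans (h.2 w hw hw')⟩

end Existence

/-! ### Exponential decay of the correctors -/

section Decay

variable {Ω : Set Plane} {𝒯 : Triangulation Ω} {H γ C α β : ℝ} {E : Type*} [AddCommGroup E]
  [Module ℝ E] {e m : Set Plane → E → ℝ} {I : E →ₗ[ℝ] E} {a : Set Plane → E → E → ℝ}

/-- The factor by which the energy of a corrector decreases across eight layers of elements. -/
def decayRate (α β γ C : ℝ) : ℝ := cutConst γ C * β / (α + cutConst γ C * β)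

theorem decayRate_pos (hα : 0 < α) (hβ : 0 < β) (γ C : ℝ) : 0 < decayRate α β γ C := by
  have := one_le_cutConst γ C
  rw [decayRate]
  positivity

theorem decayRate_lt_one (hα : 0 < α) (hβ : 0 < β) (γ C : ℝ) : decayRate α β γ C < 1 := by
  have := one_le_cutConst γ C
  rw [decayRate, div_lt_one (by positivity)]
  linarith

/-- Testing the equation of a corrector with its own cutoff bounds the energy outside of a patch by
the energy in a ring. Filling the hole gives a contraction. -/
theorem IsLocalized.energy_compl_patch_add_le (hV : IsLocalized 𝒯 H γ C α β e m I a)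
    (hα : 0 < α) (hβ : 0 < β) {t : Finset Plane} (ht : t ∈ 𝒯.elems) {v φ : E} (hφ : I φ = 0)
    (h : ∀ w, I w = 0 → a univ φ w = a (tri t) v w) (l : ℕ) :
    e (patch 𝒯 (l + 8) t)ᶜ φ ≤ decayRate α β γ C * e (patch 𝒯 l t)ᶜ φ := by
  have he := hV.energy
  have mP := fun j => measurableSet_patch (𝒯 := 𝒯) j t
  have hK := one_le_cutConst γ C
  obtain ⟨w, hw, hw0, hw1, hw2⟩ := hV.exists_fine_cutoff ht l hφ
  set K := cutConst γ C
  have hw1' : e (patch 𝒯 (l + 7) t)ᶜ (φ - w) = 0 :=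
    hV.energy_eq_zero (isClosed_patch _ _).isOpen_compl hw1
  have h0 : a univ φ w = 0 := by
    rw [h w hw]
    refine hV.form_eq_zero (measurableSet_tri t) v ?_
    exact he.eq_zero_of_subset (measurableSet_tri t) (mP _) (patch_mono ht (Nat.zero_le _)) hw0
  have h1 : a (patch 𝒯 (l + 8) t)ᶜ φ (φ - w) = 0 :=
    hV.form_eq_zero (mP _).compl φ (he.eq_zero_of_subset (mP _).compl (mP _).compl
      (compl_subset_compl.2 (patch_mono ht (by omega))) hw1')
  rw [hV.form_sub_right (mP _).compl] at h1
  have h2 := hV.form_add_compl (mP (l + 8)) φ w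
  have h3 := hV.form_add_diff (mP (l + 2)) (mP (l + 8)) (patch_mono ht (by omega)) φ w
  rw [hV.form_eq_zero (mP _) φ hw0, zero_add] at h3
  have h4 := hV.le_form (mP (l + 8)).compl φ
  have h5 := hV.sq_form_le ((mP (l + 8)).diff (mP (l + 2))) φ w
  set R := e (patch 𝒯 (l + 8) t \ patch 𝒯 l t) φ with hR
  have hR0 : 0 ≤ R := he.nonneg _ _
  have h6 : e (patch 𝒯 (l + 8) t \ patch 𝒯 (l + 2) t) φ ≤ R :=
    he.mono_set ((mP _).diff (mP _)) ((mP _).diff (mP _))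
      (sdiff_subset_sdiff_right (patch_mono ht (by omega))) φ
  have h7 : e (patch 𝒯 (l + 8) t \ patch 𝒯 (l + 2) t) w ≤ K * R :=
    (he.mono_set ((mP _).diff (mP _)) (mP _) sdiff_subset w).trans hw2
  have h8 : |a (patch 𝒯 (l + 8) t \ patch 𝒯 (l + 2) t) φ w| ≤ K * β * R := by
    refine abs_le_of_sq_le_sq (h5.trans ?_) (by positivity)
    calc β ^ 2 * (e (patch 𝒯 (l + 8) t \ patch 𝒯 (l + 2) t) φ *
          e (patch 𝒯 (l + 8) t \ patch 𝒯 (l + 2) t) w)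
        ≤ β ^ 2 * (R * (K * R)) := by
          gcongr
          exact he.nonneg _ _
      _ = K * (β * R) ^ 2 := by ring
      _ ≤ K ^ 2 * (β * R) ^ 2 :=
          mul_le_mul_of_nonneg_right (by nlinarith) (sq_nonneg _)
      _ = (K * β * R) ^ 2 := by ring
  have h9 : e (patch 𝒯 (l + 8) t)ᶜ φ + R = e (patch 𝒯 l t)ᶜ φ := by
    have := he.add_diff (mP (l + 8)).compl (mP l).compl
      (compl_subset_compl.2 (patch_mono ht (by omega))) φ
    rwa [compl_sdiff_compl] at this
  have h10 : α * e (patch 𝒯 (l + 8) t)ᶜ φ ≤ K * β * R := by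
    have := neg_abs_le (a (patch 𝒯 (l + 8) t \ patch 𝒯 (l + 2) t) φ w)
    linarith
  rw [decayRate, div_mul_eq_mul_div, le_div_iff₀ (by positivity), ← h9]
  linarith

/-- Iterating the contraction. -/
theorem IsLocalized.energy_compl_patch_le (hV : IsLocalized 𝒯 H γ C α β e m I a)
    (hα : 0 < α) (hβ : 0 < β) {t : Finset Plane} (ht : t ∈ 𝒯.elems) {v φ : E} (hφ : I φ = 0)
    (h : ∀ w, I w = 0 → a univ φ w = a (tri t) v w) (l : ℕ) :
    e (patch 𝒯 l t)ᶜ φ ≤ decayRate α β γ C ^ (l / 8) * e univ φ := by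
  have he := hV.energy
  have mP := fun j => measurableSet_patch (𝒯 := 𝒯) j t
  have key : ∀ n, e (patch 𝒯 (8 * n) t)ᶜ φ ≤ decayRate α β γ C ^ n * e univ φ := by
    intro n
    induction n with
    | zero => simpa using he.mono_set (mP _).compl MeasurableSet.univ (subset_univ _) φ
    | succ n ih =>
      refine (hV.energy_compl_patch_add_le hα hβ ht hφ h (8 * n)).trans ?_
      rw [pow_succ', mul_assoc]
      exact mul_le_mul_of_nonneg_left ih (decayRate_pos hα hβ γ C).le
  exact (he.mono_set (mP _).compl (mP _).compl
    (compl_subset_compl.2 (patch_mono ht (Nat.mul_div_le l 8))) φ).trans (key (l / 8))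

/-- The energy estimate for a corrector, tested with itself. -/
theorem IsLocalized.energy_corrector_le (hV : IsLocalized 𝒯 H γ C α β e m I a)
    (hα : 0 < α) {t : Finset Plane} {v φ : E} (hφ : I φ = 0)
    (h : ∀ w, I w = 0 → a univ φ w = a (tri t) v w) :
    e univ φ ≤ (β / α) ^ 2 * e (tri t) v := by
  have he := hV.energy
  have h1 := hV.le_form MeasurableSet.univ φ
  rw [h φ hφ] at h1
  have h2 := hV.sq_form_le (measurableSet_tri t) v φ
  have h3 := he.mono_set (measurableSet_tri t) MeasurableSet.univ (subset_univ _) φ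
  have h4 := he.nonneg univ φ
  have h5 := he.nonneg (tri t) v
  rcases h4.eq_or_lt with h0 | h0
  · rw [← h0]; positivity
  · have h6 : (α * e univ φ) ^ 2 ≤ β ^ 2 * (e (tri t) v * e univ φ) :=
      (pow_le_pow_left₀ (by positivity) h1 2).trans (h2.trans (by gcongr))
    rw [div_pow, div_mul_eq_mul_div, le_div_iff₀ (by positivity)]
    refine le_of_mul_le_mul_right ?_ h0
    linarith

/-- The localization error of a single corrector. By Galerkin orthogonality it is at most the
energy of the part of the corrector which is cut off to make it fit into the patch. -/
theorem IsLocalized.energy_sub_localCorrector_le (hV : IsLocalized 𝒯 H γ C α β e m I a)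
    (hα : 0 < α) (hβ : 0 < β) {t : Finset Plane} (ht : t ∈ 𝒯.elems) {v φ ψ : E} {k : ℕ}
    (hk : 7 ≤ k) (hφ : I φ = 0)
    (h : ∀ w, I w = 0 → a univ φ w = a (tri t) v w) (hψ : I ψ = 0)
    (hψk : m (patch 𝒯 k t)ᶜ ψ = 0)
    (h' : ∀ w, I w = 0 → m (patch 𝒯 k t)ᶜ w = 0 → a univ ψ w = a (tri t) v w) :
    e univ (φ - ψ) ≤ 3 * cutConst γ C * (β / α) ^ 4 * decayRate α β γ C ^ ((k - 7) / 8) *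
      e (tri t) v := by
  have he := hV.energy
  have hm := hV.mass
  have mU : MeasurableSet (univ : Set Plane) := MeasurableSet.univ
  have mP := fun j => measurableSet_patch (𝒯 := 𝒯) j t
  have hK := one_le_cutConst γ C
  obtain ⟨l, rfl⟩ := Nat.exists_eq_add_of_le' hk
  rw [Nat.add_sub_cancel]
  obtain ⟨w, hw, hw0, hw1, hw2⟩ := hV.exists_fine_cutoff ht l hφ
  set K := cutConst γ C
  -- `φ - w` is an admissible competitor for `ψ`
  have horth : a univ (φ - ψ) (φ - w - ψ) = 0 := by
    have i1 : I (φ - w - ψ) = 0 := by rw [map_sub, map_sub, hφ, hw, hψ, sub_zero, sub_zero]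
    have i2 : m (patch 𝒯 (l + 7) t)ᶜ (φ - w - ψ) = 0 :=
      hm.eq_zero_of_le ((hm.sub_le (mP _).compl _ _).trans (by rw [hw1, hψk]; norm_num))
    rw [hV.form_sub_left mU, h _ i1, h' _ i1 i2, sub_self]
  have h1 : a univ (φ - ψ) (φ - ψ) = a univ (φ - ψ) w := by
    rw [sub_right_comm, hV.form_sub_right mU] at horth
    linarith
  have h2 := hV.le_form mU (φ - ψ)
  rw [h1] at h2
  have h3 := hV.sq_form_le mU (φ - ψ) w
  have h4 : e univ (φ - ψ) ≤ (β / α) ^ 2 * e univ w := by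
    rcases (he.nonneg univ (φ - ψ)).eq_or_lt with h0 | h0
    · rw [← h0]; exact mul_nonneg (sq_nonneg _) (he.nonneg _ _)
    · have h6 := (pow_le_pow_left₀ (mul_nonneg hα.le h0.le) h2 2).trans h3
      rw [div_pow, div_mul_eq_mul_div, le_div_iff₀ (by positivity)]
      refine le_of_mul_le_mul_right ?_ h0
      linarith
  have h5 : e univ w ≤ 3 * K * e (patch 𝒯 l t)ᶜ φ := by
    have g1 := he.add_compl (mP (l + 8)) w
    have g2 : e (patch 𝒯 (l + 8) t \ patch 𝒯 l t) φ ≤ e (patch 𝒯 l t)ᶜ φ :=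
      he.mono_set ((mP _).diff (mP _)) (mP _).compl (fun x hx => hx.2) φ
    have g3 : e (patch 𝒯 (l + 8) t)ᶜ (φ - w) = 0 :=
      he.eq_zero_of_subset (mP _).compl (mP (l + 7)).compl
        (compl_subset_compl.2 (patch_mono ht (by omega)))
        (hV.energy_eq_zero (isClosed_patch _ _).isOpen_compl hw1)
    have g4 := he.sub_le (mP (l + 8)).compl φ (φ - w)
    rw [sub_sub_cancel, g3] at g4
    have g5 : e (patch 𝒯 (l + 8) t)ᶜ φ ≤ e (patch 𝒯 l t)ᶜ φ :=
      he.mono_set (mP _).compl (mP _).compl (compl_subset_compl.2 (patch_mono ht (by omega))) φ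
    have g6 := he.nonneg (patch 𝒯 l t)ᶜ φ
    nlinarith
  have h6 := hV.energy_compl_patch_le hα hβ ht hφ h l
  have h7 := hV.energy_corrector_le hα hφ h
  have hθ := (decayRate_pos hα hβ γ C).le
  have hθ' : 0 ≤ decayRate α β γ C ^ (l / 8) := pow_nonneg hθ _
  calc e univ (φ - ψ) ≤ (β / α) ^ 2 * (3 * K * e (patch 𝒯 l t)ᶜ φ) :=
        h4.trans (mul_le_mul_of_nonneg_left h5 (sq_nonneg _))
    _ ≤ (β / α) ^ 2 * (3 * K * (decayRate α β γ C ^ (l / 8) * ((β / α) ^ 2 * e (tri t) v))) := by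
        gcongr
        exact h6.trans (mul_le_mul_of_nonneg_left h7 hθ')
    _ = _ := by ring

/-- The constant in the global localization error. -/
def truncConst (α β γ C : ℝ) : ℝ :=
  192 * cutConst γ C ^ 2 * (β / α) ^ 6 * overlap γ * γ ^ 2

/-- The global localization error. The local errors are almost orthogonal: the error of a single
corrector does not see fine functions which vanish near its element, so that it only has to be
tested with the part of the global error close to the element. -/
theorem IsLocalized.energy_sum_sub_le (hV : IsLocalized 𝒯 H γ C α β e m I a)
    (hα : 0 < α) (hβ : 0 < β) {v : E} {k : ℕ} (hk : 7 ≤ k) {φ ψ : Finset Plane → E}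
    (hφ : ∀ t ∈ 𝒯.elems, I (φ t) = 0 ∧ ∀ w, I w = 0 → a univ (φ t) w = a (tri t) v w)
    (hψ : ∀ t ∈ 𝒯.elems, (I (ψ t) = 0 ∧ m (patch 𝒯 k t)ᶜ (ψ t) = 0) ∧
      ∀ w, I w = 0 → m (patch 𝒯 k t)ᶜ w = 0 → a univ (ψ t) w = a (tri t) v w) :
    e univ (∑ t ∈ 𝒯.elems, φ t - ∑ t ∈ 𝒯.elems, ψ t) ≤
      truncConst α β γ C * (k + 7) ^ 2 * decayRate α β γ C ^ ((k - 7) / 8) * e univ v := by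
  have he := hV.energy
  have hm := hV.mass
  have hq := hV.quasiUniform
  have mU : MeasurableSet (univ : Set Plane) := MeasurableSet.univ
  have mP := fun j t => measurableSet_patch (𝒯 := 𝒯) j t
  have hK := one_le_cutConst γ C
  set K := cutConst γ C with hKdef
  set θ := decayRate α β γ C ^ ((k - 7) / 8)
  have hθ : 0 ≤ θ := pow_nonneg (decayRate_pos hα hβ γ C).le _
  rw [← Finset.sum_sub_distrib]
  set z := ∑ t ∈ 𝒯.elems, (φ t - ψ t) with hz
  have hIz : I z = 0 := by
    rw [hz, map_sum]
    exact Finset.sum_eq_zero fun t ht => by rw [map_sub, (hφ t ht).1, (hψ t ht).1.1, sub_zero]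
  have htest : ∀ t ∈ 𝒯.elems, a univ (φ t - ψ t) z ^ 2 ≤
      e univ (φ t - ψ t) * (β ^ 2 * (4 * K * e (patch 𝒯 (k + 6) t) z)) := by
    intro t ht
    -- the cutoff `w` of `z` with `l + 2 = k` has no energy on the `k`-th patch, which contains both the
    -- element and the support of `ψ t`
    obtain ⟨l, rfl⟩ := Nat.exists_eq_add_of_le' (show 2 ≤ k by omega)
    obtain ⟨w, hw, hw0, hw1, hw2⟩ := hV.exists_fine_cutoff ht l hIz
    have g1 : a univ (φ t) w = 0 := by
      rw [(hφ t ht).2 w hw]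
      refine hV.form_eq_zero (measurableSet_tri t) v ?_
      exact he.eq_zero_of_subset (measurableSet_tri t) (mP _ _)
        (patch_mono ht (Nat.zero_le (l + 2))) hw0
    have g2 : a univ (ψ t) w = 0 := by
      rw [hV.form_comm, ← hV.form_eq_form_univ (isClosed_patch (l + 2) t) w (hψ t ht).1.2,
        hV.form_comm]
      exact hV.form_eq_zero (mP _ _) _ hw0
    have g3 : a univ (φ t - ψ t) z = a univ (φ t - ψ t) (z - w) := by
      rw [hV.form_sub_right mU _ z, hV.form_sub_left mU _ _ w, g1, g2, sub_zero, sub_zero]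
    have g4 : e (patch 𝒯 (l + 8) t)ᶜ (z - w) = 0 :=
      he.eq_zero_of_subset (mP _ _).compl (mP (l + 7) _).compl
        (compl_subset_compl.2 (patch_mono ht (by omega)))
        (hV.energy_eq_zero (isClosed_patch _ _).isOpen_compl hw1)
    have g5 := he.add_compl (mP (l + 8) t) (z - w)
    have g6 := he.sub_le (mP (l + 8) t) z w
    have g7 : e (patch 𝒯 (l + 8) t \ patch 𝒯 l t) z ≤ e (patch 𝒯 (l + 8) t) z :=
      he.mono_set ((mP _ _).diff (mP _ _)) (mP _ _) sdiff_subset z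
    have g8 := he.nonneg (patch 𝒯 (l + 8) t) z
    have g9 : e univ (z - w) ≤ 4 * K * e (patch 𝒯 (l + 8) t) z := by nlinarith
    rw [g3]
    refine (hV.sq_form_le mU _ _).trans ?_
    have g10 := mul_le_mul_of_nonneg_left g9
      (mul_nonneg (sq_nonneg β) (he.nonneg univ (φ t - ψ t)))
    change _ ≤ _ * (β ^ 2 * (4 * K * e (patch 𝒯 (l + 8) t) z))
    linarith
  have hsum1 : ∑ t ∈ 𝒯.elems, e univ (φ t - ψ t) ≤
      3 * K * (β / α) ^ 4 * θ * (overlap γ * e univ v) := by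
    calc ∑ t ∈ 𝒯.elems, e univ (φ t - ψ t)
        ≤ ∑ t ∈ 𝒯.elems, 3 * K * (β / α) ^ 4 * θ * e (nbhd 𝒯 (tri t)) v := by
          refine Finset.sum_le_sum fun t ht => ?_
          refine (hV.energy_sub_localCorrector_le hα hβ ht hk (hφ t ht).1 (hφ t ht).2
            (hψ t ht).1.1 (hψ t ht).1.2 (hψ t ht).2).trans ?_
          exact mul_le_mul_of_nonneg_left (he.mono_set (measurableSet_tri t)
            (measurableSet_nbhd _) (tri_subset_nbhd ht) v) (by positivity)
      _ ≤ _ := by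
          rw [← Finset.mul_sum]
          exact mul_le_mul_of_nonneg_left (he.sum_nbhd_le hq v subset_rfl mU
            fun _ _ => subset_univ _) (by positivity)
  -- this overlap count is the source of the polynomial factor
  have hsum2 : ∑ t ∈ 𝒯.elems, e (patch 𝒯 (k + 6) t) z ≤ (4 * γ * (k + 7)) ^ 2 * e univ z := by
    refine he.sum_le _ (fun t => patch 𝒯 (k + 6) t) (fun t _ => mP _ t) mU
      (fun _ _ => subset_univ _) (fun x G hG hx => ?_) z
    refine (hq.card_le (k + 6) x G hG hx).trans (le_of_eq ?_)
    push_cast; ring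
  have hzz : a univ z z = ∑ t ∈ 𝒯.elems, a univ (φ t - ψ t) z :=
    (map_sum (hV.bilin mU z) (fun t => φ t - ψ t) 𝒯.elems).trans
      (Finset.sum_congr rfl fun t _ => hV.form_comm univ z (φ t - ψ t))
  -- Cauchy–Schwarz for the sum over the elements
  have hcs : a univ z z ^ 2 ≤ (3 * K * (β / α) ^ 4 * θ * (overlap γ * e univ v)) *
      (β ^ 2 * (4 * K * ((4 * γ * (k + 7)) ^ 2 * e univ z))) := by
    rw [hzz]
    refine (Finset.sum_sq_le_sum_mul_sum_of_sq_le_mul _ (fun t _ => he.nonneg _ _)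
      (fun t _ => ?_) htest).trans ?_
    · have := he.nonneg (patch 𝒯 (k + 6) t) z
      positivity
    · refine mul_le_mul hsum1 ?_ (Finset.sum_nonneg fun t _ => ?_) ?_
      · rw [← Finset.mul_sum, ← Finset.mul_sum]
        gcongr
      · have := he.nonneg (patch 𝒯 (k + 6) t) z
        positivity
      · have := he.nonneg univ v
        have := overlap_nonneg γ
        positivity
  rcases (he.nonneg univ z).eq_or_lt with h0 | h0
  · rw [← h0, truncConst]
    have := he.nonneg univ v
    have := overlap_nonneg γ
    positivity
  · have h1 := (pow_le_pow_left₀ (mul_nonneg hα.le h0.le) (hV.le_form mU z) 2).trans hcs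
    have h2 : α ^ 2 * e univ z ≤ 192 * K ^ 2 * (β / α) ^ 4 * β ^ 2 * overlap γ * γ ^ 2 *
        (k + 7) ^ 2 * θ * e univ v := by
      refine le_of_mul_le_mul_right ?_ h0
      linarith
    have h3 : truncConst α β γ C * (k + 7) ^ 2 * θ * e univ v =
        (192 * K ^ 2 * (β / α) ^ 4 * β ^ 2 * overlap γ * γ ^ 2 *
        (k + 7) ^ 2 * θ * e univ v) / α ^ 2 := by
      rw [truncConst, ← hKdef]
      field_simp
    rw [h3, le_div_iff₀ (by positivity)]
    linarith

/-- The factor in the global localization error decays exponentially: the polynomial is absorbed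
at the expense of half of the rate. -/
theorem exists_exp_bound {M θ : ℝ} (hM : 0 ≤ M) (hθ : 0 < θ) (hθ1 : θ < 1) :
    ∃ D > 0, ∃ c > 0, ∀ k : ℕ, 7 ≤ k →
      M * (k + 7) ^ 2 * θ ^ ((k - 7) / 8) ≤ (D * Real.exp (-c * k)) ^ 2 := by
  set r := -Real.log θ with hr
  have hr0 : 0 < r := neg_pos.2 (Real.log_neg hθ hθ1)
  set B := M * (4 / (r / 32) ^ 2) * Real.exp (14 * r / 8) with hB
  have hB0 : 0 ≤ B := by positivity
  refine ⟨√(B + 1), by positivity, r / 32, by positivity, fun k hk => ?_⟩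
  have hk' : (7 : ℝ) ≤ k := by exact_mod_cast hk
  -- rounding down in `(k - 7) / 8` loses at most `14 / 8`
  have h1 : θ ^ ((k - 7) / 8) ≤ Real.exp (14 * r / 8) * Real.exp (-(r * k) / 8) := by
    have e1 : θ ^ ((k - 7) / 8) = Real.exp (-(r * ((k - 7) / 8 : ℕ))) := by
      rw [hr, neg_mul, neg_neg, mul_comm, Real.exp_nat_mul, Real.exp_log hθ]
    rw [e1, ← Real.exp_add]
    refine Real.exp_le_exp.2 ?_
    have e2 : (k : ℝ) ≤ 8 * ((k - 7) / 8 : ℕ) + 14 := by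
      have : k ≤ 8 * ((k - 7) / 8) + 14 := by omega
      exact_mod_cast this
    nlinarith
  have h2 : ((k : ℝ) + 7) ^ 2 ≤ 4 / (r / 32) ^ 2 * Real.exp (r * k / 16) := by
    have e1 : r / 32 * k ≤ Real.exp (r / 32 * k) :=
      (le_add_of_nonneg_right zero_le_one).trans (Real.add_one_le_exp _)
    have e2 : (k : ℝ) + 7 ≤ 2 / (r / 32) * Real.exp (r / 32 * k) := by
      rw [div_mul_eq_mul_div, le_div_iff₀ (by positivity)]
      nlinarith
    have e3 : Real.exp (r * k / 16) = Real.exp (r / 32 * k) ^ 2 := by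
      rw [← Real.exp_nat_mul]; congr 1; push_cast; ring
    calc ((k : ℝ) + 7) ^ 2 ≤ (2 / (r / 32) * Real.exp (r / 32 * k)) ^ 2 :=
          pow_le_pow_left₀ (by positivity) e2 2
      _ = _ := by rw [e3, mul_pow, div_pow]; norm_num
  have h3 : Real.exp (-(r / 32) * k) ^ 2 = Real.exp (r * k / 16) * Real.exp (-(r * k) / 8) := by
    rw [← Real.exp_nat_mul, ← Real.exp_add]; congr 1; push_cast; ring
  calc M * (k + 7) ^ 2 * θ ^ ((k - 7) / 8)
      ≤ M * (4 / (r / 32) ^ 2 * Real.exp (r * k / 16)) *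
          (Real.exp (14 * r / 8) * Real.exp (-(r * k) / 8)) := by gcongr
    _ = B * Real.exp (-(r / 32) * k) ^ 2 := by rw [h3, hB]; ring
    _ ≤ (B + 1) * Real.exp (-(r / 32) * k) ^ 2 := by gcongr; linarith
    _ = _ := by rw [mul_pow, Real.sq_sqrt (by positivity)]

end Decay

/-! ### The space `V` is localized -/

section Instance

variable {Ω : Set Plane} {Γ : Interface Ω} {𝒯 : Triangulation Ω} {H γ C α β : ℝ}
  {A AΓ : Plane → ℝ} {I : V Ω Γ →ₗ[ℝ] V Ω Γ}

theorem add_sq_le_of_add_le {a b p q K : ℝ} (ha : 0 ≤ a) (hb : 0 ≤ b)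
    (h : a + b ≤ K * (p + q)) : a ^ 2 + b ^ 2 ≤ 2 * K ^ 2 * (p ^ 2 + q ^ 2) := by
  have h1 : (a + b) ^ 2 ≤ (K * (p + q)) ^ 2 := pow_le_pow_left₀ (add_nonneg ha hb) h 2
  nlinarith [mul_nonneg ha hb, mul_nonneg (sq_nonneg K) (sq_nonneg (p - q))]

/-- The interpolation error estimate in squared form. -/
theorem IsInterpolation.massOn_sub_le (hI : IsInterpolation 𝒯 H C I) (v : V Ω Γ)
    {t : Finset Plane} (ht : t ∈ 𝒯.elems) :
    massOn (tri t) (v - I v) ≤ 2 * (C * H) ^ 2 * energyOn (nbhd 𝒯 (tri t)) v :=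
  ((massOn_eq (tri t) (v - I v)).trans_le (add_sq_le_of_add_le (Real.sqrt_nonneg _)
    (Real.sqrt_nonneg _) (hI.error v t ht))).trans_eq
    (congrArg _ (energyOn_eq (nbhd 𝒯 (tri t)) v).symm)

/-- The stability estimate in squared form. -/
theorem IsInterpolation.energyOn_map_le (hI : IsInterpolation 𝒯 H C I) (v : V Ω Γ)
    {t : Finset Plane} (ht : t ∈ 𝒯.elems) :
    energyOn (tri t) (I v) ≤ 2 * C ^ 2 * energyOn (nbhd 𝒯 (tri t)) v :=
  ((energyOn_eq (tri t) (I v)).trans_le (add_sq_le_of_add_le (Real.sqrt_nonneg _)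
    (Real.sqrt_nonneg _) (hI.stability v t ht))).trans_eq
    (congrArg _ (energyOn_eq (nbhd 𝒯 (tri t)) v).symm)

theorem sqNormOn_smul_le {E : Type*} [NormedAddCommGroup E] [NormedSpace ℝ E] {S : Set Plane}
    (hS : MeasurableSet S) (c : ℝ) (f : Lp E 2 (volume.restrict Ω : Measure Plane))
    (g : InterfaceL2 Γ) : sqNormOn Γ S (c • f) (c • g) ≤ c ^ 2 * sqNormOn Γ S f g := by
  suffices h : sqNormOn Γ S (c • f) (c • g) ≤
      c ^ 2 * sqNormOn Γ S f g + 0 * sqNormOn Γ S f g by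
    rwa [zero_mul, add_zero] at h
  refine sqNormOn_le_of_ae hS _ _ _ _ _ _ _ _ ?_ fun i => ?_
  · filter_upwards [Lp.coeFn_smul c f] with x hx _
    rw [hx, Pi.smul_apply, norm_smul, mul_pow, Real.norm_eq_abs, sq_abs, zero_mul, add_zero]
  · filter_upwards [Lp.coeFn_smul c (g i)] with s hs _
    rw [Pi.smul_apply, hs, Pi.smul_apply, smul_eq_mul, mul_pow, zero_mul, add_zero]

theorem isLocalEnergy_energyOn (hΩ : MeasurableSet Ω) :
    IsLocalEnergy Ω (energyOn (Ω := Ω) (Γ := Γ)) where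
  nonneg := energyOn_nonneg
  mono hS hS' h _ := sqNormOn_mono hΩ hS hS' h
  add_diff hS hS' h _ := sqNormOn_add_diff hS hS' h
  le_sum F T hT _ hS h _ := sqNormOn_le_sum hΩ F T hT hS h
  sum_le F T hT _ hS hTS _ h _ := sum_sqNormOn_le F T hT hS hTS h
  add_le hS v w := energyOn_add_le hS v w
  smul_le hS c v := sqNormOn_smul_le hS c (grad v) (tgrad v)

theorem isLocalEnergy_massOn (hΩ : MeasurableSet Ω) :
    IsLocalEnergy Ω (massOn (Ω := Ω) (Γ := Γ)) where
  nonneg := massOn_nonneg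
  mono hS hS' h _ := sqNormOn_mono hΩ hS hS' h
  add_diff hS hS' h _ := sqNormOn_add_diff hS hS' h
  le_sum F T hT _ hS h _ := sqNormOn_le_sum hΩ F T hT hS h
  sum_le F T hT _ hS hTS _ h _ := sum_sqNormOn_le F T hT hS hTS h
  add_le hS v w := massOn_add_le hS v w
  smul_le hS c v := sqNormOn_smul_le hS c (val v) (trace v)

theorem norm_sq_eq_integral {X E : Type*} [MeasurableSpace X] {μ : Measure X}
    [NormedAddCommGroup E] [InnerProductSpace ℝ E] (f : Lp E 2 μ) :
    ‖f‖ ^ 2 = ∫ x, ‖f x‖ ^ 2 ∂μ := by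
  rw [← real_inner_self_eq_norm_sq f, L2.inner_def]
  simp only [real_inner_self_eq_norm_sq]

theorem sqNormOn_univ {E : Type*} [NormedAddCommGroup E] [InnerProductSpace ℝ E]
    (f : Lp E 2 (volume.restrict Ω : Measure Plane)) (g : InterfaceL2 Γ) :
    sqNormOn Γ univ f g = ‖f‖ ^ 2 + ∑ i, ‖g i‖ ^ 2 := by
  have h : ∀ i, Γ.params i univ = Ioo 0 (Γ.len i) := fun i => by simp [Interface.params]
  simp only [sqNormOn, univ_inter, h, norm_sq_eq_integral, Real.norm_eq_abs, sq_abs]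

theorem norm_le_sqrt_sqNormOn {E : Type*} [NormedAddCommGroup E] [InnerProductSpace ℝ E]
    (f : Lp E 2 (volume.restrict Ω : Measure Plane)) (g : InterfaceL2 Γ) :
    ‖f‖ ≤ √(sqNormOn Γ univ f g) ∧ ‖g‖ ≤ √(sqNormOn Γ univ f g) := by
  have h0 : 0 ≤ ∑ i, ‖g i‖ ^ 2 := Finset.sum_nonneg fun i _ => sq_nonneg _
  rw [sqNormOn_univ]
  refine ⟨Real.le_sqrt_of_sq_le (by linarith),
    (pi_norm_le_iff_of_nonneg (Real.sqrt_nonneg _)).2 fun i => Real.le_sqrt_of_sq_le ?_⟩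
  have := Finset.single_le_sum (f := fun i => ‖g i‖ ^ 2) (fun i _ => sq_nonneg _)
    (Finset.mem_univ i)
  have := sq_nonneg ‖f‖
  linarith

theorem sqNormOn_univ_le {E : Type*} [NormedAddCommGroup E] [InnerProductSpace ℝ E]
    (f : Lp E 2 (volume.restrict Ω : Measure Plane)) (g : InterfaceL2 Γ) {r : ℝ}
    (hf : ‖f‖ ≤ r) (hg : ‖g‖ ≤ r) : sqNormOn Γ univ f g ≤ (1 + Γ.n) * r ^ 2 := by
  rw [sqNormOn_univ, add_mul, one_mul]
  refine add_le_add (pow_le_pow_left₀ (norm_nonneg _) hf 2) ?_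
  refine (Finset.sum_le_card_nsmul _ _ (r ^ 2) fun i _ =>
    pow_le_pow_left₀ (norm_nonneg _) ((norm_le_pi_norm g i).trans hg) 2).trans (le_of_eq ?_)
  simp

theorem norm_le_sqrt_energyOn_add_massOn (x : V Ω Γ) :
    ‖x‖ ≤ √(energyOn univ x + massOn univ x) := by
  obtain ⟨h1, h2⟩ := norm_le_sqrt_sqNormOn (grad x) (tgrad x)
  obtain ⟨h3, h4⟩ := norm_le_sqrt_sqNormOn (val x) (trace x)
  have e1 : √(energyOn univ x) ≤ √(energyOn univ x + massOn univ x) :=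
    Real.sqrt_le_sqrt (le_add_of_nonneg_right (massOn_nonneg univ x))
  have e2 : √(massOn univ x) ≤ √(energyOn univ x + massOn univ x) :=
    Real.sqrt_le_sqrt (le_add_of_nonneg_left (energyOn_nonneg univ x))
  exact max_le (max_le (h3.trans e2) (max_le (h1.trans e1) (h4.trans e2))) (h2.trans e1)

theorem energyOn_add_massOn_le (x : V Ω Γ) :
    energyOn univ x + massOn univ x ≤ 2 * (1 + Γ.n) * ‖x‖ ^ 2 := by
  have h1 : ‖x.1.1‖ ≤ ‖x‖ := le_max_left _ _
  have h2 : ‖tgrad x‖ ≤ ‖x‖ := le_max_right _ _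
  have h3 : ‖val x‖ ≤ ‖x‖ := (le_max_left _ _).trans h1
  have h4 : ‖x.1.1.2‖ ≤ ‖x‖ := (le_max_right _ _).trans h1
  have h5 : ‖grad x‖ ≤ ‖x‖ := (le_max_left _ _).trans h4
  have h6 : ‖trace x‖ ≤ ‖x‖ := (le_max_right _ _).trans h4
  have h7 : energyOn univ x ≤ (1 + Γ.n) * ‖x‖ ^ 2 := sqNormOn_univ_le _ _ h5 h2
  have h8 : massOn univ x ≤ (1 + Γ.n) * ‖x‖ ^ 2 := sqNormOn_univ_le _ _ h3 h6
  linarith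

/-- Completeness in terms of the square `q` of an equivalent norm. -/
theorem exists_sq_norm_sub_lt {X : Type*} [NormedAddCommGroup X] [CompleteSpace X] {q : X → ℝ}
    {M : ℝ} (hM : 0 < M) (h0 : ∀ x, 0 ≤ q x) (h1 : ∀ x, ‖x‖ ≤ √(q x)) (h2 : ∀ x, q x ≤ M * ‖x‖ ^ 2)
    (u : ℕ → X) (hu : ∀ ε > 0, ∃ N, ∀ i ≥ N, ∀ j ≥ N, q (u i - u j) < ε) :
    ∃ x, ∀ ε > 0, ∃ N, ∀ i ≥ N, q (u i - x) < ε := by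
  have hc : CauchySeq u := Metric.cauchySeq_iff.2 fun ε hε => by
    obtain ⟨N, hN⟩ := hu (ε ^ 2) (by positivity)
    refine ⟨N, fun i hi j hj => ?_⟩
    have h3 := Real.sqrt_lt_sqrt (h0 _) (hN i hi j hj)
    rw [Real.sqrt_sq hε.le] at h3
    exact (dist_eq_norm (u i) (u j)).trans_lt ((h1 _).trans_lt h3)
  obtain ⟨x, hx⟩ := cauchySeq_tendsto_of_complete hc
  refine ⟨x, fun ε hε => ?_⟩
  obtain ⟨N, hN⟩ := Metric.tendsto_atTop.1 hx (√(ε / M)) (by positivity)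
  refine ⟨N, fun i hi => (h2 _).trans_lt ?_⟩
  have h3 := (dist_eq_norm (u i) x).symm.trans_lt (hN i hi)
  have h4 := (Real.lt_sqrt (norm_nonneg _)).1 h3
  rw [lt_div_iff₀ hM] at h4
  linarith

/-- The space `V` with its energy, mass, interpolation and forms satisfies the requirements of the
abstract analysis. -/
theorem isLocalized_V (hα : 0 ≤ α) (hβ : 0 ≤ β) (hq : QuasiUniform 𝒯 H γ)
    (hA : IsPermeability Γ A AΓ α β) (hI : IsInterpolation 𝒯 H C I) :
    IsLocalized 𝒯 H γ C α β energyOn massOn I (form A AΓ) where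
  quasiUniform := hq
  energy := isLocalEnergy_energyOn 𝒯.measurableSet
  mass := isLocalEnergy_massOn 𝒯.measurableSet
  definite _ h h' := eq_zero_of_energyOn_massOn h h'
  complete := exists_sq_norm_sub_lt (q := fun x => energyOn univ x + massOn univ x)
    (show (0 : ℝ) < 2 * (1 + Γ.n) by positivity)
    (fun x => add_nonneg (energyOn_nonneg univ x) (massOn_nonneg univ x))
    norm_le_sqrt_energyOn_add_massOn energyOn_add_massOn_le
  energy_eq_zero hG _ h := energyOn_eq_zero_of_massOn_eq_zero 𝒯.isOpen 𝒯.isBounded hG h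
  map_map v := hI.proj _ (hI.coarse v)
  mass_sub_le v _ ht := hI.massOn_sub_le v ht
  energy_map_le v _ ht := hI.energyOn_map_le v ht
  exists_cutoff _ ht j v := hq.exists_cutoff ht j v
  form_comm := form_comm
  form_add_left hS := form_add_left hA hS
  form_smul_left hS := form_smul_left hS
  form_add_diff hS hS' h := form_add_diff hA hS hS' h
  le_form hS := le_form_self hA hS
  sq_form_le hS := sq_form_le hα hβ hA hS

/-- Local correctors in terms of `massOn`, the form used in the abstract analysis. -/
theorem isLocalCorrector_iff (k : ℕ) (t : Finset Plane) (v φ : V Ω Γ) :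
    IsLocalCorrector 𝒯 A AΓ I k t v φ ↔ (I φ = 0 ∧ massOn (patch 𝒯 k t)ᶜ φ = 0) ∧
      ∀ w, I w = 0 → massOn (patch 𝒯 k t)ᶜ w = 0 →
        form A AΓ (patch 𝒯 k t) φ w = form A AΓ (tri t) v w := by
  have hs := fun w : V Ω Γ => supportedIn_iff_massOn_eq_zero (measurableSet_patch (𝒯 := 𝒯) k t) w
  exact ⟨fun h => ⟨⟨h.1.1, (hs φ).1 h.1.2⟩, fun w h1 h2 => h.2 w h1 ((hs w).2 h2)⟩,
    fun h => ⟨⟨h.1.1, (hs φ).2 h.1.2⟩, fun w h1 h2 => h.2 w h1 ((hs w).1 h2)⟩⟩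

/-- Passage from an estimate of squared norms to one of sums of norms, at the cost of a factor `2`. -/
theorem gradNormOn_add_tgradNormOn_le {S : Set Plane} {v z : V Ω Γ} {X Y : ℝ} (hX : 0 ≤ X)
    (h : energyOn S z ≤ X ^ 2 * energyOn S v) (hY : 2 * X ≤ Y) :
    gradNormOn S z + tgradNormOn S z ≤ Y * (gradNormOn S v + tgradNormOn S v) := by
  have h1 : 0 ≤ gradNormOn S v := Real.sqrt_nonneg _
  have h2 : 0 ≤ tgradNormOn S v := Real.sqrt_nonneg _
  have h' := ((energyOn_eq S z).symm.trans_le h).trans_eq (congrArg _ (energyOn_eq S v))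
  refine le_trans ?_ (mul_le_mul_of_nonneg_right hY (add_nonneg h1 h2))
  refine le_of_sq_le_sq ?_ (by positivity)
  have h3 := mul_nonneg (sq_nonneg X) (mul_nonneg h1 h2)
  have h4 := mul_nonneg (sq_nonneg X) (sq_nonneg (gradNormOn S v + tgradNormOn S v))
  nlinarith [sq_nonneg (gradNormOn S z - tgradNormOn S z)]

end Instance

end LOD

end

/-! ### The global truncation error -/

set_option maxHeartbeats 1000000 in
theorem theorem3 (α β γ C_I : ℝ) (hα : 0 < α) (hαβ : α ≤ β) (hC_I : 0 < C_I) :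
    ∃ C > 0, ∃ c > 0,
      ∀ (Ω : Set LOD.Plane) (_ : IsConnected Ω)
        (𝒯 : LOD.Triangulation Ω) (H : ℝ) (_ : LOD.QuasiUniform 𝒯 H γ)
        (Γ : LOD.Interface Ω)
        (A AΓ : LOD.Plane → ℝ) (_ : LOD.IsPermeability Γ A AΓ α β)
        (I : LOD.V Ω Γ →ₗ[ℝ] LOD.V Ω Γ) (_ : LOD.IsInterpolation 𝒯 H C_I I)
        (v : LOD.V Ω Γ) (_ : LOD.IsCoarse 𝒯 v) (k : ℕ) (_ : 7 ≤ k),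
        (∀ t ∈ 𝒯.elems, ∃! φ, LOD.IsCorrector A AΓ I t v φ) ∧
        (∀ t ∈ 𝒯.elems, ∃! φ, LOD.IsLocalCorrector 𝒯 A AΓ I k t v φ) ∧
        ∀ (φ φk : Finset LOD.Plane → LOD.V Ω Γ),
          (∀ t ∈ 𝒯.elems, LOD.IsCorrector A AΓ I t v (φ t)) →
          (∀ t ∈ 𝒯.elems, LOD.IsLocalCorrector 𝒯 A AΓ I k t v (φk t)) →
          LOD.gradNormOn Set.univ (∑ t ∈ 𝒯.elems, φ t - ∑ t ∈ 𝒯.elems, φk t) +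
              LOD.tgradNormOn Set.univ (∑ t ∈ 𝒯.elems, φ t - ∑ t ∈ 𝒯.elems, φk t) ≤
            C * (k : ℝ) ^ (1 / 2 : ℝ) * Real.exp (-c * k) *
              (LOD.gradNormOn Set.univ v + LOD.tgradNormOn Set.univ v) := by
  have hβ : 0 < β := hα.trans_le hαβ
  have hM : 0 ≤ LOD.truncConst α β γ C_I := by
    have h1 := LOD.one_le_cutConst γ C_I
    have h2 := LOD.overlap_nonneg γ
    rw [LOD.truncConst]
    positivity
  obtain ⟨D, hD, c, hc, hDc⟩ := LOD.exists_exp_bound hM (LOD.decayRate_pos hα hβ γ C_I)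
    (LOD.decayRate_lt_one hα hβ γ C_I)
  -- the factor `k ^ (1 / 2) ≥ 1` is inserted afterwards; the exponential alone absorbs the polynomial
  have hDk : ∀ k : ℕ, 7 ≤ k →
      2 * (D * Real.exp (-c * k)) ≤ 2 * D * (k : ℝ) ^ (1 / 2 : ℝ) * Real.exp (-c * k) := by
    intro k hk
    rw [← mul_assoc, mul_right_comm (2 * D)]
    have hk1 : 1 ≤ (k : ℝ) ^ (1 / 2 : ℝ) :=
      Real.one_le_rpow (by exact_mod_cast (show 1 ≤ k by omega)) (by norm_num)
    exact le_mul_of_one_le_right (by positivity) hk1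
  refine ⟨2 * D, by positivity, c, hc, ?_⟩
  intro Ω _ 𝒯 H hq Γ A AΓ hA I hI v _ k hk
  have hV := LOD.isLocalized_V hα.le hβ.le hq hA hI
  refine ⟨fun t _ => hV.existsUnique_corrector hα hβ.le t v, fun t _ => ?_, fun φ ψ hφ hψ => ?_⟩
  · exact (existsUnique_congr (LOD.isLocalCorrector_iff k t v)).2
      (hV.existsUnique_localCorrector hα hβ.le (LOD.isClosed_patch k t) t v)
  · have h := LOD.IsLocalized.energy_sum_sub_le hV hα hβ hk hφ fun t ht =>
      hV.form_univ_eq_of_localCorrector ((LOD.isLocalCorrector_iff k t v (ψ t)).1 (hψ t ht))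
    exact LOD.gradNormOn_add_tgradNormOn_le (mul_nonneg hD.le (Real.exp_nonneg _))
      (h.trans (mul_le_mul_of_nonneg_right (hDc k hk) (LOD.energyOn_nonneg Set.univ v)))
      (hDk k hk)
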